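/- Let $d\ge 2$, let $0<\delta<1$, and let $(S_k)_{k\ge 0}$ be a simple random walk on $\mathbb Z^d$ started at the origin, with law $P$. For $n\in\mathbb N$ let $R(n)=\{S_0,\dots,S_n\}$ be its range and let $K(n,x)=\sum_{j=0}^n 1_{\{S_j=x\}}$ be the number of visits to $x$ up to time $n$. For $a\in\mathbb Z^d$ let $\mathcal N(a)=\{z\in\mathbb Z^d:|a-z|=1\}$ (Euclidean norm), and for $A\subset\mathbb Z^d$ let $\partial A=\{x\in A:\mathcal N(x)\not\subset A\}$ be its inner boundary. Let $T_x=\inf\{m\ge 1:S_m=x\}$ (with $\inf\emptyset=\infty$). Let $b\in\mathcal N(0)$ be any neighbor of the origin and put $$\beta_d=\frac{1}{-\log P(T_0<T_b)}$$ (by symmetry the value is the same for every such $b$, so it depends only on $d$). Define $$\Theta_n(\delta)=\#\Big\{x\in\partial R(n):\ \frac{K(n,x)}{\log n}\ge\beta_d\,\delta\Big\}.$$ Then $$\lim_{n\to\infty}\frac{\log\Theta_n(\delta)}{\log n}=1-\delta\qquad\text{almost surely.}$$ -/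

import Mathlib

open Filter Topology MeasureTheory ProbabilityTheory
open scoped ENNReal

noncomputable section

/-- The set `𝒩(a)` of neighbours of `a` in `ℤ^d`: the `z` at Euclidean distance `1` from `a`
(for lattice points, `|z - a| = 1` iff `|z - a|² = 1`). -/
def latticeNeighbors {d : ℕ} (a : Fin d → ℤ) : Set (Fin d → ℤ) :=
  {z | ∑ i, (z i - a i) ^ 2 = 1}

/-- The inner boundary `∂A` of `A ⊆ ℤ^d`: the points of `A` having a neighbour outside `A`. -/
def innerBoundary {d : ℕ} (A : Set (Fin d → ℤ)) : Set (Fin d → ℤ) :=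
  {x | x ∈ A ∧ ¬ latticeNeighbors x ⊆ A}

/-- `S` is, under `μ`, a simple random walk on `ℤ^d` started at the origin: the increments are
independent and each is uniformly distributed over the `2d` neighbours of the origin. -/
structure IsSimpleRandomWalk {Ω : Type*} [MeasurableSpace Ω] {d : ℕ}
    (S : ℕ → Ω → Fin d → ℤ) (μ : Measure Ω) : Prop where
  measurable : ∀ k, Measurable (S k)
  start : ∀ᵐ ω ∂μ, S 0 ω = 0
  indep : iIndepFun (fun k ω => S (k + 1) ω - S k ω) μ
  uniform : ∀ k, ∀ e ∈ latticeNeighbors (0 : Fin d → ℤ),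
    μ {ω | S (k + 1) ω - S k ω = e} = (2 * (d : ℝ≥0∞))⁻¹

/-- The range `R(n) = {S_0, …, S_n}` of the path `ω`. -/
def walkRange {Ω : Type*} {d : ℕ} (S : ℕ → Ω → Fin d → ℤ) (n : ℕ) (ω : Ω) :
    Set (Fin d → ℤ) :=
  {x | ∃ j ≤ n, S j ω = x}

/-- The number `K(n, x)` of visits to `x` by `S_0, …, S_n`. -/
def visitCount {Ω : Type*} {d : ℕ} (S : ℕ → Ω → Fin d → ℤ) (n : ℕ) (x : Fin d → ℤ)
    (ω : Ω) : ℕ :=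
  ∑ j ∈ Finset.range (n + 1), if S j ω = x then 1 else 0

/-- The first passage time `T_x = inf {m ≥ 1 : S_m = x}`, equal to `⊤` if there is no such `m`. -/
def firstPassage {Ω : Type*} {d : ℕ} (S : ℕ → Ω → Fin d → ℤ) (x : Fin d → ℤ) :
    Ω → WithTop ℕ :=
  hittingAfter S {x} 1

/-- The constant `β_d = 1 / (-log P(T_0 < T_b))`, where `b` is a neighbour of the origin. It is a
function of the law of the walk, which depends only on `d`. -/
def betaConst {Ω : Type*} [MeasurableSpace Ω] {d : ℕ} (S : ℕ → Ω → Fin d → ℤ)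
    (μ : Measure Ω) (b : Fin d → ℤ) : ℝ :=
  1 / (-Real.log (μ.real {ω | firstPassage S 0 ω < firstPassage S b ω}))

/-- The number of inner boundary points `x` of `R(n)` with `K(n, x) / log n ≥ β δ`.
It counts a subset of the finite set `R(n)`. -/
def frequentCount {Ω : Type*} {d : ℕ} (S : ℕ → Ω → Fin d → ℤ) (β δ : ℝ) (n : ℕ) (ω : Ω) : ℕ :=
  {x | x ∈ innerBoundary (walkRange S n ω) ∧
    (visitCount S n x ω : ℝ) / Real.log n ≥ β * δ}.ncard

end

/-!
A point `x` of the range up to time `n` that has `k` returns before its neighbour `x + b` is visited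
looks as follows: the first visit to `x` is followed by `k` excursions from `x` that avoid `x + b`.
The probability that a walk starts with `k` such excursions is `p ^ k` with `p = P(T_0 < T_b)`. For
`k ≈ β δ log n` and `β = 1 / (-log p)` this is about `n ^ (-δ)`, and there are about `n` times at
which such a point can be visited for the first time. So `n ^ (1 - δ)` such points are expected, and
it remains to compare this number with its mean.

All probabilities are averages over finite words of steps (`wordMean`, `wordProb`), which is the law
of the walk by `measure_stepWord`. The products of `k` excursions of length at most `T` form a code
`powCode (excursions N b T) k`, whose weight is the `k`-th power of a number that increases to `p`
as `T → ∞` (`PrefixFree.codeWeight_pow`,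
`tendsto_codeWeight_excursions`). It is enough to consider the
times `2 ^ j` and to apply the Borel–Cantelli lemma (`ae_eventually_not_stepWord`).

*Upper bound.* A frequent boundary point gives an occurrence of a product of excursions that avoid
some neighbour (`ncard_frequent_le`), so the first moment (`wordMean_occurrences_le`) and Markov's
inequality are enough.

*Lower bound.* Let `Z = {0, b, -b}`. A splitting `u ++ l ++ v` of the word of the steps, with `l` in
the code, is good if the walk avoids `x + Z` before it reaches, with the last step of `u`, the point
`x`, and again after `l` (`GoodSplit`). The good splittings that are not killed when the path is
continued give different boundary points (`goodCount_sub_killedCount_le`), even if the path is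
continued up to any time between `2 ^ j` and `2 ^ (j + 1)`. Their number `goodCount` has a mean of
order `n π q²`, where `π` is the weight of the code and `q` is the probability to escape from `Z` up
to time `n` (`le_wordMean_goodCount`).

The point is that `goodCount` is concentrated, and with a relative variance that is summable along
`n = 2 ^ j`. In dimension two `q` tends to `0`, but slowly: the walk hits a given point between the
times `2 ^ i` and `2 ^ (i + r)` with probability at most of order `(r + 1) / i`
(`exists_wordProb_hits_le`, from the heat kernel of the projection to two coordinates), so `q` at
the scale `2 ^ i` decays at most like a power of `i` (`exists_escapeProb_mul_pow_monotone`). The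
variance satisfies a recursion under doubling of `n` (`goodVar_double_le`):
the two halves of the word are
independent, and `goodCount` is additive up to the splittings of one half that are killed by the
other. Their second moment is of smaller order than `(n π q²)²` by a factor of order `j ^ (-3/2)`,
as two splittings have to escape in the past and in the future, which gives `q ^ 4`, and then both
have to be hit, which gives the square of the hitting probability (`wordMean_killedCount_sq_le`,
`wordMean_double_hit_le`); here the time scale up to which they have to escape is
`2 ^ (j - c)` with `c` of order `j ^ (1/4)`. This leads to `exists_wordProb_le_varScale`.
-/

noncomputable section

namespace LatticeWalk

open scoped Classical

/-! ### Averages over random words -/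

section Words

variable {V : Type*}

/-- The average of `f` over the words of length `n` with letters in `N`, all words being equally
likely. It is defined by averaging over the first letter. -/
def wordMean (N : Finset V) : ℕ → (List V → ℝ) → ℝ
  | 0, f => f []
  | n + 1, f => (∑ e ∈ N, wordMean N n (fun w => f (e :: w))) / N.card

/-- The probability that a uniformly random word of length `n` with letters in `N` satisfies
`P`. -/
def wordProb (N : Finset V) (n : ℕ) (P : List V → Prop) : ℝ :=
  wordMean N n (fun w => if P w then 1 else 0)

section Mean

variable (N : Finset V)

theorem wordMean_zero (f : List V → ℝ) : wordMean N 0 f = f [] := rfl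

theorem wordMean_succ (n : ℕ) (f : List V → ℝ) :
    wordMean N (n + 1) f = (∑ e ∈ N, wordMean N n (fun w => f (e :: w))) / N.card := rfl

theorem wordMean_mono {n : ℕ} : ∀ {f g : List V → ℝ},
    (∀ w, w.length = n → (∀ e ∈ w, e ∈ N) → f w ≤ g w) → wordMean N n f ≤ wordMean N n g := by
  induction n with
  | zero => intro f g h; exact h [] rfl (by simp)
  | succ n ih =>
    intro f g h
    rw [wordMean_succ, wordMean_succ]
    gcongr with e he
    refine ih fun w hw hN => h _ (by simp [hw]) ?_
    intro x hx
    rcases List.mem_cons.1 hx with rfl | hx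
    · exact he
    · exact hN x hx

theorem wordMean_congr {n : ℕ} {f g : List V → ℝ}
    (h : ∀ w, w.length = n → (∀ e ∈ w, e ∈ N) → f w = g w) : wordMean N n f = wordMean N n g :=
  le_antisymm (wordMean_mono N fun w hw hN => (h w hw hN).le)
    (wordMean_mono N fun w hw hN => (h w hw hN).ge)

theorem wordMean_add (n : ℕ) : ∀ f g : List V → ℝ,
    wordMean N n (fun w => f w + g w) = wordMean N n f + wordMean N n g := by
  induction n with
  | zero => intro f g; rfl
  | succ n ih =>
    intro f g
    simp only [wordMean_succ, ih, Finset.sum_add_distrib, add_div]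

theorem wordMean_const_mul (n : ℕ) (c : ℝ) : ∀ f : List V → ℝ,
    wordMean N n (fun w => c * f w) = c * wordMean N n f := by
  induction n with
  | zero => intro f; rfl
  | succ n ih =>
    intro f
    simp only [wordMean_succ, ih, ← Finset.mul_sum, mul_div_assoc]

theorem wordMean_mul_const (n : ℕ) (c : ℝ) (f : List V → ℝ) :
    wordMean N n (fun w => f w * c) = wordMean N n f * c := by
  simp only [mul_comm _ c, wordMean_const_mul]

theorem wordMean_sub (n : ℕ) (f g : List V → ℝ) :
    wordMean N n (fun w => f w - g w) = wordMean N n f - wordMean N n g := by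
  have h := wordMean_add N n f (fun w => (-1) * g w)
  rw [wordMean_const_mul] at h
  rw [sub_eq_add_neg, ← neg_one_mul (wordMean N n g), ← h]
  congr 1
  ext w
  ring

theorem wordMean_const_zero (n : ℕ) : wordMean N n (fun _ => 0) = 0 := by
  simpa using wordMean_const_mul N n 0 (fun _ => 0)

theorem wordMean_sum {ι : Type*} (n : ℕ) (s : Finset ι) (f : ι → List V → ℝ) :
    wordMean N n (fun w => ∑ i ∈ s, f i w) = ∑ i ∈ s, wordMean N n (f i) := by
  induction s using Finset.induction_on with
  | empty => simpa using wordMean_const_zero N n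
  | insert a s ha ih => simp only [Finset.sum_insert ha, wordMean_add, ih]

theorem wordMean_nonneg {n : ℕ} {f : List V → ℝ} (h : ∀ w, w.length = n → 0 ≤ f w) :
    0 ≤ wordMean N n f := by
  rw [← wordMean_const_zero N n]
  exact wordMean_mono N fun w hw _ => h w hw

theorem wordMean_const (hN : N.Nonempty) (n : ℕ) (c : ℝ) : wordMean N n (fun _ => c) = c := by
  have hc : (N.card : ℝ) ≠ 0 := by exact_mod_cast hN.card_pos.ne'
  induction n with
  | zero => rfl
  | succ n ih =>
    rw [wordMean_succ, ih, Finset.sum_const, nsmul_eq_mul]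
    field_simp

/-- A random word of length `m + n` consists of two independent random words. -/
theorem wordMean_append (m n : ℕ) : ∀ f : List V → ℝ,
    wordMean N (m + n) f = wordMean N m (fun u => wordMean N n (fun v => f (u ++ v))) := by
  induction m with
  | zero => intro f; simp [wordMean_zero]
  | succ m ih =>
    intro f
    rw [Nat.add_right_comm, wordMean_succ, wordMean_succ]
    simp only [ih, List.cons_append]

theorem wordMean_comm (m n : ℕ) (f : List V → List V → ℝ) :
    wordMean N m (fun u => wordMean N n (fun v => f u v))
      = wordMean N n (fun v => wordMean N m (fun u => f u v)) := by
  induction m generalizing f with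
  | zero => rfl
  | succ m ih =>
    simp only [wordMean_succ, ih]
    simp only [div_eq_inv_mul, wordMean_const_mul, wordMean_sum]

theorem wordMean_reverse (n : ℕ) : ∀ f : List V → ℝ,
    wordMean N n (fun w => f w.reverse) = wordMean N n f := by
  induction n with
  | zero => intro f; rfl
  | succ n ih =>
    intro f
    have h1 : wordMean N (n + 1) f
        = wordMean N n (fun u => wordMean N 1 (fun v => f (u ++ v))) := wordMean_append N n 1 f
    rw [h1, wordMean_comm, wordMean_succ, wordMean_succ]
    congr 1
    refine Finset.sum_congr rfl fun e _ => ?_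
    simp only [List.reverse_cons, wordMean_zero]
    exact ih (fun w => f (w ++ [e]))

theorem wordMean_map {N} (σ : V ≃ V) (hσ : ∀ e, σ e ∈ N ↔ e ∈ N) (n : ℕ) : ∀ f : List V → ℝ,
    wordMean N n (fun w => f (w.map σ)) = wordMean N n f := by
  induction n with
  | zero => intro f; rfl
  | succ n ih =>
    intro f
    rw [wordMean_succ, wordMean_succ]
    congr 1
    refine Finset.sum_equiv σ (fun e => (hσ e).symm) fun e _ => ?_
    simp only [List.map_cons]
    exact ih (fun w => f (σ e :: w))

theorem wordMean_ite (n : ℕ) (P : List V → Prop) [DecidablePred P] :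
    wordMean N n (fun w => if P w then 1 else 0) = wordProb N n P := by
  unfold wordProb
  congr!

theorem wordProb_mono {n : ℕ} {P Q : List V → Prop}
    (h : ∀ w, w.length = n → (∀ e ∈ w, e ∈ N) → P w → Q w) : wordProb N n P ≤ wordProb N n Q := by
  refine wordMean_mono N fun w hw hN => ?_
  by_cases hP : P w
  · simp [hP, h w hw hN hP]
  · simp only [hP, if_false]; split_ifs <;> norm_num

theorem wordProb_congr {n : ℕ} {P Q : List V → Prop}
    (h : ∀ w, w.length = n → (∀ e ∈ w, e ∈ N) → (P w ↔ Q w)) :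
    wordProb N n P = wordProb N n Q :=
  le_antisymm (wordProb_mono N fun w hw hN => (h w hw hN).1)
    (wordProb_mono N fun w hw hN => (h w hw hN).2)

theorem wordProb_nonneg (n : ℕ) (P : List V → Prop) : 0 ≤ wordProb N n P :=
  wordMean_nonneg N fun w _ => by split_ifs <;> norm_num

theorem wordProb_map {N} (σ : V ≃ V) (hσ : ∀ e, σ e ∈ N ↔ e ∈ N) (n : ℕ) (P : List V → Prop) :
    wordProb N n (fun w => P (w.map σ)) = wordProb N n P :=
  wordMean_map σ hσ n (fun w => if P w then 1 else 0)

theorem wordProb_reverse (n : ℕ) (P : List V → Prop) :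
    wordProb N n (fun w => P w.reverse) = wordProb N n P :=
  wordMean_reverse N n (fun w => if P w then 1 else 0)

theorem wordProb_le_one (hN : N.Nonempty) (n : ℕ) (P : List V → Prop) : wordProb N n P ≤ 1 := by
  rw [← wordMean_const N hN n 1]
  exact wordMean_mono N fun w _ _ => by split_ifs <;> norm_num

theorem wordProb_true (hN : N.Nonempty) {n : ℕ} {P : List V → Prop}
    (h : ∀ w, w.length = n → P w) : wordProb N n P = 1 := by
  rw [← wordMean_const N hN n 1]
  exact wordMean_congr N fun w hw _ => by simp [h w hw]

theorem wordProb_false {n : ℕ} {P : List V → Prop}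
    (h : ∀ w, w.length = n → (∀ e ∈ w, e ∈ N) → ¬ P w) : wordProb N n P = 0 := by
  rw [← wordMean_const_zero N n]
  exact wordMean_congr N fun w hw hN => by simp [h w hw hN]

theorem wordProb_zero (P : List V → Prop) : wordProb N 0 P = if P [] then 1 else 0 := rfl

theorem wordProb_succ (n : ℕ) (P : List V → Prop) :
    wordProb N (n + 1) P = (∑ e ∈ N, wordProb N n (fun w => P (e :: w))) / N.card := rfl

theorem wordProb_append (m n : ℕ) (P : List V → Prop) :
    wordProb N (m + n) P = wordMean N m (fun u => wordProb N n (fun v => P (u ++ v))) :=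
  wordMean_append N m n _

theorem wordProb_le_sum {ι : Type*} (n : ℕ) (s : Finset ι) (P : List V → Prop)
    (Q : ι → List V → Prop) (h : ∀ w, w.length = n → P w → ∃ i ∈ s, Q i w) :
    wordProb N n P ≤ ∑ i ∈ s, wordProb N n (Q i) := by
  unfold wordProb
  rw [← wordMean_sum]
  refine wordMean_mono N fun w hw _ => ?_
  have h0 : ∀ i ∈ s, (0 : ℝ) ≤ if Q i w then 1 else 0 := fun i _ => by split_ifs <;> norm_num
  by_cases hP : P w
  · obtain ⟨i, hi, hQ⟩ := h w hw hP
    have := Finset.single_le_sum h0 hi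
    rw [if_pos hQ] at this
    rwa [if_pos hP]
  · rw [if_neg hP]; exact Finset.sum_nonneg h0

theorem wordProb_or_le (n : ℕ) (P Q R : List V → Prop)
    (h : ∀ w, w.length = n → (∀ e ∈ w, e ∈ N) → P w → Q w ∨ R w) :
    wordProb N n P ≤ wordProb N n Q + wordProb N n R := by
  unfold wordProb
  rw [← wordMean_add]
  refine wordMean_mono N fun w hw hN => ?_
  have := h w hw hN
  by_cases hP : P w
  · rcases this hP with h | h <;> simp only [hP, h, if_true] <;> split_ifs <;> norm_num
  · simp only [hP, if_false]; split_ifs <;> norm_num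

theorem wordProb_mono_length (hN : N.Nonempty) {m n : ℕ} (hmn : m ≤ n) (P : List V → Prop)
    (h : ∀ u v, u.length = m → P u → P (u ++ v)) : wordProb N m P ≤ wordProb N n P := by
  obtain ⟨k, rfl⟩ := Nat.exists_eq_add_of_le hmn
  rw [wordProb_append]
  refine wordMean_mono N fun u hu _ => ?_
  by_cases hP : P u
  · rw [wordProb_true N hN (fun v _ => h u v hu hP)]; simp [hP]
  · simpa [hP] using wordProb_nonneg N _ _

theorem wordProb_anti_length (hN : N.Nonempty) {m n : ℕ} (hmn : m ≤ n) (P : List V → Prop)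
    (h : ∀ u v, u.length = m → P (u ++ v) → P u) : wordProb N n P ≤ wordProb N m P := by
  obtain ⟨k, rfl⟩ := Nat.exists_eq_add_of_le hmn
  rw [wordProb_append]
  refine wordMean_mono N fun u hu _ => ?_
  by_cases hP : P u
  · simpa [hP] using wordProb_le_one N hN _ _
  · rw [wordProb_false N (fun v _ _ hv => hP (h u v hu hv))]; simp [hP]

theorem wordProb_take (hN : N.Nonempty) {m n : ℕ} (hmn : m ≤ n)
    (P : List V → Prop) : wordProb N n (fun w => P (w.take m)) = wordProb N m P := by
  obtain ⟨k, rfl⟩ := Nat.exists_eq_add_of_le hmn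
  rw [wordProb_append]
  refine wordMean_congr N fun u hu _ => ?_
  by_cases hP : P u
  · rw [wordProb_true N hN (fun v _ => by rwa [List.take_append_of_le_length hu.ge,
      List.take_of_length_le hu.le]), if_pos hP]
  · rw [wordProb_false N (fun v _ _ => by rwa [List.take_append_of_le_length hu.ge,
      List.take_of_length_le hu.le]), if_neg hP]

/-- Markov's inequality. -/
theorem wordProb_le_of_mean (n : ℕ) (P : List V → Prop) (f : List V → ℝ) {t : ℝ} (ht : 0 < t)
    (hf : ∀ w, w.length = n → 0 ≤ f w) (h : ∀ w, w.length = n → P w → t ≤ f w) :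
    wordProb N n P ≤ wordMean N n f / t := by
  rw [le_div_iff₀ ht, wordProb, ← wordMean_mul_const]
  refine wordMean_mono N fun w hw _ => ?_
  by_cases hP : P w
  · simpa [hP] using h w hw hP
  · simpa [hP] using hf w hw

end Mean

/-! ### Hitting sets -/

variable [AddCommGroup V]

theorem sum_map_neg (w : List V) : (w.map (Equiv.neg V)).sum = -w.sum := by
  induction w with
  | nil => simp
  | cons e w ih =>
    rw [List.map_cons, List.sum_cons, List.sum_cons, ih, Equiv.neg_apply, neg_add]

/-- The path that starts at `c` and follows the steps `w` is in `A` at some time at least `M`. -/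
def Hits (A : Set V) (c : V) (M : ℕ) (w : List V) : Prop :=
  ∃ i, M ≤ i ∧ i ≤ w.length ∧ c + (w.take i).sum ∈ A

theorem hits_nil {A : Set V} {c : V} {M : ℕ} : Hits A c M [] ↔ M = 0 ∧ c ∈ A := by
  simp [Hits]

theorem hits_cons_succ {A : Set V} {c : V} {M : ℕ} {e : V} {w : List V} :
    Hits A c (M + 1) (e :: w) ↔ Hits A (c + e) M w := by
  constructor
  · rintro ⟨i, h1, h2, h3⟩
    obtain ⟨j, rfl⟩ : ∃ j, i = j + 1 := ⟨i - 1, by omega⟩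
    exact ⟨j, by omega, by simpa using h2, by simpa [add_assoc] using h3⟩
  · rintro ⟨i, h1, h2, h3⟩
    exact ⟨i + 1, by omega, by simpa using h2, by simpa [add_assoc] using h3⟩

theorem hits_cons_zero {A : Set V} {c : V} {e : V} {w : List V} :
    Hits A c 0 (e :: w) ↔ c ∈ A ∨ Hits A (c + e) 0 w := by
  rw [← hits_cons_succ]
  constructor
  · rintro ⟨i, h1, h2, h3⟩
    rcases Nat.eq_zero_or_pos i with rfl | hi
    · left; simpa using h3
    · right; exact ⟨i, hi, h2, h3⟩
  · rintro (h | ⟨i, h1, h2, h3⟩)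
    · exact ⟨0, le_rfl, by simp, by simpa using h⟩
    · exact ⟨i, by omega, h2, h3⟩

theorem Hits.mono {A B : Set V} {c : V} {M M' : ℕ} {w : List V} (hAB : A ⊆ B) (hM : M' ≤ M)
    (h : Hits A c M w) : Hits B c M' w := by
  obtain ⟨i, h1, h2, h3⟩ := h
  exact ⟨i, hM.trans h1, h2, hAB h3⟩

/-- Splitting the time of a visit at the junction of two words. -/
theorem hits_append {A : Set V} {c : V} {M : ℕ} {u v : List V} (hM : M ≤ u.length + 1) :
    Hits A c M (u ++ v) ↔ Hits A c M u ∨ Hits A (c + u.sum) 1 v := by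
  constructor
  · rintro ⟨i, h1, h2, h3⟩
    rcases le_or_gt i u.length with hi | hi
    · left
      exact ⟨i, h1, hi, by rwa [List.take_append_of_le_length hi] at h3⟩
    · right
      refine ⟨i - u.length, by omega, by simp at h2; omega, ?_⟩
      rw [List.take_append, List.take_of_length_le hi.le, List.sum_append] at h3
      rwa [add_assoc]
  · rintro (⟨i, h1, h2, h3⟩ | ⟨i, h1, h2, h3⟩)
    · exact ⟨i, h1, by simp; omega, by rwa [List.take_append_of_le_length h2]⟩
    · refine ⟨u.length + i, by omega, by simp; omega, ?_⟩
      rw [List.take_length_add_append, List.sum_append, ← add_assoc]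
      exact h3

/-- A visit during the second of two words is a visit after the length of the first one. -/
theorem Hits.append_left {A : Set V} {c : V} {M : ℕ} {u v : List V}
    (h : Hits A (c + u.sum) M v) : Hits A c (u.length + M) (u ++ v) := by
  obtain ⟨i, h1, h2, h3⟩ := h
  refine ⟨u.length + i, by omega, by simp; omega, ?_⟩
  rw [List.take_length_add_append, List.sum_append, ← add_assoc]
  exact h3

/-- First step decomposition of the distribution of the walk. -/
theorem wordProb_sum_mem_succ (N : Finset V) (A : Set V) (i : ℕ) (c : V) :
    wordProb N (i + 1) (fun w => c + w.sum ∈ A)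
      = (∑ e ∈ N, wordProb N i (fun w => (c + e) + w.sum ∈ A)) / N.card := by
  rw [wordProb_succ]
  simp only [List.sum_cons, add_assoc]

/-- Once in `A`, the walk spends on average time at least `g` there during the next `K` steps;
hence the expected number of visits to `A` bounds the probability of a visit. -/
theorem wordProb_hits_mul_le (N : Finset V) (hN : N.Nonempty) (A : Set V) (K : ℕ) (g : ℝ)
    (hg : ∀ c ∈ A, g ≤ ∑ i ∈ Finset.range (K + 1), wordProb N i (fun w => c + w.sum ∈ A))
    (n : ℕ) : ∀ (M : ℕ) (c : V), wordProb N n (Hits A c M) * g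
      ≤ ∑ i ∈ Finset.Ico M (n + K + 1), wordProb N i (fun w => c + w.sum ∈ A) := by
  have hnn : ∀ (c : V) (s : Finset ℕ),
      0 ≤ ∑ i ∈ s, wordProb N i (fun w => c + w.sum ∈ A) :=
    fun c s => Finset.sum_nonneg fun i _ => wordProb_nonneg N _ _
  have hstart : ∀ (n : ℕ) (c : V), c ∈ A → wordProb N n (Hits A c 0) * g
      ≤ ∑ i ∈ Finset.Ico 0 (n + K + 1), wordProb N i (fun w => c + w.sum ∈ A) := by
    intro n c hc
    rw [wordProb_true N hN (fun w _ => ⟨0, le_rfl, by simp, by simpa using hc⟩), one_mul]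
    refine (hg c hc).trans ?_
    rw [Finset.range_eq_Ico]
    refine Finset.sum_le_sum_of_subset_of_nonneg (Finset.Ico_subset_Ico_right (by omega))
      fun i _ _ => wordProb_nonneg N _ _
  induction n with
  | zero =>
    intro M c
    by_cases h : M = 0 ∧ c ∈ A
    · obtain ⟨rfl, hc⟩ := h
      exact hstart 0 c hc
    · rw [wordProb_zero, if_neg (by rwa [hits_nil]), zero_mul]
      exact hnn _ _
  | succ n ih =>
    intro M c
    by_cases h : M = 0 ∧ c ∈ A
    · obtain ⟨rfl, hc⟩ := h
      exact hstart _ c hc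
    · -- away from `A` at time `0`, the first step can be taken out
      have hstep : wordProb N (n + 1) (Hits A c M)
          = (∑ e ∈ N, wordProb N n (Hits A (c + e) (M - 1))) / N.card := by
        rw [wordProb_succ]
        congr 1
        refine Finset.sum_congr rfl fun e _ => wordProb_congr N fun w _ _ => ?_
        rcases Nat.eq_zero_or_pos M with rfl | hM
        · rw [hits_cons_zero]
          simp only [true_and] at h
          simp [h]
        · obtain ⟨M, rfl⟩ : ∃ k, M = k + 1 := ⟨M - 1, by omega⟩
          rw [hits_cons_succ]; rfl
      have hsum : ∑ i ∈ Finset.Ico (M - 1) (n + K + 1),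
            wordProb N (i + 1) (fun w => c + w.sum ∈ A)
          ≤ ∑ i ∈ Finset.Ico M (n + 1 + K + 1), wordProb N i (fun w => c + w.sum ∈ A) := by
        rw [Finset.sum_Ico_add' (fun i => wordProb N i (fun w => c + w.sum ∈ A))]
        refine Finset.sum_le_sum_of_subset_of_nonneg ?_ fun i _ _ => wordProb_nonneg N _ _
        intro i hi
        simp only [Finset.mem_Ico] at hi ⊢
        omega
      refine le_trans ?_ hsum
      simp only [wordProb_sum_mem_succ]
      rw [hstep, ← Finset.sum_div, Finset.sum_comm, div_mul_eq_mul_div, Finset.sum_mul]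
      gcongr with e he
      exact ih (M - 1) (c + e)

/-- The Markov property at the first visit to `z` after time `M`: visiting `z` and then, with the
second path (which differs from the first one by the shift `δ`), visiting `B`. -/
theorem wordProb_two_hits_le (N : Finset V) (hN : N.Nonempty) (z δ : V) (B : Set V) (n : ℕ) :
    ∀ (M : ℕ) (c : V), wordProb N n (fun w => ∃ i j, M ≤ i ∧ i ≤ j ∧ j ≤ w.length ∧
        c + (w.take i).sum = z ∧ c + δ + (w.take j).sum ∈ B)
      ≤ wordProb N n (Hits {z} c M) * wordProb N n (Hits B (z + δ) 0) := by
  have hstart : ∀ (n : ℕ) (c : V), c = z →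
      wordProb N n (fun w => ∃ i j, 0 ≤ i ∧ i ≤ j ∧ j ≤ w.length ∧
        c + (w.take i).sum = z ∧ c + δ + (w.take j).sum ∈ B)
      ≤ wordProb N n (Hits {z} c 0) * wordProb N n (Hits B (z + δ) 0) := by
    rintro n c rfl
    rw [wordProb_true N hN (P := Hits {c} c 0)
      (fun w _ => ⟨0, le_rfl, by simp, by simp⟩), one_mul]
    refine wordProb_mono N fun w _ _ => ?_
    rintro ⟨i, j, -, -, hj, -, h⟩
    exact ⟨j, by omega, hj, h⟩
  induction n with
  | zero =>
    intro M c
    by_cases h : M = 0 ∧ c = z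
    · obtain ⟨rfl, hc⟩ := h
      exact hstart 0 c hc
    · rw [wordProb_zero, if_neg]
      · exact mul_nonneg (wordProb_nonneg N _ _) (wordProb_nonneg N _ _)
      · rintro ⟨i, j, h1, h2, h3, h4, -⟩
        simp at h3
        subst h3
        exact h ⟨by omega, by simpa using h4⟩
  | succ n ih =>
    intro M c
    by_cases h : M = 0 ∧ c = z
    · obtain ⟨rfl, hc⟩ := h
      exact hstart _ c hc
    · have hstep : wordProb N (n + 1) (Hits {z} c M)
          = (∑ e ∈ N, wordProb N n (Hits {z} (c + e) (M - 1))) / N.card := by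
        rw [wordProb_succ]
        congr 1
        refine Finset.sum_congr rfl fun e _ => wordProb_congr N fun w _ _ => ?_
        rcases Nat.eq_zero_or_pos M with rfl | hM
        · rw [hits_cons_zero]
          simp only [true_and] at h
          simp [h]
        · obtain ⟨M, rfl⟩ : ∃ k, M = k + 1 := ⟨M - 1, by omega⟩
          rw [hits_cons_succ]; rfl
      have hB : wordProb N n (Hits B (z + δ) 0) ≤ wordProb N (n + 1) (Hits B (z + δ) 0) :=
        wordProb_mono_length N hN (Nat.le_succ n) _ fun u v _ hu =>
          (hits_append (Nat.zero_le _)).2 (Or.inl hu)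
      rw [wordProb_succ, hstep, div_mul_eq_mul_div, Finset.sum_mul]
      gcongr with e he
      refine le_trans (wordProb_mono N fun w _ _ => ?_) ((ih (M - 1) (c + e)).trans
        (mul_le_mul_of_nonneg_left hB (wordProb_nonneg N _ _)))
      rintro ⟨i, j, h1, h2, h3, h4, h5⟩
      have hi : i ≠ 0 := by
        rintro rfl
        exact h ⟨by omega, by simpa using h4⟩
      obtain ⟨i, rfl⟩ : ∃ k, i = k + 1 := ⟨i - 1, by omega⟩
      obtain ⟨j, rfl⟩ : ∃ k, j = k + 1 := ⟨j - 1, by omega⟩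
      refine ⟨i, j, by omega, by omega, by simpa using h3, ?_, ?_⟩
      · simpa [add_assoc] using h4
      · have : c + e + δ + (w.take j).sum = c + δ + ((e :: w).take (j + 1)).sum := by
          simp only [List.take_succ_cons, List.sum_cons]; abel
        rwa [this]

end Words

/-! ### The steps of the simple random walk -/

/-- The `2d` unit vectors `± e_i` of `ℤ^d`. -/
def unitSteps (d : ℕ) : Finset (Fin d → ℤ) :=
  Finset.univ.image fun p : Fin d × Bool => Pi.single p.1 (if p.2 then 1 else -1)

theorem sum_unitSteps {d : ℕ} (f : (Fin d → ℤ) → ℝ) :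
    ∑ e ∈ unitSteps d, f e = ∑ i, (f (Pi.single i 1) + f (Pi.single i (-1))) := by
  rw [unitSteps, Finset.sum_image, Fintype.sum_prod_type]
  · simp
  · rintro ⟨i, s⟩ - ⟨j, t⟩ - h
    simp only at h
    have hij : i = j := by
      by_contra hij
      have := congrFun h i
      rw [Pi.single_eq_same, Pi.single_eq_of_ne hij] at this
      cases s <;> simp at this
    subst hij
    have := congrFun h i
    rw [Pi.single_eq_same, Pi.single_eq_same] at this
    cases s <;> cases t <;> simp_all

theorem card_unitSteps (d : ℕ) : ((unitSteps d).card : ℝ) = 2 * d := by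
  have := sum_unitSteps (d := d) (fun _ => 1)
  simp only [Finset.sum_const, nsmul_eq_mul, mul_one, Finset.card_univ, Fintype.card_fin] at this
  rw [this]; ring

theorem unitSteps_nonempty {d : ℕ} (hd : 2 ≤ d) : (unitSteps d).Nonempty := by
  rw [← Finset.card_pos]
  have : (0 : ℝ) < ((unitSteps d).card : ℝ) := by
    rw [card_unitSteps]
    have : (2 : ℝ) ≤ d := by exact_mod_cast hd
    linarith
  exact_mod_cast this

theorem mem_unitSteps {d : ℕ} {e : Fin d → ℤ} :
    e ∈ unitSteps d ↔ ∃ i, e = Pi.single i 1 ∨ e = Pi.single i (-1) := by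
  simp only [unitSteps, Finset.mem_image, Finset.mem_univ, true_and, Prod.exists, Bool.exists_bool]
  refine exists_congr fun i => ?_
  simp only [Bool.false_eq_true, if_false, if_true]
  rw [or_comm, @eq_comm _ e, @eq_comm _ e]

theorem mem_unitSteps_iff {d : ℕ} {e : Fin d → ℤ} :
    e ∈ unitSteps d ↔ e ∈ latticeNeighbors (0 : Fin d → ℤ) := by
  rw [mem_unitSteps]
  simp only [latticeNeighbors, Set.mem_ofPred_eq, Pi.zero_apply, sub_zero]
  constructor
  · rintro ⟨i, rfl | rfl⟩ <;>
    · rw [Finset.sum_eq_single i]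
      · simp
      · intro j _ hj; simp [Pi.single_eq_of_ne hj]
      · simp
  · intro h
    have hex : ∃ i, e i ≠ 0 := by
      by_contra hne
      push Not at hne
      simp [hne] at h
    obtain ⟨i, hi⟩ := hex
    have hpos : 1 ≤ e i ^ 2 := by
      have := sq_pos_of_ne_zero hi
      omega
    have hsplit := Finset.add_sum_erase Finset.univ (fun j => e j ^ 2) (Finset.mem_univ i)
    have hnn : 0 ≤ ∑ j ∈ Finset.univ.erase i, e j ^ 2 :=
      Finset.sum_nonneg fun j _ => sq_nonneg _
    have hzero : ∑ j ∈ Finset.univ.erase i, e j ^ 2 = 0 := by omega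
    have hone : e i ^ 2 = 1 := by omega
    have hj : ∀ j, j ≠ i → e j = 0 := by
      intro j hj
      have := (Finset.sum_eq_zero_iff_of_nonneg fun j _ => sq_nonneg (e j)).1 hzero j (by simp [hj])
      exact pow_eq_zero_iff (two_ne_zero) |>.1 this
    refine ⟨i, ?_⟩
    rcases (by
      rcases mul_eq_zero.1 (show (e i - 1) * (e i + 1) = 0 by linarith) with h | h
      · left; omega
      · right; omega : e i = 1 ∨ e i = -1) with h1 | h1
    · left
      ext j
      by_cases hji : j = i
      · subst hji; simp [h1]
      · simp [hji, hj j hji]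
    · right
      ext j
      by_cases hji : j = i
      · subst hji; simp [h1]
      · simp [hji, hj j hji]

theorem neg_mem_unitSteps {d : ℕ} {e : Fin d → ℤ} : -e ∈ unitSteps d ↔ e ∈ unitSteps d := by
  simp only [mem_unitSteps_iff, latticeNeighbors, Set.mem_ofPred_eq, Pi.zero_apply, sub_zero,
    Pi.neg_apply, neg_sq]

/-! ### The heat kernel of a two-dimensional projection -/

section HeatKernel

variable {V : Type*}

theorem continuous_wordMean (N : Finset V) (n : ℕ) : ∀ F : ℝ → List V → ℝ,
    (∀ w, Continuous fun a => F a w) → Continuous fun a => wordMean N n (F a) := by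
  induction n with
  | zero => intro F hF; exact hF []
  | succ n ih =>
    intro F hF
    simp only [wordMean_succ]
    exact (continuous_finsetSum _ fun e _ =>
      ih (fun a w => F a (e :: w)) fun w => hF _).div_const _

theorem wordMean_intervalIntegral (N : Finset V) (n : ℕ) (α β : ℝ) : ∀ F : ℝ → List V → ℝ,
    (∀ w, Continuous fun a => F a w) →
    wordMean N n (fun w => ∫ a in α..β, F a w) = ∫ a in α..β, wordMean N n (F a) := by
  induction n with
  | zero => intro F hF; rfl
  | succ n ih =>
    intro F hF
    simp only [wordMean_succ]
    rw [intervalIntegral.integral_div, intervalIntegral.integral_finsetSum]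
    · congr 1
      exact Finset.sum_congr rfl fun e _ => ih (fun a w => F a (e :: w)) fun w => hF _
    · intro e _
      exact (continuous_wordMean N n (fun a w => F a (e :: w)) fun w => hF _).intervalIntegrable
        _ _

theorem integral_cos_mul_int (m : ℤ) :
    ∫ a in (-Real.pi)..Real.pi, Real.cos (a * m) = if m = 0 then 2 * Real.pi else 0 := by
  split_ifs with h
  · subst h; simp; ring
  · have hm : (m : ℝ) ≠ 0 := by exact_mod_cast h
    rw [intervalIntegral.integral_comp_mul_right (fun x => Real.cos x) hm, integral_cos]
    have h1 : Real.sin (Real.pi * m) = 0 := by rw [mul_comm]; exact Real.sin_int_mul_pi m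
    simp [h1]

/-- Since `sin` vanishes linearly at `-π`, `0` and `π`, and nowhere else on `[-π, π]`, the
integral of `exp (-s sin² a)` is bounded by three Gaussian integrals. -/
theorem integral_exp_neg_mul_sin_sq_le {s : ℝ} (hs : 0 < s) :
    ∫ a in (-Real.pi)..Real.pi, Real.exp (-(s * Real.sin a ^ 2)) ≤ 3 * Real.pi ^ 2 / √s := by
  have hpi := Real.pi_pos
  set r : ℝ := 4 * s / Real.pi ^ 2 with hr
  have hrpos : 0 < r := by positivity
  have key : ∀ a : ℝ, |a| ≤ Real.pi / 2 → r * a ^ 2 ≤ s * Real.sin a ^ 2 := by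
    intro a ha
    have h1 : 2 / Real.pi * |a| ≤ |Real.sin a| := by
      rcases le_total 0 a with h | h
      · rw [abs_of_nonneg h] at ha ⊢
        exact (Real.mul_le_sin h ha).trans (le_abs_self _)
      · rw [abs_of_nonpos h] at ha ⊢
        have := Real.mul_le_sin (neg_nonneg.2 h) ha
        rw [Real.sin_neg] at this
        exact this.trans (neg_le_abs _)
    have h2 : (2 / Real.pi * |a|) ^ 2 ≤ |Real.sin a| ^ 2 := by gcongr
    rw [mul_pow, sq_abs, sq_abs] at h2
    calc r * a ^ 2 = s * ((2 / Real.pi) ^ 2 * a ^ 2) := by rw [hr]; field_simp; ring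
      _ ≤ s * Real.sin a ^ 2 := by gcongr
  set G : ℝ → ℝ := fun a => Real.exp (-r * a ^ 2) with hG
  have hGint : Integrable G := integrable_exp_neg_mul_sq hrpos
  have hbound : ∀ a ∈ Set.Icc (-Real.pi) Real.pi,
      Real.exp (-(s * Real.sin a ^ 2)) ≤ G a + G (a - Real.pi) + G (a + Real.pi) := by
    intro a ha
    have hGpos : ∀ x, 0 < G x := fun x => Real.exp_pos _
    have hle : ∀ x, |x| ≤ Real.pi / 2 → Real.sin x ^ 2 = Real.sin a ^ 2 →
        Real.exp (-(s * Real.sin a ^ 2)) ≤ G x := by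
      intro x hx hxa
      rw [hG, ← hxa]
      apply Real.exp_le_exp.2
      linarith [key x hx]
    rcases le_or_gt a (-(Real.pi / 2)) with h1 | h1
    · have := hle (a + Real.pi) (by rw [abs_le]; constructor <;> linarith [ha.1])
        (by rw [Real.sin_add_pi, neg_sq])
      linarith [hGpos a, hGpos (a - Real.pi)]
    · rcases le_or_gt a (Real.pi / 2) with h2 | h2
      · have := hle a (by rw [abs_le]; constructor <;> linarith) rfl
        linarith [hGpos (a - Real.pi), hGpos (a + Real.pi)]
      · have := hle (a - Real.pi) (by rw [abs_le]; constructor <;> linarith [ha.2])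
          (by rw [Real.sin_sub_pi, neg_sq])
        linarith [hGpos a, hGpos (a + Real.pi)]
  have hcontG : Continuous G := by fun_prop
  have hone : ∀ c : ℝ, ∫ a in (-Real.pi)..Real.pi, G (a + c) ≤ √(Real.pi / r) := by
    intro c
    rw [intervalIntegral.integral_of_le (by linarith)]
    calc ∫ a in Set.Ioc (-Real.pi) Real.pi, G (a + c) ≤ ∫ a, G (a + c) :=
          setIntegral_le_integral (hGint.comp_add_right c)
            (Eventually.of_forall fun a => (Real.exp_pos _).le)
      _ = ∫ a, G a := integral_add_right_eq_self G c
      _ = √(Real.pi / r) := integral_gaussian r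
  have hval : √(Real.pi / r) ≤ Real.pi ^ 2 / √s := by
    rw [le_div_iff₀ (Real.sqrt_pos.2 hs), ← Real.sqrt_mul (by positivity)]
    apply Real.sqrt_le_iff.2
    refine ⟨by positivity, ?_⟩
    have h3 : Real.pi / r * s = Real.pi ^ 3 / 4 := by rw [hr]; field_simp
    rw [h3]
    have : 1 ≤ Real.pi := by linarith [Real.pi_gt_three]
    nlinarith [pow_pos hpi 3, pow_pos hpi 4]
  calc ∫ a in (-Real.pi)..Real.pi, Real.exp (-(s * Real.sin a ^ 2))
      ≤ ∫ a in (-Real.pi)..Real.pi, (G a + G (a - Real.pi) + G (a + Real.pi)) := by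
        refine intervalIntegral.integral_mono_on (by linarith) ?_ ?_ hbound
        · exact Continuous.intervalIntegrable (by fun_prop) _ _
        · exact Continuous.intervalIntegrable (by fun_prop) _ _
    _ = (∫ a in (-Real.pi)..Real.pi, G (a + 0)) + (∫ a in (-Real.pi)..Real.pi, G (a + -Real.pi))
        + ∫ a in (-Real.pi)..Real.pi, G (a + Real.pi) := by
        rw [intervalIntegral.integral_add, intervalIntegral.integral_add]
        · simp [sub_eq_add_neg]
        all_goals exact Continuous.intervalIntegrable (by fun_prop) _ _
    _ ≤ 3 * Real.pi ^ 2 / √s := by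
        have := hone 0; have := hone (-Real.pi); have := hone Real.pi
        have h4 : 3 * Real.pi ^ 2 / √s = 3 * (Real.pi ^ 2 / √s) := by ring
        linarith

variable {d : ℕ}

/-- The step average of a product of two cosines; summed over `± e_k` the sine terms cancel. -/
theorem sum_unitSteps_cos {i j : Fin d} (hij : i ≠ j) (a b α β : ℝ) :
    ∑ e ∈ unitSteps d, Real.cos (a * (e i : ℝ) + α) * Real.cos (b * (e j : ℝ) + β)
      = (2 * d - 2 * (1 - Real.cos a) - 2 * (1 - Real.cos b)) * (Real.cos α * Real.cos β) := by
  rw [sum_unitSteps]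
  have hterm : ∀ k : Fin d,
      Real.cos (a * (((Pi.single k 1 : Fin d → ℤ) i : ℤ) : ℝ) + α)
          * Real.cos (b * (((Pi.single k 1 : Fin d → ℤ) j : ℤ) : ℝ) + β)
        + Real.cos (a * (((Pi.single k (-1) : Fin d → ℤ) i : ℤ) : ℝ) + α)
          * Real.cos (b * (((Pi.single k (-1) : Fin d → ℤ) j : ℤ) : ℝ) + β)
      = 2 * (Real.cos α * Real.cos β)
        + (if k = i then -(2 * (1 - Real.cos a)) * (Real.cos α * Real.cos β) else 0)
        + (if k = j then -(2 * (1 - Real.cos b)) * (Real.cos α * Real.cos β) else 0) := by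
    intro k
    by_cases hi : k = i
    · subst hi
      simp only [Pi.single_eq_same, Pi.single_eq_of_ne hij.symm, if_neg hij]
      push_cast
      simp only [mul_zero, zero_add, mul_one, mul_neg, Real.cos_add, Real.cos_neg, Real.sin_neg]
      ring
    · by_cases hj : k = j
      · subst hj
        simp only [Pi.single_eq_same, Pi.single_eq_of_ne hij, if_neg hi]
        push_cast
        simp only [mul_zero, zero_add, mul_one, mul_neg, Real.cos_add, Real.cos_neg, Real.sin_neg]
        ring
      · simp only [Pi.single_eq_of_ne (Ne.symm hi), Pi.single_eq_of_ne (Ne.symm hj), if_neg hi,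
          if_neg hj]
        simp
        ring
  rw [Finset.sum_congr rfl fun k _ => hterm k]
  simp only [Finset.sum_add_distrib, Finset.sum_ite_eq', Finset.mem_univ, if_true,
    Finset.sum_const, Finset.card_univ, Fintype.card_fin, nsmul_eq_mul]
  ring

/-- The characteristic function of the projection of the walk to two coordinates. -/
theorem wordMean_cos_mul_cos (hd : 2 ≤ d) {i j : Fin d} (hij : i ≠ j) (a b : ℝ) (t : ℕ) :
    ∀ α β : ℝ, wordMean (unitSteps d) t (fun w =>
        Real.cos (a * (w.sum i : ℝ) + α) * Real.cos (b * (w.sum j : ℝ) + β))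
      = (1 - ((1 - Real.cos a) + (1 - Real.cos b)) / d) ^ t * (Real.cos α * Real.cos β) := by
  have hd0 : (d : ℝ) ≠ 0 := by
    have : d ≠ 0 := by omega
    exact_mod_cast this
  induction t with
  | zero => intro α β; simp [wordMean_zero]
  | succ t ih =>
    intro α β
    rw [wordMean_succ]
    have : ∀ e : Fin d → ℤ, wordMean (unitSteps d) t (fun w =>
        Real.cos (a * (((e :: w).sum i : ℤ) : ℝ) + α)
          * Real.cos (b * (((e :: w).sum j : ℤ) : ℝ) + β))
        = (1 - ((1 - Real.cos a) + (1 - Real.cos b)) / d) ^ t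
          * (Real.cos (a * (e i : ℝ) + α) * Real.cos (b * (e j : ℝ) + β)) := by
      intro e
      rw [← ih]
      congr 1
      ext w
      simp only [List.sum_cons, Pi.add_apply]
      push_cast
      congr 2 <;> ring
    simp only [this]
    rw [← Finset.mul_sum, sum_unitSteps_cos hij, card_unitSteps, pow_succ, mul_div_assoc, mul_assoc]
    congr 1
    field_simp
    ring

/-- The bound `|cos x| ≤ 1 - sin² x / 2` turns the characteristic function into a product of two
factors, one for each coordinate, that no longer distinguishes the two parities. -/
theorem abs_charFun_pow_le (hd : 2 ≤ d) (a b : ℝ) (t : ℕ) :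
    |1 - ((1 - Real.cos a) + (1 - Real.cos b)) / d| ^ t
      ≤ Real.exp (-((t : ℝ) / (2 * d) * Real.sin a ^ 2))
        * Real.exp (-((t : ℝ) / (2 * d) * Real.sin b ^ 2)) := by
  have hd2 : (2 : ℝ) ≤ d := by exact_mod_cast hd
  have hcos : ∀ x : ℝ, Real.sin x ^ 2 / 2 ≤ 1 - |Real.cos x| := by
    intro x
    have h1 := Real.abs_cos_le_one x
    have h2 : Real.sin x ^ 2 = 1 - |Real.cos x| ^ 2 := by rw [sq_abs, Real.sin_sq]
    nlinarith [abs_nonneg (Real.cos x)]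
  have h1 : |1 - ((1 - Real.cos a) + (1 - Real.cos b)) / d|
      ≤ 1 - (Real.sin a ^ 2 + Real.sin b ^ 2) / (2 * d) := by
    have e1 : 1 - ((1 - Real.cos a) + (1 - Real.cos b)) / d
        = ((d - 2) + Real.cos a + Real.cos b) / d := by field_simp; ring
    have e2 : 1 - (Real.sin a ^ 2 + Real.sin b ^ 2) / (2 * d)
        = ((d : ℝ) - (Real.sin a ^ 2 / 2 + Real.sin b ^ 2 / 2)) / d := by field_simp
    rw [e1, e2, abs_div, abs_of_pos (show (0 : ℝ) < d by linarith)]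
    gcongr
    have := abs_add_le ((d : ℝ) - 2 + Real.cos a) (Real.cos b)
    have := abs_add_le ((d : ℝ) - 2) (Real.cos a)
    rw [abs_of_nonneg (show (0 : ℝ) ≤ d - 2 by linarith)] at this
    linarith [hcos a, hcos b]
  have h2 := Real.add_one_le_exp (-((Real.sin a ^ 2 + Real.sin b ^ 2) / (2 * d)))
  calc _ ≤ Real.exp (-((Real.sin a ^ 2 + Real.sin b ^ 2) / (2 * d))) ^ t := by
        gcongr
        linarith
    _ = _ := by
        rw [← Real.exp_nat_mul, ← Real.exp_add]
        congr 1
        ring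

/-- The local upper bound of order `1 / t` for the projection to two coordinates, by Fourier
inversion. -/
theorem wordProb_proj_eq_le (hd : 2 ≤ d) {i j : Fin d} (hij : i ≠ j) (t : ℕ) (ht : 0 < t)
    (x y : ℤ) : wordProb (unitSteps d) t (fun w => w.sum i = x ∧ w.sum j = y)
      ≤ 9 * Real.pi ^ 2 * d / t := by
  have hpi := Real.pi_pos
  have hd2 : (2 : ℝ) ≤ d := by exact_mod_cast hd
  have ht' : (0 : ℝ) < t := by exact_mod_cast ht
  set s : ℝ := (t : ℝ) / (2 * d) with hs
  have hspos : 0 < s := by positivity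
  set G : ℝ → ℝ := fun a => Real.exp (-(s * Real.sin a ^ 2)) with hG
  have hGc : Continuous G := by fun_prop
  have h1 : (2 * Real.pi) ^ 2 * wordProb (unitSteps d) t (fun w => w.sum i = x ∧ w.sum j = y)
      = ∫ a in (-Real.pi)..Real.pi, ∫ b in (-Real.pi)..Real.pi,
        (1 - ((1 - Real.cos a) + (1 - Real.cos b)) / d) ^ t
          * (Real.cos (-(a * x)) * Real.cos (-(b * y))) := by
    simp only [← wordMean_cos_mul_cos hd hij]
    have hin : ∀ a : ℝ, (∫ b in (-Real.pi)..Real.pi, wordMean (unitSteps d) t (fun w =>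
          Real.cos (a * (w.sum i : ℝ) + -(a * x)) * Real.cos (b * (w.sum j : ℝ) + -(b * y))))
        = wordMean (unitSteps d) t (fun w =>
          Real.cos (a * (w.sum i : ℝ) + -(a * x)) * (if w.sum j = y then 2 * Real.pi else 0)) := by
      intro a
      rw [← wordMean_intervalIntegral _ t _ _ (fun b (w : List (Fin d → ℤ)) =>
          Real.cos (a * (w.sum i : ℝ) + -(a * x)) * Real.cos (b * (w.sum j : ℝ) + -(b * y)))]
      · congr 1
        ext w
        rw [intervalIntegral.integral_const_mul]
        congr 1
        have := integral_cos_mul_int (w.sum j - y)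
        simp only [sub_eq_zero] at this
        rw [← this]
        congr 1
        ext b
        push_cast
        congr 1
        ring
      · intro w; fun_prop
    simp only [hin]
    rw [← wordMean_intervalIntegral _ t _ _ (fun a (w : List (Fin d → ℤ)) =>
          Real.cos (a * (w.sum i : ℝ) + -(a * x)) * (if w.sum j = y then 2 * Real.pi else 0)),
      wordProb, ← wordMean_const_mul]
    · congr 1
      ext w
      rw [intervalIntegral.integral_mul_const]
      have := integral_cos_mul_int (w.sum i - x)
      simp only [sub_eq_zero] at this
      have h2 : (∫ a in (-Real.pi)..Real.pi, Real.cos (a * (w.sum i : ℝ) + -(a * x)))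
          = if w.sum i = x then 2 * Real.pi else 0 := by
        rw [← this]
        congr 1
        ext b
        push_cast
        congr 1
        ring
      rw [h2]
      by_cases hx : w.sum i = x <;> by_cases hy : w.sum j = y <;> simp [hx, hy]
      ring
    · intro w; fun_prop
  have h2 : ‖∫ a in (-Real.pi)..Real.pi, ∫ b in (-Real.pi)..Real.pi,
        (1 - ((1 - Real.cos a) + (1 - Real.cos b)) / d) ^ t
          * (Real.cos (-(a * x)) * Real.cos (-(b * y)))‖
      ≤ ∫ a in (-Real.pi)..Real.pi, G a * ∫ b in (-Real.pi)..Real.pi, G b := by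
    refine intervalIntegral.norm_integral_le_of_norm_le (by linarith)
      (Eventually.of_forall fun a _ => ?_) (Continuous.intervalIntegrable (by fun_prop) _ _)
    rw [← intervalIntegral.integral_const_mul]
    refine intervalIntegral.norm_integral_le_of_norm_le (by linarith)
      (Eventually.of_forall fun b _ => ?_) (Continuous.intervalIntegrable (by fun_prop) _ _)
    rw [norm_mul, norm_pow, norm_mul, Real.norm_eq_abs, Real.norm_eq_abs, Real.norm_eq_abs]
    calc _ ≤ |1 - ((1 - Real.cos a) + (1 - Real.cos b)) / d| ^ t * (1 * 1) := by
          gcongr <;> exact Real.abs_cos_le_one _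
      _ ≤ _ := by rw [mul_one, mul_one]; exact abs_charFun_pow_le hd a b t
  rw [← h1, intervalIntegral.integral_mul_const] at h2
  have h3 := integral_exp_neg_mul_sin_sq_le hspos
  have h4 : 0 ≤ ∫ a in (-Real.pi)..Real.pi, G a :=
    intervalIntegral.integral_nonneg (by linarith) fun a _ => (Real.exp_pos _).le
  have h5 : (2 * Real.pi) ^ 2 * wordProb (unitSteps d) t (fun w => w.sum i = x ∧ w.sum j = y)
      ≤ (3 * Real.pi ^ 2 / √s) * (3 * Real.pi ^ 2 / √s) :=
    (le_abs_self _).trans (h2.trans (mul_le_mul h3 h3 h4 (by positivity)))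
  have h6 : (3 * Real.pi ^ 2 / √s) * (3 * Real.pi ^ 2 / √s)
      = (2 * Real.pi) ^ 2 * (9 * Real.pi ^ 2 * d / t) / 2 := by
    rw [div_mul_div_comm, Real.mul_self_sqrt hspos.le, hs]
    field_simp
    ring
  rw [h6] at h5
  have h7 : (0 : ℝ) < (2 * Real.pi) ^ 2 := by positivity
  have h8 : 0 ≤ 9 * Real.pi ^ 2 * d / t := by positivity
  nlinarith

end HeatKernel

/-! ### Hitting probabilities -/

section HittingProbability

variable {d : ℕ}

/-- A coordinate of the walk has variance `t / d` after `t` steps. -/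
theorem wordMean_coord_sq (hd : 2 ≤ d) (i : Fin d) (t : ℕ) : ∀ x : ℝ,
    wordMean (unitSteps d) t (fun w => (x + (w.sum i : ℝ)) ^ 2) = x ^ 2 + t / d := by
  have hd0 : (d : ℝ) ≠ 0 := by
    have : d ≠ 0 := by omega
    exact_mod_cast this
  have hsum : ∀ x : ℝ, ∑ e ∈ unitSteps d, (x + (e i : ℝ)) ^ 2 = 2 * d * x ^ 2 + 2 := by
    intro x
    rw [sum_unitSteps]
    have : ∀ k : Fin d, (x + (((Pi.single k 1 : Fin d → ℤ) i : ℤ) : ℝ)) ^ 2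
        + (x + (((Pi.single k (-1) : Fin d → ℤ) i : ℤ) : ℝ)) ^ 2
        = 2 * x ^ 2 + if k = i then 2 else 0 := by
      intro k
      by_cases hi : k = i
      · subst hi
        simp only [Pi.single_eq_same, if_true]
        push_cast
        ring
      · simp only [Pi.single_eq_of_ne (Ne.symm hi), if_neg hi]
        push_cast
        ring
    rw [Finset.sum_congr rfl fun k _ => this k]
    simp only [Finset.sum_add_distrib, Finset.sum_ite_eq', Finset.mem_univ, if_true,
      Finset.sum_const, Finset.card_univ, Fintype.card_fin, nsmul_eq_mul]
    ring
  induction t with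
  | zero => intro x; simp [wordMean_zero]
  | succ t ih =>
    intro x
    rw [wordMean_succ]
    have : ∀ e : Fin d → ℤ, wordMean (unitSteps d) t (fun w =>
        (x + (((e :: w).sum i : ℤ) : ℝ)) ^ 2) = (x + (e i : ℝ)) ^ 2 + t / d := by
      intro e
      rw [← ih]
      congr 1
      ext w
      simp only [List.sum_cons, Pi.add_apply]
      push_cast
      ring
    simp only [this]
    rw [Finset.sum_add_distrib, hsum, Finset.sum_const, nsmul_eq_mul, card_unitSteps]
    field_simp
    push_cast
    ring

/-- Chebyshev's inequality for a coordinate of the walk. -/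
theorem wordProb_coord_large_le (hd : 2 ≤ d) (i : Fin d) (t R : ℕ) (hR : 2 * t < R ^ 2) :
    wordProb (unitSteps d) t (fun w => ¬ |w.sum i| ≤ (R : ℤ)) ≤ 1 / 4 := by
  have hR0 : (0 : ℝ) < (R : ℝ) ^ 2 := by
    have : 0 < R ^ 2 := by omega
    exact_mod_cast this
  have h := wordProb_le_of_mean (unitSteps d) t (fun w => ¬ |w.sum i| ≤ (R : ℤ))
    (fun w => (0 + (w.sum i : ℝ)) ^ 2) hR0 (fun _ _ => sq_nonneg _) (fun w _ hw => by
      rw [zero_add, ← sq_abs (w.sum i : ℝ)]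
      have : (R : ℤ) ≤ |w.sum i| := by omega
      have : (R : ℝ) ≤ |(w.sum i : ℝ)| := by exact_mod_cast this
      gcongr)
  rw [wordMean_coord_sq hd] at h
  refine h.trans ?_
  have hd2 : (2 : ℝ) ≤ d := by exact_mod_cast hd
  have h3 : (2 : ℝ) * t ≤ (R : ℝ) ^ 2 := by exact_mod_cast hR.le
  have h4 : (t : ℝ) / d ≤ t / 2 := by gcongr
  rw [div_le_iff₀ hR0]
  linarith

/-- Lower bound for the return probability: by the second moment bound the projected walk is
likely to be in a box of size of order `t`, and by the Cauchy–Schwarz inequality two independent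
copies coincide with probability at least of order `1 / t`. -/
theorem le_wordProb_proj_return (hd : 2 ≤ d) (i j : Fin d) (t : ℕ) (ht : 0 < t) :
    1 / (136 * t) ≤ wordProb (unitSteps d) (t + t) (fun w => w.sum i = 0 ∧ w.sum j = 0) := by
  have hN := unitSteps_nonempty hd
  set N := unitSteps d with hNdef
  set p : ℤ × ℤ → ℝ := fun z => wordProb N t (fun w => w.sum i = z.1 ∧ w.sum j = z.2) with hp
  set R : ℕ := Nat.sqrt (2 * t) + 1 with hR
  have hRt : 2 * t < R ^ 2 := by rw [hR]; exact Nat.lt_succ_sqrt' _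
  set s : Finset (ℤ × ℤ) := Finset.Icc (-(R : ℤ)) R ×ˢ Finset.Icc (-(R : ℤ)) R with hs
  -- the distribution of the first half, integrated against that of the second half
  have h1 : wordProb N (t + t) (fun w => w.sum i = 0 ∧ w.sum j = 0)
      = wordMean N t (fun u => p (u.sum i, u.sum j)) := by
    rw [wordProb_append]
    refine wordMean_congr N fun u _ _ => ?_
    rw [hp, ← wordProb_map (Equiv.neg (Fin d → ℤ)) (fun e => neg_mem_unitSteps)]
    refine wordProb_congr N fun v _ _ => ?_
    rw [List.sum_append, sum_map_neg]
    simp only [Pi.add_apply, Pi.neg_apply]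
    constructor <;> rintro ⟨h1, h2⟩ <;> constructor <;> omega
  have h2 : ∑ z ∈ s, p z ^ 2 ≤ wordMean N t (fun u => p (u.sum i, u.sum j)) := by
    have : ∑ z ∈ s, p z ^ 2
        = wordMean N t (fun u => ∑ z ∈ s,
          p z * if u.sum i = z.1 ∧ u.sum j = z.2 then 1 else 0) := by
      rw [wordMean_sum]
      refine Finset.sum_congr rfl fun z _ => ?_
      rw [wordMean_const_mul, sq, hp]
      simp only [wordProb]
      congr!
    rw [this]
    refine wordMean_mono N fun u _ _ => ?_
    have hp0 : ∀ z, 0 ≤ p z := fun z => wordProb_nonneg N _ _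
    have e1 : ∀ z ∈ s, (p z * if u.sum i = z.1 ∧ u.sum j = z.2 then 1 else 0)
        = if z = (u.sum i, u.sum j) then p z else 0 := by
      intro z _
      by_cases hz : z = (u.sum i, u.sum j)
      · subst hz; simp
      · have : ¬ (u.sum i = z.1 ∧ u.sum j = z.2) := by
          rintro ⟨h1, h2⟩
          exact hz (Prod.ext h1.symm h2.symm)
        simp [hz, this]
    rw [Finset.sum_congr rfl e1, Finset.sum_ite_eq']
    split_ifs
    · exact le_rfl
    · exact hp0 _
  have h3 : 1 / 2 ≤ ∑ z ∈ s, p z := by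
    have e1 : 1 - 1 / 4 - 1 / 4
        ≤ wordProb N t (fun w => |w.sum i| ≤ (R : ℤ) ∧ |w.sum j| ≤ (R : ℤ)) := by
      have a1 := wordProb_coord_large_le hd i t R hRt
      have a2 := wordProb_coord_large_le hd j t R hRt
      have a3 := wordProb_or_le N t (fun _ => True)
        (fun w => |w.sum i| ≤ (R : ℤ) ∧ |w.sum j| ≤ (R : ℤ))
        (fun w => ¬ |w.sum i| ≤ (R : ℤ) ∨ ¬ |w.sum j| ≤ (R : ℤ))
        (fun w _ _ _ => by tauto)
      have a4 := wordProb_or_le N t (fun w => ¬ |w.sum i| ≤ (R : ℤ) ∨ ¬ |w.sum j| ≤ (R : ℤ))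
        (fun w => ¬ |w.sum i| ≤ (R : ℤ)) (fun w => ¬ |w.sum j| ≤ (R : ℤ)) (fun w _ _ h => h)
      rw [wordProb_true N hN (fun _ _ => trivial)] at a3
      linarith
    have e2 := wordProb_le_sum N t s (fun w => |w.sum i| ≤ (R : ℤ) ∧ |w.sum j| ≤ (R : ℤ))
      (fun z w => w.sum i = z.1 ∧ w.sum j = z.2) (fun w _ hw => by
        refine ⟨(w.sum i, w.sum j), ?_, rfl, rfl⟩
        simp only [hs, Finset.mem_product, Finset.mem_Icc]
        exact ⟨abs_le.1 hw.1, abs_le.1 hw.2⟩)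
    linarith
  have hcard : (s.card : ℝ) ≤ 34 * t := by
    have hsqrt : Nat.sqrt (2 * t) * Nat.sqrt (2 * t) ≤ 2 * t := Nat.sqrt_le _
    have : s.card = (2 * R + 1) * (2 * R + 1) := by
      rw [hs, Finset.card_product, Int.card_Icc]
      congr 1 <;> omega
    rw [this]
    have h5 : (2 * R + 1) * (2 * R + 1) ≤ 34 * t := by
      rw [hR]
      nlinarith [sq_nonneg ((Nat.sqrt (2 * t) : ℤ) - 1), Nat.sqrt_le_self (2 * t),
        Nat.sqrt_pos.2 (show 0 < 2 * t by omega), mul_le_mul hsqrt hsqrt]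
    exact_mod_cast h5
  have h4 := sq_sum_le_card_mul_sum_sq (s := s) (f := p)
  have ht' : (0 : ℝ) < t := by exact_mod_cast ht
  have h5 : (1 / 2 : ℝ) ^ 2 ≤ (∑ z ∈ s, p z) ^ 2 := by gcongr
  have h6 : (s.card : ℝ) * ∑ z ∈ s, p z ^ 2 ≤ 34 * t * ∑ z ∈ s, p z ^ 2 :=
    mul_le_mul_of_nonneg_right hcard (Finset.sum_nonneg fun _ _ => sq_nonneg _)
  rw [h1]
  refine le_trans ?_ h2
  rw [div_le_iff₀ (by positivity)]
  nlinarith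

/-- The expected number of returns of the projected walk up to time `2 ^ m` grows at least
linearly in `m`: every dyadic block of times contributes a constant. -/
theorem le_sum_wordProb_proj_return (hd : 2 ≤ d) (i j : Fin d) (m : ℕ) (hm : 1 ≤ m) :
    (m : ℝ) / 272 ≤ ∑ t ∈ Finset.range (2 ^ m + 1),
      wordProb (unitSteps d) t (fun w => w.sum i = 0 ∧ w.sum j = 0) := by
  set r : ℕ → ℝ := fun t => wordProb (unitSteps d) t (fun w => w.sum i = 0 ∧ w.sum j = 0) with hr
  have hr0 : ∀ t, 0 ≤ r t := fun t => wordProb_nonneg _ _ _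
  obtain ⟨m, rfl⟩ : ∃ k, m = k + 1 := ⟨m - 1, by omega⟩
  induction m with
  | zero =>
    have h1 : r 0 = 1 := by rw [hr]; simp [wordProb_zero]
    have h2 : r 0 ≤ ∑ t ∈ Finset.range (2 ^ (0 + 1) + 1), r t :=
      Finset.single_le_sum (fun t _ => hr0 t) (by simp)
    rw [h1] at h2
    refine le_trans ?_ h2
    norm_num
  | succ m ih =>
    have hblock : (1 : ℝ) / 272 ≤ ∑ t ∈ Finset.Ico (2 ^ (m + 1) + 1) (2 ^ (m + 2) + 1), r t := by
      have h1 : ∑ s ∈ Finset.Ico (2 ^ m + 1) (2 ^ (m + 1) + 1), r (s + s)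
          ≤ ∑ t ∈ Finset.Ico (2 ^ (m + 1) + 1) (2 ^ (m + 2) + 1), r t := by
        rw [← Finset.sum_image (f := r) (g := fun s => s + s)]
        · refine Finset.sum_le_sum_of_subset_of_nonneg ?_ fun t _ _ => hr0 t
          intro t ht
          simp only [Finset.mem_image, Finset.mem_Ico] at ht ⊢
          obtain ⟨s, hs, rfl⟩ := ht
          have : 2 ^ (m + 2) = 2 * 2 ^ (m + 1) := by ring
          have : 2 ^ (m + 1) = 2 * 2 ^ m := by ring
          omega
        · intro a _ b _ h
          simp only at h
          omega
      refine le_trans ?_ h1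
      have h2 : ∀ s ∈ Finset.Ico (2 ^ m + 1) (2 ^ (m + 1) + 1),
          (1 : ℝ) / (272 * 2 ^ m) ≤ r (s + s) := by
        intro s hs
        rw [Finset.mem_Ico] at hs
        refine le_trans ?_ (le_wordProb_proj_return hd i j s (by omega))
        have hs1 : s ≤ 2 * 2 ^ m := by
          have : 2 ^ (m + 1) = 2 * 2 ^ m := by ring
          omega
        have hs2 : (s : ℝ) ≤ 2 * 2 ^ m := by exact_mod_cast hs1
        have hs3 : (0 : ℝ) < s := by
          have : 0 < s := by omega
          exact_mod_cast this
        apply one_div_le_one_div_of_le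
        · positivity
        · linarith
      have h3 := Finset.card_nsmul_le_sum _ _ _ h2
      refine le_trans (le_of_eq ?_) h3
      rw [Nat.card_Ico, nsmul_eq_mul]
      have : 2 ^ (m + 1) + 1 - (2 ^ m + 1) = 2 ^ m := by
        have : 2 ^ (m + 1) = 2 * 2 ^ m := by ring
        omega
      rw [this]
      push_cast
      field_simp
    have hsplit : ∑ t ∈ Finset.range (2 ^ (m + 1 + 1) + 1), r t
        = ∑ t ∈ Finset.range (2 ^ (m + 1) + 1), r t
          + ∑ t ∈ Finset.Ico (2 ^ (m + 1) + 1) (2 ^ (m + 2) + 1), r t := by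
      rw [Finset.sum_range_add_sum_Ico]
      have : 2 ^ (m + 2) = 2 * 2 ^ (m + 1) := by ring
      omega
    rw [hsplit]
    have := ih (by omega)
    push_cast at this ⊢
    linarith

theorem sum_Ico_dyadic_inv_le (i r : ℕ) :
    ∑ t ∈ Finset.Ico (2 ^ i) (2 ^ (i + r)), (1 : ℝ) / (t : ℕ) ≤ r := by
  induction r with
  | zero => simp
  | succ r ih =>
    have h1 : 2 ^ i ≤ 2 ^ (i + r) := Nat.pow_le_pow_right (by norm_num) (by omega)
    have h2 : 2 ^ (i + r) ≤ 2 ^ (i + (r + 1)) := Nat.pow_le_pow_right (by norm_num) (by omega)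
    rw [← Finset.sum_Ico_consecutive _ h1 h2]
    have h3 : ∀ t ∈ Finset.Ico (2 ^ (i + r)) (2 ^ (i + (r + 1))),
        (1 : ℝ) / (t : ℕ) ≤ 1 / 2 ^ (i + r) := by
      intro t ht
      rw [Finset.mem_Ico] at ht
      have : ((2 : ℝ) ^ (i + r)) ≤ t := by exact_mod_cast ht.1
      exact one_div_le_one_div_of_le (by positivity) this
    have h4 := Finset.sum_le_card_nsmul _ _ _ h3
    have h5 : 2 ^ (i + (r + 1)) - 2 ^ (i + r) = 2 ^ (i + r) := by
      have : 2 ^ (i + (r + 1)) = 2 * 2 ^ (i + r) := by ring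
      omega
    rw [Nat.card_Ico, h5, nsmul_eq_mul] at h4
    push_cast at h4 ⊢
    rw [mul_one_div_cancel (by positivity)] at h4
    linarith

/-- A walk hits a given point between the times `2 ^ i` and `2 ^ (i + r)` with probability of order
at most `r / i`. This is sharp in dimension two; in higher dimensions it follows by looking at two
of the coordinates only. -/
theorem exists_wordProb_hits_le (hd : 2 ≤ d) : ∃ C : ℝ, 0 < C ∧ ∀ (i r n : ℕ) (c z : Fin d → ℤ),
    1 ≤ i → n ≤ 2 ^ (i + r) →
    wordProb (unitSteps d) n (Hits {z} c (2 ^ i)) ≤ C * (r + 1) / i := by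
  have hN := unitSteps_nonempty hd
  have hpi := Real.pi_pos
  have hd2 : (2 : ℝ) ≤ d := by exact_mod_cast hd
  set D : ℝ := 9 * Real.pi ^ 2 * d with hD
  have hDpos : 0 < D := by positivity
  refine ⟨D * 272 * 2, by positivity, ?_⟩
  intro i r n c z hi hn
  set i₀ : Fin d := ⟨0, by omega⟩
  set j₀ : Fin d := ⟨1, by omega⟩
  have hij : i₀ ≠ j₀ := by simp [i₀, j₀]
  set A : Set (Fin d → ℤ) := {v | v i₀ = z i₀ ∧ v j₀ = z j₀} with hA
  have hmem : ∀ (c v : Fin d → ℤ), c + v ∈ A ↔ v i₀ = z i₀ - c i₀ ∧ v j₀ = z j₀ - c j₀ := by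
    intro c v
    simp only [hA, Set.mem_ofPred_eq, Pi.add_apply]
    constructor <;> rintro ⟨h1, h2⟩ <;> constructor <;> linarith
  have h1 : wordProb (unitSteps d) n (Hits {z} c (2 ^ i))
      ≤ wordProb (unitSteps d) n (Hits A c (2 ^ i)) :=
    wordProb_mono _ fun w _ _ h => h.mono (by simp [hA]) le_rfl
  have h2 := wordProb_hits_mul_le (unitSteps d) hN A (2 ^ i) (i / 272) (fun c hc => by
    refine (le_sum_wordProb_proj_return hd i₀ j₀ i hi).trans (le_of_eq ?_)
    refine Finset.sum_congr rfl fun t _ => wordProb_congr _ fun w _ _ => ?_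
    rw [hmem, hc.1, hc.2, sub_self, sub_self]) n (2 ^ i) c
  have h3 : ∑ t ∈ Finset.Ico (2 ^ i) (n + 2 ^ i + 1),
      wordProb (unitSteps d) t (fun w => c + w.sum ∈ A) ≤ D * ((r : ℝ) + 2) := by
    calc _ ≤ ∑ t ∈ Finset.Ico (2 ^ i) (n + 2 ^ i + 1), D * ((1 : ℝ) / (t : ℕ)) := by
          refine Finset.sum_le_sum fun t ht => ?_
          simp only [hmem]
          rw [mul_one_div]
          rw [Finset.mem_Ico] at ht
          exact wordProb_proj_eq_le hd hij t (lt_of_lt_of_le (by positivity) ht.1) _ _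
      _ ≤ ∑ t ∈ Finset.Ico (2 ^ i) (2 ^ (i + (r + 2))), D * ((1 : ℝ) / (t : ℕ)) := by
          refine Finset.sum_le_sum_of_subset_of_nonneg (Finset.Ico_subset_Ico_right ?_)
            fun t _ _ => by positivity
          have e1 : 2 ^ (i + (r + 2)) = 4 * 2 ^ (i + r) := by ring
          have e2 : 2 ^ i ≤ 2 ^ (i + r) := Nat.pow_le_pow_right (by norm_num) (by omega)
          have e3 : 0 < 2 ^ i := by positivity
          omega
      _ ≤ D * ((r : ℝ) + 2) := by
          rw [← Finset.mul_sum]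
          have := sum_Ico_dyadic_inv_le i (r + 2)
          push_cast at this
          gcongr
  have hi' : (0 : ℝ) < i := by exact_mod_cast hi
  refine h1.trans ?_
  rw [le_div_iff₀ hi']
  have hr : (0 : ℝ) ≤ r := by positivity
  nlinarith

end HittingProbability

/-! ### Slow variation of the escape probability -/

section Escape

variable {V : Type*} [AddCommGroup V]

/-- The probability that the walk started at `0` avoids `Z` at the times `1, …, n`. -/
def escapeProb (N : Finset V) (Z : Set V) (n : ℕ) : ℝ :=
  wordProb N n (fun w => ¬ Hits Z 0 1 w)

theorem escapeProb_nonneg (N : Finset V) (Z : Set V) (n : ℕ) : 0 ≤ escapeProb N Z n :=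
  wordProb_nonneg N _ _

theorem escapeProb_le_one {N : Finset V} (hN : N.Nonempty) (Z : Set V) (n : ℕ) :
    escapeProb N Z n ≤ 1 :=
  wordProb_le_one N hN _ _

theorem escapeProb_antitone {N : Finset V} (hN : N.Nonempty) (Z : Set V) :
    Antitone (escapeProb N Z) := fun _ _ hmn =>
  wordProb_anti_length N hN hmn _ fun _ _ _ h hu => h ((hits_append (by omega)).2 (Or.inl hu))

/-- To avoid `Z` until time `m` but not until time `n`, the walk has to escape until time `m₀` and
then to hit `Z` after at least `M` further steps. -/
theorem escapeProb_sub_le {N : Finset V} (hN : N.Nonempty) (Z : Set V) {m₀ M m n : ℕ}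
    (hm : m₀ + M ≤ m) (hmn : m ≤ n) {η : ℝ}
    (hη : ∀ c, wordProb N (n - m₀) (Hits Z c M) ≤ η) :
    escapeProb N Z m - escapeProb N Z n ≤ escapeProb N Z m₀ * η := by
  have h1 : escapeProb N Z m = wordProb N n (fun w => ¬ Hits Z 0 1 (w.take m)) :=
    (wordProb_take N hN hmn (fun w => ¬ Hits Z 0 1 w)).symm
  have h2 := wordProb_or_le N n (fun w => ¬ Hits Z 0 1 (w.take m)) (fun w => ¬ Hits Z 0 1 w)
    (fun w => ¬ Hits Z 0 1 (w.take m) ∧ Hits Z 0 1 w) (fun w _ _ h => by tauto)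
  have h3 : wordProb N n (fun w => ¬ Hits Z 0 1 (w.take m) ∧ Hits Z 0 1 w)
      ≤ escapeProb N Z m₀ * η := by
    obtain ⟨k, rfl⟩ : ∃ k, n = m₀ + k := ⟨n - m₀, by omega⟩
    rw [wordProb_append, escapeProb, wordProb, ← wordMean_mul_const]
    refine wordMean_mono N fun u hu _ => ?_
    by_cases hP : Hits Z 0 1 u
    · rw [wordProb_false N]
      · simp [hP]
      · rintro v hv - ⟨hv1, -⟩
        refine hv1 ?_
        obtain ⟨i, hi1, hi2, hi3⟩ := hP
        refine ⟨i, hi1, by simp; omega, ?_⟩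
        rw [List.take_take, min_eq_left (by omega), List.take_append_of_le_length hi2]
        exact hi3
    · rw [if_pos hP, one_mul]
      rw [Nat.add_sub_cancel_left] at hη
      refine (wordProb_mono N fun v hv _ => ?_).trans (hη u.sum)
      rintro ⟨hv1, i, hi1, hi2, hi3⟩
      have him : m < i := by
        by_contra hcon
        refine hv1 ⟨i, hi1, by simp at hi2 ⊢; omega, ?_⟩
        rw [List.take_take, min_eq_left (by omega)]
        exact hi3
      refine ⟨i - m₀, by omega, by simp at hi2; omega, ?_⟩
      rw [List.take_append, List.take_of_length_le (by omega), List.sum_append, zero_add, hu] at hi3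
      exact hi3
  rw [h1]
  have : escapeProb N Z n = wordProb N n (fun w => ¬ Hits Z 0 1 w) := rfl
  linarith

/-- A one-dimensional lower bound: the walk stays in the half-space `λ > 0`, which is disjoint from
`Z`, with a probability bounded below by the harmonic function `λ`. -/
theorem le_wordProb_not_hits {N : Finset V} (hN : N.Nonempty) (Z : Set V) (lam : V →+ ℤ)
    (hZ : ∀ z ∈ Z, lam z = 0) (hge : ∀ e ∈ N, -1 ≤ lam e) (hle : ∀ e ∈ N, lam e ≤ 1)
    (hsum : ∑ e ∈ N, lam e = 0) (K n : ℕ) : ∀ c : V, 0 ≤ lam c → lam c + n ≤ K →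
      (lam c : ℝ) / K ≤ wordProb N n (fun w => ¬ Hits Z c 0 w) := by
  have hzero : ∀ n : ℕ, ∀ c : V, lam c = 0 →
      (lam c : ℝ) / K ≤ wordProb N n (fun w => ¬ Hits Z c 0 w) := by
    intro n c hc
    rw [hc]
    simpa using wordProb_nonneg N _ _
  induction n with
  | zero =>
    intro c hc hK
    rcases eq_or_ne (lam c) 0 with h0 | h0
    · exact hzero 0 c h0
    · have hcZ : c ∉ Z := fun h => h0 (hZ c h)
      rw [wordProb_zero, if_pos (by simpa [hits_nil] using hcZ)]
      have : (lam c : ℝ) ≤ K := by exact_mod_cast (by simpa using hK : lam c ≤ K)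
      exact div_le_one_of_le₀ this (by positivity)
  | succ n ih =>
    intro c hc hK
    rcases eq_or_ne (lam c) 0 with h0 | h0
    · exact hzero _ c h0
    · have hcZ : c ∉ Z := fun h => h0 (hZ c h)
      have hcard : (0 : ℝ) < N.card := by exact_mod_cast hN.card_pos
      rw [wordProb_succ, le_div_iff₀ hcard]
      calc (lam c : ℝ) / K * N.card = ∑ e ∈ N, ((lam (c + e) : ℤ) : ℝ) / K := by
            rw [← Finset.sum_div]
            simp only [map_add, Int.cast_add, Finset.sum_add_distrib, Finset.sum_const,
              nsmul_eq_mul]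
            have : ∑ e ∈ N, ((lam e : ℤ) : ℝ) = 0 := by exact_mod_cast hsum
            rw [this]
            ring
        _ ≤ ∑ e ∈ N, wordProb N n (fun w => ¬ Hits Z c 0 (e :: w)) := by
            refine Finset.sum_le_sum fun e he => ?_
            have h1 := ih (c + e) (by rw [map_add]; have := hge e he; omega)
              (by rw [map_add]; have := hle e he; push_cast at hK; omega)
            refine h1.trans (le_of_eq (wordProb_congr N fun w _ _ => ?_))
            rw [hits_cons_zero]
            simp [hcZ]

/-- A polynomial lower bound for the probability to escape, from a first step in a direction in
which the functional `λ` equals `1` and the harmonic lower bound afterwards. -/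
theorem le_escapeProb {N : Finset V} (hN : N.Nonempty) (Z : Set V) (lam : V →+ ℤ)
    (hZ : ∀ z ∈ Z, lam z = 0) (hge : ∀ e ∈ N, -1 ≤ lam e) (hle : ∀ e ∈ N, lam e ≤ 1)
    (hsum : ∑ e ∈ N, lam e = 0) {e₀ : V} (he₀ : e₀ ∈ N) (hlam : lam e₀ = 1) (n : ℕ) :
    1 / ((n : ℝ) + 1) / N.card ≤ escapeProb N Z (n + 1) := by
  have hcard : (0 : ℝ) < N.card := by exact_mod_cast hN.card_pos
  rw [escapeProb, wordProb_succ]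
  gcongr
  simp only [hits_cons_succ, zero_add]
  have h1 := le_wordProb_not_hits hN Z lam hZ hge hle hsum (n + 1) n e₀ (by omega)
    (by rw [hlam]; push_cast; omega)
  rw [hlam] at h1
  push_cast at h1
  exact h1.trans (Finset.single_le_sum
    (f := fun e => wordProb N n (fun w => ¬ Hits Z e 0 w)) (fun e _ => wordProb_nonneg N _ _) he₀)

/-- A sequence whose decrements are of relative order `1 / i` cannot decay faster than a power,
unless it decays geometrically. -/
theorem exists_monotone_mul_pow {a : ℕ → ℝ} (ha : ∀ i, 0 ≤ a i) {K c : ℝ}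
    (hK : 0 ≤ K) (hdec : ∀ i, 1 ≤ i → a (i + 1) - a (i + 2) ≤ K / i * a i) (hc : 0 < c)
    (hlow : ∀ i, c / 2 ^ i ≤ a i) :
    ∃ A i₁ : ℕ, ∀ i ≥ i₁, a i * ((i : ℝ) + 1) ^ A ≤ a (i + 1) * ((i : ℝ) + 2) ^ A := by
  obtain ⟨i₀, hi₀⟩ := exists_nat_ge (max 1 (8 * K))
  have hi₀1 : 1 ≤ i₀ := by exact_mod_cast (le_max_left _ _).trans hi₀
  have hi₀K : 8 * K ≤ i₀ := (le_max_right _ _).trans hi₀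
  -- at some scale beyond `i₀` the sequence does not drop by more than a factor `4`
  obtain ⟨i₂, hi₂, h4⟩ : ∃ i ≥ i₀, a i ≤ 4 * a (i + 1) := by
    by_contra hcon
    push Not at hcon
    have hgeo : ∀ k : ℕ, a (i₀ + k) * 4 ^ k ≤ a i₀ := by
      intro k
      induction k with
      | zero => simp
      | succ k ih =>
        have := hcon (i₀ + k) (by omega)
        rw [pow_succ]
        have h4 : (0 : ℝ) < 4 ^ k := by positivity
        rw [← add_assoc]
        nlinarith
    obtain ⟨k, hk⟩ := pow_unbounded_of_one_lt (a i₀ * 2 ^ i₀ / c) (one_lt_two (α := ℝ))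
    have h1 := hgeo k
    have h2 := hlow (i₀ + k)
    have h4 : (4 : ℝ) ^ k = 2 ^ k * 2 ^ k := by rw [← mul_pow]; norm_num
    have h5 : c / 2 ^ (i₀ + k) * 4 ^ k ≤ a i₀ :=
      (mul_le_mul_of_nonneg_right h2 (by positivity)).trans h1
    rw [div_lt_iff₀ hc] at hk
    have h6 : c / 2 ^ (i₀ + k) * 4 ^ k = c * 2 ^ k / 2 ^ i₀ := by
      rw [h4, pow_add]; field_simp
    rw [h6, div_le_iff₀ (by positivity)] at h5
    linarith
  have hstep : ∀ i, i₀ ≤ i → a i ≤ 4 * a (i + 1) → a (i + 1) * (1 - 4 * K / i) ≤ a (i + 2) := by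
    intro i hi h
    have hi' : (0 : ℝ) < i := by exact_mod_cast (by omega : 0 < i)
    have h1 := hdec i (by omega)
    have h2 : K / i * a i ≤ K / i * (4 * a (i + 1)) := by gcongr
    have h3 : K / i * (4 * a (i + 1)) = a (i + 1) * (4 * K / i) := by ring
    nlinarith
  have hratio : ∀ i, i₀ ≤ i → 4 * K / i ≤ 1 / 2 := by
    intro i hi
    have hi' : (0 : ℝ) < i := by exact_mod_cast (by omega : 0 < i)
    have : (i₀ : ℝ) ≤ i := by exact_mod_cast hi
    rw [div_le_iff₀ hi']
    linarith
  have hall : ∀ i ≥ i₂, a i ≤ 4 * a (i + 1) := by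
    intro i hi
    induction i, hi using Nat.le_induction with
    | base => exact h4
    | succ i hi ih =>
      have h1 := hstep i (by omega) ih
      have h2 := hratio i (by omega)
      nlinarith [ha (i + 1), ha (i + 2)]
  obtain ⟨A, hA⟩ := exists_nat_ge (24 * K)
  refine ⟨A, i₂ + 1, fun i hi => ?_⟩
  obtain ⟨i, rfl⟩ : ∃ k, i = k + 1 := ⟨i - 1, by omega⟩
  have hi0 : i₀ ≤ i := by omega
  have hi1 : (1 : ℝ) ≤ i := by exact_mod_cast (by omega : 1 ≤ i)
  have h1 := hstep i hi0 (hall i (by omega))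
  have h2 := hratio i hi0
  set y : ℝ := 4 * K / i with hy
  have hy0 : 0 ≤ y := by positivity
  -- Bernoulli's inequality
  have hb : 1 + 2 * y ≤ (((i : ℝ) + 3) / ((i : ℝ) + 2)) ^ A := by
    have e1 : ((i : ℝ) + 3) / ((i : ℝ) + 2) = 1 + 1 / ((i : ℝ) + 2) := by field_simp; ring
    have e2 := one_add_mul_le_pow (a := 1 / ((i : ℝ) + 2))
      (by have : (0 : ℝ) ≤ 1 / ((i : ℝ) + 2) := by positivity
          linarith) A
    rw [e1]
    refine le_trans ?_ e2
    have e3 : 2 * y ≤ A * (1 / ((i : ℝ) + 2)) := by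
      rw [hy, mul_one_div, ← mul_div_assoc, div_le_div_iff₀ (by linarith) (by linarith)]
      nlinarith
    linarith
  have h3 : a (i + 1) ≤ a (i + 2) * (1 + 2 * y) := by
    nlinarith [ha (i + 1), ha (i + 2), mul_nonneg (ha (i + 1)) hy0]
  have h4 : a (i + 1) ≤ a (i + 2) * (((i : ℝ) + 3) / ((i : ℝ) + 2)) ^ A :=
    h3.trans (mul_le_mul_of_nonneg_left hb (ha _))
  rw [div_pow, ← mul_div_assoc, le_div_iff₀ (by positivity)] at h4
  push_cast
  rw [show (i : ℝ) + 1 + 1 = i + 2 by ring, show (i : ℝ) + 1 + 2 = i + 3 by ring]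
  exact h4

end Escape

/-! ### Occurrences of the words of a code -/

section Code

variable {V : Type*}

/-- The probability that a random word starts with one of the words of a prefix-free set `𝓛`, that
is, the sum over `l ∈ 𝓛` of `|N| ^ (-|l|)`. -/
def codeWeight (N : Finset V) (𝓛 : Finset (List V)) : ℝ :=
  ∑ l ∈ 𝓛, ((N.card : ℝ)⁻¹) ^ l.length

theorem codeWeight_nonneg (N : Finset V) (𝓛 : Finset (List V)) : 0 ≤ codeWeight N 𝓛 :=
  Finset.sum_nonneg fun _ _ => by positivity

theorem wordProb_eq_word {N : Finset V} (l : List V) : (∀ e ∈ l, e ∈ N) →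
    wordProb N l.length (fun w => w = l) = ((N.card : ℝ)⁻¹) ^ l.length := by
  induction l with
  | nil => intro _; simp [wordProb_zero]
  | cons e l ih =>
    intro h
    rw [List.length_cons, wordProb_succ, Finset.sum_eq_single e]
    · have : wordProb N l.length (fun w => e :: w = e :: l)
          = wordProb N l.length (fun w => w = l) := wordProb_congr N fun w _ _ => by simp
      rw [this, ih fun x hx => h x (by simp [hx]), pow_succ]
      ring
    · intro x _ hx
      exact wordProb_false N fun w _ _ hw => hx (List.cons_eq_cons.1 hw).1
    · intro he
      exact absurd (h e (by simp)) he

/-- The word `l` occurs in `w` at position `m`. -/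
def OccursAt (l : List V) (m : ℕ) (w : List V) : Prop :=
  ∃ u v, w = u ++ (l ++ v) ∧ u.length = m

theorem exists_of_append_eq_append {a b c d : List V} (h : a ++ b = c ++ d)
    (hac : a.length ≤ c.length) : ∃ e, c = a ++ e ∧ b = e ++ d := by
  rcases List.append_eq_append_iff.1 h with ⟨as, h1, h2⟩ | ⟨bs, h1, h2⟩
  · exact ⟨as, h1, h2⟩
  · have : bs = [] := by
      have := congrArg List.length h1
      simp only [List.length_append] at this
      exact List.eq_nil_of_length_eq_zero (by omega)
    subst this
    exact ⟨[], by simpa using h1.symm, by simpa using h2.symm⟩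

theorem eq_of_append_word {u u' x l r v : List V} (h : u ++ (x ++ r) = u' ++ (l ++ v))
    (hu : u.length = u'.length) (hx : x.length = l.length) : u = u' ∧ x = l ∧ r = v := by
  obtain ⟨h1, h2⟩ := List.append_inj h hu
  obtain ⟨h3, h4⟩ := List.append_inj h2 hx
  exact ⟨h1, h3, h4⟩

theorem OccursAt.add_length_le {l : List V} {m : ℕ} {w : List V} (h : OccursAt l m w) :
    m + l.length ≤ w.length := by
  obtain ⟨u, v, rfl, rfl⟩ := h
  simp

theorem OccursAt.eq_of_prefixFree {𝓛 : Finset (List V)}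
    (hpf : ∀ l ∈ 𝓛, ∀ l' ∈ 𝓛, l <+: l' → l = l') {l l' : List V} (hl : l ∈ 𝓛) (hl' : l' ∈ 𝓛)
    {m : ℕ} {w : List V} (h : OccursAt l m w) (h' : OccursAt l' m w) : l = l' := by
  obtain ⟨u, v, rfl, hu⟩ := h
  obtain ⟨u', v', h2, hu'⟩ := h'
  have h3 := (List.append_inj h2 (hu.trans hu'.symm)).2
  have h4 : l <+: l ++ v := List.prefix_append _ _
  have h5 : l' <+: l ++ v := h3 ▸ List.prefix_append _ _
  rcases List.prefix_or_prefix_of_prefix h4 h5 with h | h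
  · exact hpf l hl l' hl' h
  · exact (hpf l' hl' l hl h).symm

/-- At most one word of a prefix-free set occurs at a given position. -/
theorem sum_indicator_le_one {𝓛 : Finset (List V)}
    (hpf : ∀ l ∈ 𝓛, ∀ l' ∈ 𝓛, l <+: l' → l = l') {m : ℕ} {w : List V} (P : List V → Prop)
    [DecidablePred P] (hP : ∀ l ∈ 𝓛, P l → OccursAt l m w) :
    ∑ l ∈ 𝓛, (if P l then (1 : ℝ) else 0) ≤ 1 := by
  rw [Finset.sum_ite, Finset.sum_const_zero, add_zero, Finset.sum_const, nsmul_eq_mul, mul_one]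
  have : (𝓛.filter P).card ≤ 1 := by
    refine Finset.card_le_one.2 fun l hl l' hl' => ?_
    rw [Finset.mem_filter] at hl hl'
    exact OccursAt.eq_of_prefixFree hpf hl.1 hl'.1 (hP l hl.1 hl.2) (hP l' hl'.1 hl'.2)
  exact_mod_cast this

theorem wordMean_one_word {N : Finset V} {l : List V} (hl : ∀ e ∈ l, e ∈ N) (m t : ℕ)
    (F G f : List V → ℝ)
    (hf : ∀ u x v, u.length = m → x.length = l.length → v.length = t →
      f (u ++ (x ++ v)) = if x = l then F u * G v else 0) :
    wordMean N (m + (l.length + t)) f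
      = wordMean N m F * ((N.card : ℝ)⁻¹) ^ l.length * wordMean N t G := by
  rw [wordMean_append, mul_assoc, ← wordMean_mul_const]
  refine wordMean_congr N fun u hu _ => ?_
  rw [wordMean_append, ← wordProb_eq_word l hl, wordProb, ← wordMean_mul_const,
    ← wordMean_const_mul]
  refine wordMean_congr N fun x hx _ => ?_
  rw [← wordMean_const_mul, ← wordMean_const_mul]
  refine wordMean_congr N fun v hv _ => ?_
  rw [hf u x v hu hx hv]
  split_ifs <;> ring

/-- Upper bound for the mean of a function that is supported on the words with two prescribed
subwords, the remaining letters being independent. -/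
theorem wordMean_two_words_le {N : Finset V} {l l' : List V} (hl : ∀ e ∈ l, e ∈ N)
    (hl' : ∀ e ∈ l', e ∈ N) (m s t : ℕ) (F : List V → ℝ) (G : List V → List V → ℝ)
    (f : List V → ℝ)
    (hf : ∀ u x σ y v, u.length = m → x.length = l.length → σ.length = s →
      y.length = l'.length → v.length = t →
      f (u ++ (x ++ (σ ++ (y ++ v)))) ≤ if x = l ∧ y = l' then F u * G σ v else 0) :
    wordMean N (m + (l.length + (s + (l'.length + t)))) f
      ≤ wordMean N m F * (((N.card : ℝ)⁻¹) ^ l.length * ((N.card : ℝ)⁻¹) ^ l'.length)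
        * wordMean N s (fun σ => wordMean N t (G σ)) := by
  rw [← wordProb_eq_word l hl, ← wordProb_eq_word l' hl']
  have h1 : wordMean N (m + (l.length + (s + (l'.length + t)))) f
      ≤ wordMean N m (fun u => wordMean N l.length (fun x => wordMean N s (fun σ =>
        wordMean N l'.length (fun y => wordMean N t (fun v =>
          F u * ((if x = l then 1 else 0) * ((if y = l' then 1 else 0) * G σ v))))))) := by
    rw [wordMean_append]
    refine wordMean_mono N fun u hu _ => ?_
    rw [wordMean_append]
    refine wordMean_mono N fun x hx _ => ?_
    rw [wordMean_append]
    refine wordMean_mono N fun σ hσ _ => ?_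
    rw [wordMean_append]
    refine wordMean_mono N fun y hy _ => ?_
    refine wordMean_mono N fun v hv _ => ?_
    refine (hf u x σ y v hu hx hσ hy hv).trans (le_of_eq ?_)
    by_cases hxl : x = l <;> by_cases hyl : y = l' <;> simp [hxl, hyl]
  refine h1.trans (le_of_eq ?_)
  simp only [wordMean_const_mul, wordMean_mul_const, wordMean_ite]
  ring

theorem wordProb_occursAt_two_le {N : Finset V} (hN : N.Nonempty) {l l' : List V}
    (hl : ∀ e ∈ l, e ∈ N) (hl' : ∀ e ∈ l', e ∈ N) {m m' n : ℕ} (hm : m + l.length ≤ m') :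
    wordProb N n (fun w => OccursAt l m w ∧ OccursAt l' m' w)
      ≤ ((N.card : ℝ)⁻¹) ^ l.length * ((N.card : ℝ)⁻¹) ^ l'.length := by
  by_cases hn : m' + l'.length ≤ n
  · obtain ⟨s, rfl⟩ := Nat.exists_eq_add_of_le hm
    obtain ⟨t, rfl⟩ := Nat.exists_eq_add_of_le hn
    have h := wordMean_two_words_le hl hl' m s t (fun _ => 1) (fun _ _ => 1)
      (fun w => if OccursAt l m w ∧ OccursAt l' (m + l.length + s) w then 1 else 0) (by
        intro u x σ y v hu hx hσ hy hv
        by_cases h : OccursAt l m (u ++ (x ++ (σ ++ (y ++ v)))) ∧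
          OccursAt l' (m + l.length + s) (u ++ (x ++ (σ ++ (y ++ v))))
        · obtain ⟨⟨u1, v1, h1, h2⟩, ⟨u2, v2, h3, h4⟩⟩ := h
          have e1 := eq_of_append_word h1 (hu.trans h2.symm) hx
          have e2 : (u ++ (x ++ σ)) ++ (y ++ v) = u2 ++ (l' ++ v2) := by
            rw [← h3]; simp only [List.append_assoc]
          have e3 := eq_of_append_word e2 (by simp; omega) hy
          rw [if_pos (show x = l ∧ y = l' from ⟨e1.2.1, e3.2.1⟩)]
          split_ifs <;> norm_num
        · rw [if_neg h]
          split_ifs <;> norm_num)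
    simp only [wordMean_const N hN, one_mul, mul_one] at h
    rw [wordMean_ite] at h
    convert h using 2
    omega
  · rw [wordProb_false N]
    · positivity
    · rintro w hw - ⟨-, h⟩
      have := h.add_length_le
      omega

theorem wordProb_occursAt_le {N : Finset V} (hN : N.Nonempty) {l : List V} 
    (hl : ∀ e ∈ l, e ∈ N) (m n : ℕ) :
    wordProb N n (fun w => OccursAt l m w) ≤ ((N.card : ℝ)⁻¹) ^ l.length := by
  have h := wordProb_occursAt_two_le hN (l := []) (l' := l) (m := 0) (m' := m) (n := n) (by simp) hl
    (by simp)
  refine (wordProb_mono N fun w hw _ hocc => ?_).trans (h.trans (by simp))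
  exact ⟨⟨[], w, by simp, rfl⟩, hocc⟩

theorem codeWeight_reverse (N : Finset V) (𝓛 : Finset (List V)) :
    codeWeight N (𝓛.image List.reverse) = codeWeight N 𝓛 := by
  rw [codeWeight, Finset.sum_image fun _ _ _ _ h => List.reverse_injective h]
  simp [codeWeight]

/-- A count of events, squared, is the count of pairs of events. -/
theorem sq_sum_sum_indicator (R : Finset ℕ) (𝓛 : Finset (List V)) (P : List V → ℕ → Prop) :
    (∑ m ∈ R, ∑ l ∈ 𝓛, if P l m then (1 : ℝ) else 0) ^ 2
      = ∑ m ∈ R, ∑ m' ∈ R, ∑ l ∈ 𝓛, ∑ l' ∈ 𝓛, if P l m ∧ P l' m' then (1 : ℝ) else 0 := by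
  rw [sq, Finset.sum_mul_sum]
  refine Finset.sum_congr rfl fun m _ => Finset.sum_congr rfl fun m' _ => ?_
  rw [Finset.sum_mul_sum]
  refine Finset.sum_congr rfl fun l _ => Finset.sum_congr rfl fun l' _ => ?_
  by_cases h1 : P l m <;> by_cases h2 : P l' m' <;> simp [h1, h2]

end Code

section PairEstimate

variable {V : Type*} [AddCommGroup V]

theorem wordProb_hits_finset_le {N : Finset V} (Z : Finset V) {M n : ℕ} {c : V} {η : ℝ}
    (hη : ∀ z, wordProb N n (Hits {z} c M) ≤ η) :
    wordProb N n (Hits (Z : Set V) c M) ≤ Z.card * η := by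
  refine (wordProb_le_sum N n Z _ (fun z w => Hits {z} c M w) fun w _ h => ?_).trans ?_
  · obtain ⟨i, h1, h2, h3⟩ := h
    exact ⟨_, h3, i, h1, h2, rfl⟩
  · refine (Finset.sum_le_card_nsmul _ _ η fun z _ => hη z).trans ?_
    rw [nsmul_eq_mul]

/-- Two paths that use the same steps `w`, and whose starting points differ by an independent walk
of length `a ≥ M`, both hit `Z` after time `M` with probability of order `η²`. -/
theorem wordMean_double_hit_le {N : Finset V} (hN : N.Nonempty) (hneg : ∀ e, -e ∈ N ↔ e ∈ N)
    (Z : Finset V) {M a n K : ℕ} {η : ℝ} (haM : M ≤ a) (hK : a + n ≤ K)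
    (hη : ∀ k ≤ K, ∀ c z, wordProb N k (Hits {z} c M) ≤ η) (c₁ c₂ : V) :
    wordMean N a (fun s => wordProb N n (fun w => Hits (Z : Set V) (c₁ + s.sum) M w ∧
        Hits (Z : Set V) c₂ M w)) ≤ 2 * (Z.card : ℝ) ^ 2 * η ^ 2 := by
  have hη0 : 0 ≤ η := (wordProb_nonneg N _ _).trans (hη 0 (Nat.zero_le _) 0 0)
  set Q : V → ℝ := fun c => wordProb N n (Hits (Z : Set V) c 0) with hQ
  have hQavg : ∀ c, wordMean N a (fun s => Q (c + s.sum)) ≤ Z.card * η := by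
    intro c
    have h1 : wordMean N a (fun s => Q (c + s.sum))
        ≤ wordProb N (a + n) (Hits (Z : Set V) c M) := by
      rw [wordProb_append]
      refine wordMean_mono N fun s hs _ => wordProb_mono N fun v _ _ hv => ?_
      exact (Hits.append_left hv).mono subset_rfl (by omega)
    exact h1.trans (wordProb_hits_finset_le Z fun z => hη _ hK c z)
  have hQavg' : ∀ c, wordMean N a (fun s => Q (c - s.sum)) ≤ Z.card * η := by
    intro c
    rw [← wordMean_map (Equiv.neg V) (fun e => hneg e)]
    simp only [sum_map_neg, sub_neg_eq_add]
    exact hQavg c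
  have hin : ∀ s : List V, wordProb N n (fun w => Hits (Z : Set V) (c₁ + s.sum) M w ∧
      Hits (Z : Set V) c₂ M w)
      ≤ ∑ z ∈ Z, η * (Q (z + (c₂ - c₁) - s.sum) + Q (z + (c₁ - c₂) + s.sum)) := by
    intro s
    have h1 : wordProb N n (fun w => Hits (Z : Set V) (c₁ + s.sum) M w ∧ Hits (Z : Set V) c₂ M w)
        ≤ ∑ z ∈ Z, wordProb N n (fun w =>
          (∃ i j, M ≤ i ∧ i ≤ j ∧ j ≤ w.length ∧ c₁ + s.sum + (w.take i).sum = z ∧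
            c₁ + s.sum + (c₂ - (c₁ + s.sum)) + (w.take j).sum ∈ (Z : Set V)) ∨
          (∃ i j, M ≤ i ∧ i ≤ j ∧ j ≤ w.length ∧ c₂ + (w.take i).sum = z ∧
            c₂ + (c₁ + s.sum - c₂) + (w.take j).sum ∈ (Z : Set V))) := by
      refine wordProb_le_sum N n Z _ _ fun w _ h => ?_
      obtain ⟨⟨i, hi1, hi2, hi3⟩, ⟨j, hj1, hj2, hj3⟩⟩ := h
      rcases le_total i j with hij | hij
      · refine ⟨_, hi3, Or.inl ⟨i, j, hi1, hij, hj2, rfl, ?_⟩⟩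
        rwa [add_sub_cancel]
      · refine ⟨_, hj3, Or.inr ⟨j, i, hj1, hij, hi2, rfl, ?_⟩⟩
        rwa [add_sub_cancel]
    refine h1.trans (Finset.sum_le_sum fun z _ => ?_)
    refine (wordProb_or_le N n _ _ _ fun w _ _ h => h).trans ?_
    rw [mul_add]
    have hkn : n ≤ K := by omega
    refine add_le_add ?_ ?_
    · refine (wordProb_two_hits_le N hN z (c₂ - (c₁ + s.sum)) (Z : Set V) n M (c₁ + s.sum)).trans ?_
      have : z + (c₂ - (c₁ + s.sum)) = z + (c₂ - c₁) - s.sum := by abel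
      rw [this]
      exact mul_le_mul_of_nonneg_right (hη n hkn _ _) (wordProb_nonneg N _ _)
    · refine (wordProb_two_hits_le N hN z (c₁ + s.sum - c₂) (Z : Set V) n M c₂).trans ?_
      have : z + (c₁ + s.sum - c₂) = z + (c₁ - c₂) + s.sum := by abel
      rw [this]
      exact mul_le_mul_of_nonneg_right (hη n hkn _ _) (wordProb_nonneg N _ _)
  calc _ ≤ wordMean N a (fun s =>
        ∑ z ∈ Z, η * (Q (z + (c₂ - c₁) - s.sum) + Q (z + (c₁ - c₂) + s.sum))) :=
        wordMean_mono N fun s _ _ => hin s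
    _ = ∑ z ∈ Z, η * (wordMean N a (fun s => Q (z + (c₂ - c₁) - s.sum))
          + wordMean N a (fun s => Q (z + (c₁ - c₂) + s.sum))) := by
        rw [wordMean_sum]
        simp only [wordMean_const_mul, wordMean_add]
    _ ≤ ∑ z ∈ Z, η * (Z.card * η + Z.card * η) := by
        gcongr with z hz
        · exact hQavg' _
        · exact hQavg _
    _ = _ := by rw [Finset.sum_const, nsmul_eq_mul]; ring

/-- A splitting `w = u ++ l ++ v` for which the point reached by `u` is new, in the sense that the
path `u` visited no point of `x - Z` before reaching its end point `x`, and such that the path `v`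
starting at `x` does not enter `x + Z`. Here `m` is the length of `u`. -/
def GoodSplit (Z : Set V) (l : List V) (m : ℕ) (w : List V) : Prop :=
  ∃ u v, w = u ++ (l ++ v) ∧ u.length = m ∧ ¬ Hits Z 0 1 u.reverse ∧ ¬ Hits Z 0 1 v

/-- A good splitting of `w` that ceases to be good once `w` is continued by `w'`. -/
def KilledSplit (Z : Set V) (l : List V) (m : ℕ) (w w' : List V) : Prop :=
  ∃ u v, w = u ++ (l ++ v) ∧ u.length = m ∧ ¬ Hits Z 0 1 u.reverse ∧ ¬ Hits Z 0 1 v ∧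
    Hits Z v.sum 1 w'

theorem GoodSplit.occursAt {Z : Set V} {l : List V} {m : ℕ} {w : List V}
    (h : GoodSplit Z l m w) : OccursAt l m w := by
  obtain ⟨u, v, h1, h2, -⟩ := h
  exact ⟨u, v, h1, h2⟩

theorem KilledSplit.goodSplit {Z : Set V} {l : List V} {m : ℕ} {w w' : List V}
    (h : KilledSplit Z l m w w') : GoodSplit Z l m w := by
  obtain ⟨u, v, h1, h2, h3, h4, -⟩ := h
  exact ⟨u, v, h1, h2, h3, h4⟩

/-- The probability that two good splittings at a large distance from each other and from the ends
of the word are both killed by the continuation. The factor `escapeProb ^ 4` comes from the past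
and the future of both splittings, up to the time `M`, and the factor `η²` from the two hits. -/
theorem wordMean_killedSplit_two_le {N : Finset V} (hN : N.Nonempty) (hneg : ∀ e, -e ∈ N ↔ e ∈ N)
    (Z : Finset V) {M n n' : ℕ} {η : ℝ}
    (hη : ∀ k ≤ n + n', ∀ c z, wordProb N k (Hits {z} c M) ≤ η) {l l' : List V}
    (hl : ∀ e ∈ l, e ∈ N) (hl' : ∀ e ∈ l', e ∈ N) (hl'0 : l'.sum = 0) {m m' : ℕ}
    (hm : M ≤ m) (hmm : m + l.length + 3 * M ≤ m') (hn : m' + l'.length + 2 * M ≤ n) :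
    wordMean N n (fun w => wordProb N n' (fun w' => KilledSplit (Z : Set V) l m w w' ∧
        KilledSplit (Z : Set V) l' m' w w'))
      ≤ ((N.card : ℝ)⁻¹) ^ l.length * ((N.card : ℝ)⁻¹) ^ l'.length
        * (escapeProb N Z M ^ 4 * (2 * (Z.card : ℝ) ^ 2 * η ^ 2)) := by
  obtain ⟨a, ha⟩ : ∃ a, m' = m + l.length + (M + ((a + M) + M)) :=
    ⟨m' - (m + l.length + 3 * M), by omega⟩
  obtain ⟨b, hb⟩ : ∃ b, n = m' + l'.length + (M + (b + M)) :=
    ⟨n - (m' + l'.length + 2 * M), by omega⟩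
  set D : V → V → ℝ := fun c₁ c₂ => wordMean N (a + M) (fun s =>
    wordProb N ((b + M) + n') (fun w => Hits (Z : Set V) (c₁ + s.sum) M w ∧
        Hits (Z : Set V) c₂ M w)) with hD
  have hDle : ∀ c₁ c₂, D c₁ c₂ ≤ 2 * (Z.card : ℝ) ^ 2 * η ^ 2 := fun c₁ c₂ =>
    wordMean_double_hit_le hN hneg Z (by omega) (by omega) hη c₁ c₂
  have hη0 : 0 ≤ 2 * (Z.card : ℝ) ^ 2 * η ^ 2 := by positivity
  set A : List V → ℝ := fun w => if ¬ Hits (Z : Set V) 0 1 w then 1 else 0 with hA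
  have hA0 : ∀ w, 0 ≤ A w := fun w => by simp only [hA]; split_ifs <;> norm_num
  have hAM : wordMean N M A = escapeProb N Z M := wordMean_ite N M _
  have hAM' : wordMean N M (fun w => A w.reverse) = escapeProb N Z M := by
    rw [wordMean_reverse, hAM]
  set G : List V → List V → ℝ := fun σ v =>
    A (σ.take M) * (A ((σ.drop (M + (a + M))).reverse) * (A (v.take M) *
      wordProb N n' (fun w' => Hits (Z : Set V) (σ.sum + v.sum) 1 w' ∧
        Hits (Z : Set V) v.sum 1 w'))) with hG
  have hGle : wordMean N (M + ((a + M) + M)) (fun σ => wordMean N (M + (b + M)) (G σ))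
      ≤ escapeProb N Z M ^ 3 * (2 * (Z.card : ℝ) ^ 2 * η ^ 2) := by
    calc _ = wordMean N M (fun sa => wordMean N (a + M) (fun s0 => wordMean N M (fun sb =>
          wordMean N M (fun va => wordMean N (b + M) (fun v0 =>
            G (sa ++ (s0 ++ sb)) (va ++ v0)))))) := by
          rw [wordMean_append]
          congr 1; ext sa
          rw [wordMean_append]
          congr 1; ext s0
          congr 1; ext sb
          rw [wordMean_append]
      _ ≤ wordMean N M (fun sa => wordMean N (a + M) (fun s0 => wordMean N M (fun sb =>
          wordMean N M (fun va => A sa * (A sb.reverse * (A va *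
            wordProb N ((b + M) + n') (fun w =>
              Hits (Z : Set V) (sa.sum + sb.sum + va.sum + s0.sum) M w ∧
                Hits (Z : Set V) va.sum M w))))))) := by
          refine wordMean_mono N fun sa hsa _ => wordMean_mono N fun s0 hs0 _ =>
            wordMean_mono N fun sb hsb _ => wordMean_mono N fun va hva _ => ?_
          rw [wordProb_append, ← wordMean_const_mul, ← wordMean_const_mul, ← wordMean_const_mul]
          refine wordMean_mono N fun v0 hv0 _ => ?_
          have e1 : (sa ++ (s0 ++ sb)).take M = sa := by
            rw [← hsa, List.take_left]
          have e2 : (sa ++ (s0 ++ sb)).drop (M + (a + M)) = sb := by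
            have : M + (a + M) = (sa ++ s0).length := by simp; omega
            rw [this, ← List.append_assoc, List.drop_left]
          have e3 : (va ++ v0).take M = va := by
            rw [← hva, List.take_left]
          simp only [hG, e1, e2, e3]
          refine mul_le_mul_of_nonneg_left (mul_le_mul_of_nonneg_left
            (mul_le_mul_of_nonneg_left ?_ (hA0 _)) (hA0 _)) (hA0 _)
          refine wordProb_mono N fun w' _ _ => ?_
          rintro ⟨h1, h2⟩
          constructor
          · have e4 : (sa ++ (s0 ++ sb)).sum + (va ++ v0).sum
                = sa.sum + sb.sum + va.sum + s0.sum + v0.sum := by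
              simp only [List.sum_append]; abel
            rw [e4] at h1
            exact (Hits.append_left h1).mono subset_rfl (by omega)
          · rw [List.sum_append] at h2
            exact (Hits.append_left h2).mono subset_rfl (by omega)
      _ = wordMean N M (fun sa => A sa * wordMean N M (fun sb => A sb.reverse *
            wordMean N M (fun va => A va * D (sa.sum + sb.sum + va.sum) va.sum))) := by
          -- average over `s0` last
          congr 1; ext sa
          rw [wordMean_comm, ← wordMean_const_mul]
          congr 1; ext sb
          rw [wordMean_comm, ← wordMean_const_mul, ← wordMean_const_mul]
          congr 1; ext va
          simp only [wordMean_const_mul, hD]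
      _ ≤ wordMean N M (fun sa => A sa * wordMean N M (fun sb => A sb.reverse *
            wordMean N M (fun va => A va * (2 * (Z.card : ℝ) ^ 2 * η ^ 2)))) := by
          refine wordMean_mono N fun sa _ _ => mul_le_mul_of_nonneg_left
            (wordMean_mono N fun sb _ _ => mul_le_mul_of_nonneg_left
              (wordMean_mono N fun va _ _ => mul_le_mul_of_nonneg_left (hDle _ _) (hA0 _))
              (hA0 _)) (hA0 _)
      _ = _ := by
          simp only [wordMean_mul_const, hAM, hAM']
          ring
  have hF : wordMean N m (fun u => A u.reverse) ≤ escapeProb N Z M := by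
    rw [wordMean_reverse, hA, wordMean_ite]
    exact escapeProb_antitone hN Z hm
  have h := wordMean_two_words_le hl hl' m (M + ((a + M) + M)) (M + (b + M))
    (fun u => A u.reverse) G
    (fun w => wordProb N n' (fun w' => KilledSplit (Z : Set V) l m w w' ∧
        KilledSplit (Z : Set V) l' m' w w')) (by
      intro u x σ y v hu hx hσ hy hv
      have hkey : ∀ w', (KilledSplit (Z : Set V) l m (u ++ (x ++ (σ ++ (y ++ v)))) w' ∧
          KilledSplit (Z : Set V) l' m' (u ++ (x ++ (σ ++ (y ++ v)))) w') →
          (x = l ∧ y = l') ∧ ¬ Hits (Z : Set V) 0 1 u.reverse ∧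
          ¬ Hits (Z : Set V) 0 1 (σ.take M) ∧
          ¬ Hits (Z : Set V) 0 1 (σ.drop (M + (a + M))).reverse ∧
          ¬ Hits (Z : Set V) 0 1 (v.take M) ∧
          Hits (Z : Set V) (σ.sum + v.sum) 1 w' ∧ Hits (Z : Set V) v.sum 1 w' := by
        rintro w' ⟨⟨u1, v1, h1, h2, h3, h4, h5⟩, ⟨u2, v2, h6, h7, h8, h9, h10⟩⟩
        obtain ⟨rfl, rfl, rfl⟩ := eq_of_append_word h1 (hu.trans h2.symm) hx
        have e2 : (u ++ (x ++ σ)) ++ (y ++ v) = u2 ++ (l' ++ v2) := by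
          rw [← h6]; simp only [List.append_assoc]
        obtain ⟨rfl, rfl, rfl⟩ := eq_of_append_word e2 (by simp; omega) hy
        refine ⟨⟨rfl, rfl⟩, h3, ?_, ?_, ?_, ?_, h10⟩
        · intro h
          refine h4 ?_
          have := (hits_append (v := σ.drop M ++ (y ++ v)) (by omega)).2 (Or.inl h)
          rwa [← List.append_assoc, List.take_append_drop] at this
        · intro h
          refine h8 ?_
          have : (u ++ (x ++ σ)).reverse = (σ.drop (M + (a + M))).reverse
              ++ (u ++ (x ++ σ.take (M + (a + M)))).reverse := by
            rw [← List.reverse_append, List.append_assoc, List.append_assoc,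
              List.take_append_drop]
          rw [this]
          exact (hits_append (by omega)).2 (Or.inl h)
        · intro h
          refine h9 ?_
          have := (hits_append (v := v.drop M) (by omega)).2 (Or.inl h)
          rwa [List.take_append_drop] at this
        · rw [List.sum_append, List.sum_append, hl'0, zero_add] at h5
          exact h5
      by_cases hP : (x = l ∧ y = l') ∧ ¬ Hits (Z : Set V) 0 1 u.reverse ∧
          ¬ Hits (Z : Set V) 0 1 (σ.take M) ∧
          ¬ Hits (Z : Set V) 0 1 (σ.drop (M + (a + M))).reverse ∧
          ¬ Hits (Z : Set V) 0 1 (v.take M)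
      · obtain ⟨p1, p2, p3, p4, p5⟩ := hP
        rw [if_pos p1]
        simp only [hG, hA, if_pos p2, if_pos p3, if_pos p4, if_pos p5, one_mul]
        exact wordProb_mono N fun w' _ _ h => (hkey w' h).2.2.2.2.2
      · rw [wordProb_false N]
        · split_ifs
          · exact mul_nonneg (hA0 _) (mul_nonneg (hA0 _) (mul_nonneg (hA0 _)
              (mul_nonneg (hA0 _) (wordProb_nonneg N _ _))))
          · exact le_rfl
        · intro w' _ _ h
          have := hkey w' h
          tauto)
  have hlen : n = m + (l.length + ((M + ((a + M) + M)) + (l'.length + (M + (b + M))))) := by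
    omega
  rw [← hlen] at h
  refine h.trans ?_
  have hGnn : 0 ≤ wordMean N (M + ((a + M) + M)) (fun σ => wordMean N (M + (b + M)) (G σ)) :=
    wordMean_nonneg N fun σ _ => wordMean_nonneg N fun v _ =>
      mul_nonneg (hA0 _) (mul_nonneg (hA0 _) (mul_nonneg (hA0 _) (wordProb_nonneg N _ _)))
  have hq0 := escapeProb_nonneg N (Z : Set V) M
  calc _ ≤ escapeProb N Z M * (((N.card : ℝ)⁻¹) ^ l.length * ((N.card : ℝ)⁻¹) ^ l'.length)
        * (escapeProb N Z M ^ 3 * (2 * (Z.card : ℝ) ^ 2 * η ^ 2)) := by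
        gcongr
    _ = _ := by ring

end PairEstimate

/-! ### Counting good splittings -/

section Count

variable {V : Type*} [AddCommGroup V]

/-- A finite set of nonempty words with letters in `N`, each of which describes a closed path of
length at most `L`, such that no word of the set is a proper prefix or a proper suffix of another
one. -/
structure IsLoopCode (N : Finset V) (𝓛 : Finset (List V)) (L : ℕ) : Prop where
  mem : ∀ l ∈ 𝓛, ∀ e ∈ l, e ∈ N
  ne_nil : ∀ l ∈ 𝓛, l ≠ []
  length_le : ∀ l ∈ 𝓛, l.length ≤ L
  sum_eq_zero : ∀ l ∈ 𝓛, l.sum = 0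
  prefixFree : ∀ l ∈ 𝓛, ∀ l' ∈ 𝓛, l <+: l' → l = l'
  suffixFree : ∀ l ∈ 𝓛, ∀ l' ∈ 𝓛, l <:+ l' → l = l'

theorem IsLoopCode.reverse {N : Finset V} {𝓛 : Finset (List V)} {L : ℕ} (h : IsLoopCode N 𝓛 L) :
    IsLoopCode N (𝓛.image List.reverse) L where
  mem := by
    intro l hl e he
    obtain ⟨l, hl₀, rfl⟩ := Finset.mem_image.1 hl
    exact h.mem l hl₀ e (List.mem_reverse.1 he)
  ne_nil := by
    intro l hl
    obtain ⟨l, hl₀, rfl⟩ := Finset.mem_image.1 hl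
    simpa using h.ne_nil l hl₀
  length_le := by
    intro l hl
    obtain ⟨l, hl₀, rfl⟩ := Finset.mem_image.1 hl
    simpa using h.length_le l hl₀
  sum_eq_zero := by
    intro l hl
    obtain ⟨l, hl₀, rfl⟩ := Finset.mem_image.1 hl
    rw [List.sum_reverse]
    exact h.sum_eq_zero l hl₀
  prefixFree := by
    intro l hl l' hl' hp
    obtain ⟨l, hl₀, rfl⟩ := Finset.mem_image.1 hl
    obtain ⟨l', hl₀', rfl⟩ := Finset.mem_image.1 hl'
    rw [h.suffixFree l hl₀ l' hl₀' (List.reverse_prefix.1 hp)]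
  suffixFree := by
    intro l hl l' hl' hp
    obtain ⟨l, hl₀, rfl⟩ := Finset.mem_image.1 hl
    obtain ⟨l', hl₀', rfl⟩ := Finset.mem_image.1 hl'
    rw [h.prefixFree l hl₀ l' hl₀' (List.reverse_suffix.1 hp)]

/-- The number of good splittings of `w` with middle word in `𝓛`. -/
def goodCount (Z : Set V) (𝓛 : Finset (List V)) (w : List V) : ℝ :=
  ∑ m ∈ Finset.range (w.length + 1), ∑ l ∈ 𝓛, if GoodSplit Z l m w then 1 else 0

/-- The number of good splittings of `w` that are killed by the continuation `w'`. -/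
def killedCount (Z : Set V) (𝓛 : Finset (List V)) (w w' : List V) : ℝ :=
  ∑ m ∈ Finset.range (w.length + 1), ∑ l ∈ 𝓛, if KilledSplit Z l m w w' then 1 else 0

theorem killedCount_nonneg (Z : Set V) (𝓛 : Finset (List V)) (w w' : List V) :
    0 ≤ killedCount Z 𝓛 w w' :=
  Finset.sum_nonneg fun _ _ => Finset.sum_nonneg fun _ _ => by split_ifs <;> norm_num

variable {N : Finset V} {𝓛 : Finset (List V)} {L : ℕ}

/-- Two words of a code occur at given positions with probability at most `π²`, if the positions
are so far apart that the words do not overlap; otherwise one of the two words is still free. -/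
theorem sum_wordProb_occursAt_two_le (hN : N.Nonempty) (h𝓛 : IsLoopCode N 𝓛 L) (n m m' : ℕ) :
    ∑ l ∈ 𝓛, ∑ l' ∈ 𝓛, wordProb N n (fun w => OccursAt l m w ∧ OccursAt l' m' w)
      ≤ (if m' < m + L ∧ m < m' + L then codeWeight N 𝓛 else 0) + codeWeight N 𝓛 ^ 2 := by
  have hpi := codeWeight_nonneg N 𝓛
  have hmul : codeWeight N 𝓛 ^ 2 = ∑ l ∈ 𝓛, ∑ l' ∈ 𝓛,
      ((N.card : ℝ)⁻¹) ^ l.length * ((N.card : ℝ)⁻¹) ^ l'.length := by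
    rw [sq, codeWeight, Finset.sum_mul_sum]
  by_cases hnear : m' < m + L ∧ m < m' + L
  · rw [if_pos hnear]
    have h1 : ∑ l ∈ 𝓛, ∑ l' ∈ 𝓛, wordProb N n (fun w => OccursAt l m w ∧ OccursAt l' m' w)
        ≤ codeWeight N 𝓛 := by
      rw [codeWeight]
      refine Finset.sum_le_sum fun l hl => ?_
      refine le_trans ?_ (wordProb_occursAt_le hN (h𝓛.mem l hl) m n)
      simp only [wordProb]
      rw [← wordMean_sum]
      refine wordMean_mono N fun w _ _ => ?_
      by_cases hocc : OccursAt l m w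
      · simp only [hocc, true_and, if_true]
        exact sum_indicator_le_one h𝓛.prefixFree (m := m') (w := w) _ fun l' _ h => h
      · simp [hocc]
    nlinarith
  · rw [if_neg hnear, zero_add, hmul]
    refine Finset.sum_le_sum fun l hl => Finset.sum_le_sum fun l' hl' => ?_
    have e1 := h𝓛.length_le l hl
    have e2 := h𝓛.length_le l' hl'
    rcases not_and_or.1 hnear with h | h
    · exact wordProb_occursAt_two_le hN (h𝓛.mem l hl) (h𝓛.mem l' hl') (by omega)
    · rw [mul_comm]
      refine le_trans (wordProb_mono N fun w _ _ h => ?_)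
        (wordProb_occursAt_two_le hN (h𝓛.mem l' hl') (h𝓛.mem l hl) (m := m') (m' := m) (n := n)
          (by omega))
      exact ⟨h.2, h.1⟩

theorem sum_range_near_le (n D m : ℕ) {c : ℝ} (hc : 0 ≤ c) :
    ∑ m' ∈ Finset.range (n + 1), (if m' < m + D ∧ m < m' + D then c else 0) ≤ 2 * D * c := by
  rw [Finset.sum_ite, Finset.sum_const_zero, add_zero, Finset.sum_const, nsmul_eq_mul]
  have : ((Finset.range (n + 1)).filter (fun m' => m' < m + D ∧ m < m' + D)).card ≤ 2 * D := by
    refine (Finset.card_le_card (t := Finset.Ico (m + 1 - D) (m + D)) fun x hx => ?_).trans ?_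
    · simp only [Finset.mem_filter, Finset.mem_range, Finset.mem_Ico] at hx ⊢
      omega
    · rw [Nat.card_Ico]; omega
  have : (((Finset.range (n + 1)).filter (fun m' => m' < m + D ∧ m < m' + D)).card : ℝ)
      ≤ 2 * D := by exact_mod_cast this
  gcongr

theorem sum_range_lt_le (n D : ℕ) {c : ℝ} (hc : 0 ≤ c) :
    ∑ m ∈ Finset.range (n + 1), (if m < D then c else 0) ≤ D * c := by
  rw [Finset.sum_ite, Finset.sum_const_zero, add_zero, Finset.sum_const, nsmul_eq_mul]
  have : ((Finset.range (n + 1)).filter (fun m => m < D)).card ≤ D := by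
    refine (Finset.card_le_card (t := Finset.range D) fun x hx => ?_).trans (by simp)
    simp only [Finset.mem_filter, Finset.mem_range] at hx ⊢
    omega
  have : (((Finset.range (n + 1)).filter (fun m => m < D)).card : ℝ) ≤ D := by exact_mod_cast this
  gcongr

theorem sum_range_gt_le (n D : ℕ) {c : ℝ} (hc : 0 ≤ c) :
    ∑ m ∈ Finset.range (n + 1), (if n < m + D then c else 0) ≤ D * c := by
  rw [Finset.sum_ite, Finset.sum_const_zero, add_zero, Finset.sum_const, nsmul_eq_mul]
  have : ((Finset.range (n + 1)).filter (fun m => n < m + D)).card ≤ D := by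
    refine (Finset.card_le_card (t := Finset.Ico (n + 1 - D) (n + 1)) fun x hx => ?_).trans ?_
    · simp only [Finset.mem_filter, Finset.mem_range, Finset.mem_Ico] at hx ⊢
      omega
    · rw [Nat.card_Ico]; omega
  have : (((Finset.range (n + 1)).filter (fun m => n < m + D)).card : ℝ) ≤ D := by
    exact_mod_cast this
  gcongr

/-- Second moment bound for good splittings, by the occurrences of pairs of words of the code. -/
theorem wordMean_goodCount_sq_le (hN : N.Nonempty) (Z : Set V) (h𝓛 : IsLoopCode N 𝓛 L) (n : ℕ) :
    wordMean N n (fun w => goodCount Z 𝓛 w ^ 2)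
      ≤ (n + 1) * (2 * L * codeWeight N 𝓛) + (n + 1) ^ 2 * codeWeight N 𝓛 ^ 2 := by
  have hpi := codeWeight_nonneg N 𝓛
  calc _ ≤ wordMean N n (fun w => ∑ m ∈ Finset.range (n + 1), ∑ m' ∈ Finset.range (n + 1),
        ∑ l ∈ 𝓛, ∑ l' ∈ 𝓛, if OccursAt l m w ∧ OccursAt l' m' w then (1 : ℝ) else 0) := by
        refine wordMean_mono N fun w hw _ => ?_
        rw [goodCount, sq_sum_sum_indicator _ _ (fun l m => GoodSplit Z l m w), hw]
        refine Finset.sum_le_sum fun m _ => Finset.sum_le_sum fun m' _ =>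
          Finset.sum_le_sum fun l _ => Finset.sum_le_sum fun l' _ => ?_
        by_cases h : GoodSplit Z l m w ∧ GoodSplit Z l' m' w
        · rw [if_pos h, if_pos ⟨h.1.occursAt, h.2.occursAt⟩]
        · rw [if_neg h]; split_ifs <;> norm_num
    _ = ∑ m ∈ Finset.range (n + 1), ∑ m' ∈ Finset.range (n + 1),
        ∑ l ∈ 𝓛, ∑ l' ∈ 𝓛, wordProb N n (fun w => OccursAt l m w ∧ OccursAt l' m' w) := by
        simp only [wordMean_sum, wordMean_ite]
    _ ≤ ∑ m ∈ Finset.range (n + 1), ∑ m' ∈ Finset.range (n + 1),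
        ((if m' < m + L ∧ m < m' + L then codeWeight N 𝓛 else 0) + codeWeight N 𝓛 ^ 2) :=
        Finset.sum_le_sum fun m _ => Finset.sum_le_sum fun m' _ =>
          sum_wordProb_occursAt_two_le hN h𝓛 n m m'
    _ ≤ ∑ m ∈ Finset.range (n + 1), (2 * L * codeWeight N 𝓛 + (n + 1) * codeWeight N 𝓛 ^ 2) := by
        refine Finset.sum_le_sum fun m _ => ?_
        rw [Finset.sum_add_distrib, Finset.sum_const, Finset.card_range, nsmul_eq_mul]
        push_cast
        gcongr
        exact sum_range_near_le n L m hpi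
    _ = _ := by
        rw [Finset.sum_const, Finset.card_range, nsmul_eq_mul]
        push_cast
        ring

/-- Second moment of the number of killed splittings: the pairs of splittings that are close to
each other or to an end of the word contribute a small proportion, since `M` is small compared to
`n`, and for the other pairs both have to escape and then to be hit. -/
theorem wordMean_killedCount_sq_le (hN : N.Nonempty) (hneg : ∀ e, -e ∈ N ↔ e ∈ N)
    (Z : Finset V) (h𝓛 : IsLoopCode N 𝓛 L) {M n n' : ℕ} {η : ℝ}
    (hη : ∀ k ≤ n + n', ∀ c z, wordProb N k (Hits {z} c M) ≤ η) :
    wordMean N n (fun w => wordMean N n' (fun w' => killedCount (Z : Set V) 𝓛 w w' ^ 2))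
      ≤ (n + 1) * (2 * L * codeWeight N 𝓛) + (n + 1) * ((12 * M + 4 * L) * codeWeight N 𝓛 ^ 2)
        + (n + 1) ^ 2 * (codeWeight N 𝓛 ^ 2
          * (escapeProb N Z M ^ 4 * (2 * (Z.card : ℝ) ^ 2 * η ^ 2))) := by
  set π := codeWeight N 𝓛 with hπ
  have hpi : 0 ≤ π := codeWeight_nonneg N 𝓛
  set Q := escapeProb N Z M ^ 4 * (2 * (Z.card : ℝ) ^ 2 * η ^ 2) with hQ
  have hQ0 : 0 ≤ Q := by have := escapeProb_nonneg N (Z : Set V) M; positivity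
  set k : ℕ → ℕ → ℝ := fun m m' => ∑ l ∈ 𝓛, ∑ l' ∈ 𝓛, wordMean N n (fun w =>
    wordProb N n' (fun w' => KilledSplit (Z : Set V) l m w w' ∧
      KilledSplit (Z : Set V) l' m' w w')) with hk
  have hmul : π ^ 2 = ∑ l ∈ 𝓛, ∑ l' ∈ 𝓛,
      ((N.card : ℝ)⁻¹) ^ l.length * ((N.card : ℝ)⁻¹) ^ l'.length := by
    rw [sq, hπ, codeWeight, Finset.sum_mul_sum]
  have hsymm : ∀ m m', k m m' = k m' m := by
    intro m m'
    simp only [hk]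
    rw [Finset.sum_comm]
    refine Finset.sum_congr rfl fun l _ => Finset.sum_congr rfl fun l' _ => ?_
    simp only [and_comm]
  -- without any use of the killing, valid for all pairs of positions
  have hocc : ∀ m m', k m m' ≤ (if m' < m + L ∧ m < m' + L then π else 0) + π ^ 2 := by
    intro m m'
    refine le_trans (Finset.sum_le_sum fun l _ => Finset.sum_le_sum fun l' _ => ?_)
      (sum_wordProb_occursAt_two_le hN h𝓛 n m m')
    refine wordMean_mono N fun w _ _ => ?_
    by_cases h : OccursAt l m w ∧ OccursAt l' m' w
    · rw [if_pos h]; exact wordProb_le_one N hN _ _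
    · rw [if_neg h, wordProb_false N]
      exact fun w' _ _ hw => h ⟨hw.1.goodSplit.occursAt, hw.2.goodSplit.occursAt⟩
  -- positions that are far from each other and from both ends of the word
  have hfar : ∀ m m', M ≤ m → m + L + 3 * M ≤ m' → m' + L + 2 * M ≤ n → k m m' ≤ π ^ 2 * Q := by
    intro m m' h1 h2 h3
    rw [hmul, Finset.sum_mul]
    refine Finset.sum_le_sum fun l hl => ?_
    rw [Finset.sum_mul]
    refine Finset.sum_le_sum fun l' hl' => ?_
    have e1 := h𝓛.length_le l hl
    have e2 := h𝓛.length_le l' hl'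
    exact wordMean_killedSplit_two_le hN hneg Z hη (h𝓛.mem l hl) (h𝓛.mem l' hl')
      (h𝓛.sum_eq_zero l' hl') h1 (by omega) (by omega)
  have hbound : ∀ m m', k m m' ≤ (if m' < m + L ∧ m < m' + L then π else 0) + (π ^ 2 * Q
      + ((if m < M then π ^ 2 else 0) + (if m' < M then π ^ 2 else 0)
      + (if m' < m + (L + 3 * M) ∧ m < m' + (L + 3 * M) then π ^ 2 else 0)
      + (if n < m + (L + 2 * M) then π ^ 2 else 0)
      + (if n < m' + (L + 2 * M) then π ^ 2 else 0))) := by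
    intro m m'
    have hp2 : 0 ≤ π ^ 2 := sq_nonneg _
    have hex : ∀ (p : Prop) [Decidable p] (x : ℝ), 0 ≤ x →
        ∃ t, (if p then x else 0) = t ∧ 0 ≤ t ∧ (p → x ≤ t) := fun p _ x hx => by
      by_cases hp : p
      · exact ⟨x, if_pos hp, hx, fun _ => le_rfl⟩
      · exact ⟨0, if_neg hp, le_rfl, fun h => absurd h hp⟩
    have a6 : 0 ≤ π ^ 2 * Q := by positivity
    have hb := hocc m m'
    obtain ⟨t0, e0, p0, -⟩ := hex (m' < m + L ∧ m < m' + L) π hpi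
    obtain ⟨t1, e1, p1, i1⟩ := hex (m < M) _ hp2
    obtain ⟨t2, e2, p2, i2⟩ := hex (m' < M) _ hp2
    obtain ⟨t3, e3, p3, i3⟩ := hex (m' < m + (L + 3 * M) ∧ m < m' + (L + 3 * M)) _ hp2
    obtain ⟨t4, e4, p4, i4⟩ := hex (n < m + (L + 2 * M)) _ hp2
    obtain ⟨t5, e5, p5, i5⟩ := hex (n < m' + (L + 2 * M)) _ hp2
    rw [e0] at hb
    rw [e0, e1, e2, e3, e4, e5]
    by_cases c1 : m < M
    · linarith [i1 c1]
    by_cases c2 : m' < M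
    · linarith [i2 c2]
    by_cases c3 : m' < m + (L + 3 * M) ∧ m < m' + (L + 3 * M)
    · linarith [i3 c3]
    by_cases c4 : n < m + (L + 2 * M)
    · linarith [i4 c4]
    by_cases c5 : n < m' + (L + 2 * M)
    · linarith [i5 c5]
    have hkQ : k m m' ≤ π ^ 2 * Q := by
      rcases not_and_or.1 c3 with h | h
      · exact hfar m m' (by omega) (by omega) (by omega)
      · rw [hsymm]
        exact hfar m' m (by omega) (by omega) (by omega)
    linarith
  calc _ = ∑ m ∈ Finset.range (n + 1), ∑ m' ∈ Finset.range (n + 1), k m m' := by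
        have : wordMean N n (fun w => wordMean N n' (fun w' =>
              killedCount (Z : Set V) 𝓛 w w' ^ 2))
            = wordMean N n (fun w => ∑ m ∈ Finset.range (n + 1), ∑ m' ∈ Finset.range (n + 1),
              ∑ l ∈ 𝓛, ∑ l' ∈ 𝓛, wordProb N n' (fun w' => KilledSplit (Z : Set V) l m w w' ∧
                KilledSplit (Z : Set V) l' m' w w')) := by
          refine wordMean_congr N fun w hw _ => ?_
          have hsq : ∀ w', killedCount (Z : Set V) 𝓛 w w' ^ 2 = ∑ m ∈ Finset.range (n + 1),
              ∑ m' ∈ Finset.range (n + 1), ∑ l ∈ 𝓛, ∑ l' ∈ 𝓛,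
                if KilledSplit (Z : Set V) l m w w' ∧ KilledSplit (Z : Set V) l' m' w w'
                  then (1 : ℝ) else 0 := by
            intro w'
            rw [killedCount, sq_sum_sum_indicator _ _ (fun l m => KilledSplit (Z : Set V) l m w w'),
              hw]
          simp only [hsq, wordMean_sum, wordMean_ite]
        rw [this]
        simp only [wordMean_sum, hk]
    _ ≤ ∑ m ∈ Finset.range (n + 1), ∑ m' ∈ Finset.range (n + 1), _ :=
        Finset.sum_le_sum fun m _ => Finset.sum_le_sum fun m' _ => hbound m m'
    _ ≤ ∑ m ∈ Finset.range (n + 1), (2 * L * π + ((n + 1) * (π ^ 2 * Q)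
          + ((n + 1) * (if m < M then π ^ 2 else 0) + M * π ^ 2
          + 2 * ((L + 3 * M : ℕ) : ℝ) * π ^ 2
          + (n + 1) * (if n < m + (L + 2 * M) then π ^ 2 else 0)
          + ((L + 2 * M : ℕ) : ℝ) * π ^ 2))) := by
        refine Finset.sum_le_sum fun m _ => ?_
        simp only [Finset.sum_add_distrib, Finset.sum_const, Finset.card_range, nsmul_eq_mul]
        have b1 := sum_range_near_le n L m hpi
        have b2 := sum_range_lt_le n M (sq_nonneg π)
        have b3 := sum_range_near_le n (L + 3 * M) m (sq_nonneg π)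
        have b4 := sum_range_gt_le n (L + 2 * M) (sq_nonneg π)
        push_cast at b3 b4 ⊢
        gcongr
    _ ≤ _ := by
        simp only [Finset.sum_add_distrib, Finset.sum_const, Finset.card_range, nsmul_eq_mul,
          ← Finset.mul_sum]
        have b2 := sum_range_lt_le n M (sq_nonneg π)
        have b4 := sum_range_gt_le n (L + 2 * M) (sq_nonneg π)
        have b2' := mul_le_mul_of_nonneg_left b2 (show (0 : ℝ) ≤ n + 1 by positivity)
        have b4' := mul_le_mul_of_nonneg_left b4 (show (0 : ℝ) ≤ n + 1 by positivity)
        push_cast at b2' b4' ⊢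
        nlinarith

/-- The past, the middle word and the future of a splitting are independent, so that each position
contributes the weight of the code times the square of the escape probability to the mean. -/
theorem le_wordMean_goodCount (hN : N.Nonempty) (Z : Set V) (h𝓛 : IsLoopCode N 𝓛 L) (n : ℕ)
    (hL : L ≤ n) :
    ((n : ℝ) - L) * (codeWeight N 𝓛 * escapeProb N Z n ^ 2)
      ≤ wordMean N n (goodCount Z 𝓛) := by
  have hq := escapeProb_nonneg N Z n
  have hpi := codeWeight_nonneg N 𝓛
  have h1 : wordMean N n (goodCount Z 𝓛) = ∑ m ∈ Finset.range (n + 1), ∑ l ∈ 𝓛,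
      wordProb N n (GoodSplit Z l m) := by
    have : wordMean N n (goodCount Z 𝓛) = wordMean N n (fun w =>
        ∑ m ∈ Finset.range (n + 1), ∑ l ∈ 𝓛, if GoodSplit Z l m w then 1 else 0) :=
      wordMean_congr N fun w hw _ => by rw [goodCount, hw]
    rw [this]
    simp only [wordMean_sum, wordMean_ite]
  have h2 : ∀ m ∈ Finset.range (n - L), codeWeight N 𝓛 * escapeProb N Z n ^ 2
      ≤ ∑ l ∈ 𝓛, wordProb N n (GoodSplit Z l m) := by
    intro m hm
    rw [Finset.mem_range] at hm
    rw [codeWeight, Finset.sum_mul]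
    refine Finset.sum_le_sum fun l hl => ?_
    have e1 := h𝓛.length_le l hl
    obtain ⟨t, ht⟩ : ∃ t, n = m + (l.length + t) := ⟨n - (m + l.length), by omega⟩
    have h3 := wordMean_one_word (h𝓛.mem l hl) m t
      (fun u => if ¬ Hits Z 0 1 u.reverse then 1 else 0) (fun v => if ¬ Hits Z 0 1 v then 1 else 0)
      (fun w => if GoodSplit Z l m w then 1 else 0) (by
        intro u x v hu hx hv
        have : GoodSplit Z l m (u ++ (x ++ v)) ↔
            x = l ∧ ¬ Hits Z 0 1 u.reverse ∧ ¬ Hits Z 0 1 v := by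
          constructor
          · rintro ⟨u', v', h1, h2, h3, h4⟩
            obtain ⟨rfl, rfl, rfl⟩ := eq_of_append_word h1 (hu.trans h2.symm) hx
            exact ⟨rfl, h3, h4⟩
          · rintro ⟨rfl, h3, h4⟩
            exact ⟨u, v, rfl, hu, h3, h4⟩
        rw [if_congr this rfl rfl]
        by_cases b1 : x = l <;> by_cases b2 : Hits Z 0 1 u.reverse <;>
          by_cases b3 : Hits Z 0 1 v <;> simp [b1, b2, b3])
    rw [wordMean_ite, wordMean_ite, wordMean_ite, ← ht,
      wordProb_reverse N m (fun u => ¬ Hits Z 0 1 u)] at h3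
    have h4 : wordProb N n (GoodSplit Z l m) = escapeProb N Z m * ((N.card : ℝ)⁻¹) ^ l.length
      * escapeProb N Z t := h3
    rw [h4]
    have hq' := escapeProb_nonneg N Z m
    have h5 : escapeProb N Z n ≤ escapeProb N Z m := escapeProb_antitone hN Z (by omega)
    have h6 : escapeProb N Z n ≤ escapeProb N Z t := escapeProb_antitone hN Z (by omega)
    calc _ = escapeProb N Z n * ((N.card : ℝ)⁻¹) ^ l.length * escapeProb N Z n := by ring
      _ ≤ _ := by gcongr
  rw [h1]
  calc _ = ∑ m ∈ Finset.range (n - L), codeWeight N 𝓛 * escapeProb N Z n ^ 2 := by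
        rw [Finset.sum_const, Finset.card_range, nsmul_eq_mul, Nat.cast_sub hL]
    _ ≤ ∑ m ∈ Finset.range (n - L), ∑ l ∈ 𝓛, wordProb N n (GoodSplit Z l m) :=
        Finset.sum_le_sum h2
    _ ≤ _ := by
        refine Finset.sum_le_sum_of_subset_of_nonneg ?_ fun m _ _ =>
          Finset.sum_nonneg fun l _ => wordProb_nonneg N _ _
        intro m hm
        rw [Finset.mem_range] at hm ⊢
        omega

end Count

/-! ### Concentration of the number of good splittings -/

section Concentration

variable {V : Type*} [AddCommGroup V]

theorem GoodSplit.add_length_le {Z : Set V} {l : List V} {m : ℕ} {w : List V}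
    (h : GoodSplit Z l m w) : m + l.length ≤ w.length :=
  h.occursAt.add_length_le

/-- The mirror image of `KilledSplit`: a good splitting of `w` that ceases to be good when `w` is
preceded by `w'`. -/
def KilledByPast (Z : Set V) (l : List V) (m : ℕ) (w w' : List V) : Prop :=
  m + l.length ≤ w.length ∧
    KilledSplit Z l.reverse (w.length - m - l.length) w.reverse w'.reverse

/-- A good splitting of `w ++ w'` has its middle word in `w`, in `w'`, or across the junction. -/
theorem goodSplit_append_cases {Z : Set V} {l : List V} {m : ℕ} {w w' : List V}
    (h : GoodSplit Z l m (w ++ w')) :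
    GoodSplit Z l m w ∨ (w.length ≤ m ∧ GoodSplit Z l (m - w.length) w') ∨
      (m < w.length ∧ w.length < m + l.length) := by
  obtain ⟨u, v, h1, h2, h3, h4⟩ := h
  rcases le_or_gt (m + l.length) w.length with hm | hm
  · left
    rw [← List.append_assoc] at h1
    obtain ⟨e, he, rfl⟩ := exists_of_append_eq_append h1.symm (by simp; omega)
    exact ⟨u, e, by rw [he, List.append_assoc], h2, h3,
      fun h => h4 ((hits_append (by omega)).2 (Or.inl h))⟩
  · rcases le_or_gt w.length m with hwm | hwm
    · right; left
      refine ⟨hwm, ?_⟩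
      obtain ⟨e, rfl, he⟩ := exists_of_append_eq_append h1 (by omega)
      refine ⟨e, v, he, by simp at h2; omega, fun h => h3 ?_, h4⟩
      rw [List.reverse_append]
      exact (hits_append (by omega)).2 (Or.inl h)
    · right; right
      exact ⟨hwm, hm⟩

theorem GoodSplit.append_right {Z : Set V} {l : List V} {m : ℕ} {w : List V} (w' : List V)
    (h : GoodSplit Z l m w) : GoodSplit Z l m (w ++ w') ∨ KilledSplit Z l m w w' := by
  obtain ⟨u, v, rfl, h2, h3, h4⟩ := h
  by_cases hh : Hits Z v.sum 1 w'
  · exact Or.inr ⟨u, v, rfl, h2, h3, h4, hh⟩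
  · left
    refine ⟨u, v ++ w', by simp, h2, h3, fun h => ?_⟩
    rcases (hits_append (by omega)).1 h with h | h
    · exact h4 h
    · rw [zero_add] at h
      exact hh h

theorem GoodSplit.append_left {Z : Set V} {l : List V} {m : ℕ} {w : List V} (w' : List V)
    (h : GoodSplit Z l m w) :
    GoodSplit Z l (w'.length + m) (w' ++ w) ∨ KilledByPast Z l m w w' := by
  obtain ⟨u, v, rfl, h2, h3, h4⟩ := h
  by_cases hh : Hits Z u.reverse.sum 1 w'.reverse
  · right
    refine ⟨by simp; omega, v.reverse, u.reverse, by simp, by simp; omega, ?_, h3, hh⟩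
    rwa [List.reverse_reverse]
  · left
    refine ⟨w' ++ u, v, by simp, by simp; omega, fun h => ?_, h4⟩
    rw [List.reverse_append] at h
    rcases (hits_append (by omega)).1 h with h | h
    · exact h3 h
    · rw [zero_add] at h
      exact hh h

theorem sum_killedByPast_le (Z : Set V) (𝓛 : Finset (List V)) (w w' : List V) :
    ∑ m ∈ Finset.range (w.length + 1), ∑ l ∈ 𝓛, (if KilledByPast Z l m w w' then (1 : ℝ) else 0)
      ≤ killedCount Z (𝓛.image List.reverse) w.reverse w'.reverse := by
  rw [killedCount, Finset.sum_comm, Finset.sum_comm (s := Finset.range (w.reverse.length + 1)),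
    Finset.sum_image fun _ _ _ _ h => List.reverse_injective h]
  refine Finset.sum_le_sum fun l _ => ?_
  simp only [Finset.sum_ite, Finset.sum_const_zero, add_zero, Finset.sum_const, nsmul_eq_mul,
    mul_one]
  have := Finset.card_le_card_of_injOn
    (s := (Finset.range (w.length + 1)).filter fun m => KilledByPast Z l m w w')
    (t := (Finset.range (w.reverse.length + 1)).filter fun m =>
      KilledSplit Z l.reverse m w.reverse w'.reverse)
    (fun m => w.length - m - l.length) (by
      intro m hm
      simp only [Finset.coe_filter, Finset.mem_range, Set.mem_ofPred_eq, List.length_reverse]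
        at hm ⊢
      exact ⟨by omega, hm.2.2⟩) (by
      intro m hm m' hm' h
      simp only [Finset.coe_filter, Finset.mem_range, Set.mem_ofPred_eq] at hm hm' h
      have := hm.2.1
      have := hm'.2.1
      omega)
  exact_mod_cast this

variable {N : Finset V} {𝓛 : Finset (List V)} {L : ℕ}

/-- At most one word of the code starts at each of the last `L` positions before the junction. -/
theorem sum_straddle_le (h𝓛 : IsLoopCode N 𝓛 L) (Z : Set V) (n : ℕ) (w : List V) :
    ∑ m ∈ Finset.range (w.length + 1), ∑ l ∈ 𝓛,
      (if (m < n ∧ n < m + l.length) ∧ GoodSplit Z l m w then (1 : ℝ) else 0) ≤ L := by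
  have h1 : ∀ m ∈ Finset.range (w.length + 1), ∑ l ∈ 𝓛,
      (if (m < n ∧ n < m + l.length) ∧ GoodSplit Z l m w then (1 : ℝ) else 0)
      ≤ if m ∈ Finset.Ico (n - L) n then 1 else 0 := by
    intro m _
    by_cases hm : m ∈ Finset.Ico (n - L) n
    · rw [if_pos hm]
      exact sum_indicator_le_one h𝓛.prefixFree (m := m) (w := w)
        (fun l => (m < n ∧ n < m + l.length) ∧ GoodSplit Z l m w) fun l _ h => h.2.occursAt
    · rw [if_neg hm]
      refine (Finset.sum_eq_zero fun l hl => if_neg ?_).le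
      rintro ⟨⟨h1, h2⟩, -⟩
      have := h𝓛.length_le l hl
      rw [Finset.mem_Ico] at hm
      omega
  refine (Finset.sum_le_sum h1).trans ?_
  rw [Finset.sum_ite, Finset.sum_const_zero, add_zero, Finset.sum_const, nsmul_eq_mul, mul_one]
  have : ((Finset.range (w.length + 1)).filter (fun m => m ∈ Finset.Ico (n - L) n)).card ≤ L := by
    refine (Finset.card_le_card (t := Finset.Ico (n - L) n) fun x hx =>
      (Finset.mem_filter.1 hx).2).trans ?_
    rw [Nat.card_Ico]; omega
  exact_mod_cast this

/-- Sums of indicators over the positions in a word do not change when more positions are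
admitted. -/
theorem sum_range_extend {f : ℕ → ℝ} {n k : ℕ} (hnk : n ≤ k) (hf : ∀ m, n < m → f m = 0) :
    ∑ m ∈ Finset.range (k + 1), f m = ∑ m ∈ Finset.range (n + 1), f m := by
  symm
  refine Finset.sum_subset (Finset.range_subset_range.2 (by omega)) fun m _ hm => hf m ?_
  rw [Finset.mem_range] at hm
  omega

theorem sum_range_shift (f : ℕ → ℝ) (n k : ℕ) :
    ∑ m ∈ Finset.range (n + k + 1), (if n ≤ m then f (m - n) else 0)
      = ∑ m ∈ Finset.range (k + 1), f m := by
  rw [add_assoc, Finset.sum_range_add, Finset.sum_eq_zero, zero_add]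
  · exact Finset.sum_congr rfl fun m _ => by simp
  · intro m hm
    rw [Finset.mem_range] at hm
    rw [if_neg (by omega)]

/-- The number of good splittings is additive up to the killed splittings and to the words of the
code that overlap the junction. -/
theorem abs_goodCount_append_sub_le (h𝓛 : IsLoopCode N 𝓛 L) (Z : Set V) (w w' : List V) :
    |goodCount Z 𝓛 (w ++ w') - (goodCount Z 𝓛 w + goodCount Z 𝓛 w')|
      ≤ L + (killedCount Z 𝓛 w w' + killedCount Z (𝓛.image List.reverse) w'.reverse w.reverse) := by
  set n := w.length with hn
  set k := w'.length with hk
  have hlen : (w ++ w').length = n + k := by simp [hn, hk]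
  have hgw : goodCount Z 𝓛 w
      = ∑ m ∈ Finset.range (n + k + 1), ∑ l ∈ 𝓛, if GoodSplit Z l m w then (1 : ℝ) else 0 := by
    rw [goodCount, sum_range_extend (n := n) (k := n + k) (by omega)]
    intro m hm
    refine Finset.sum_eq_zero fun l _ => if_neg fun h => ?_
    have := h.add_length_le
    omega
  have hgw' : goodCount Z 𝓛 w' = ∑ m ∈ Finset.range (n + k + 1),
      if n ≤ m then ∑ l ∈ 𝓛, (if GoodSplit Z l (m - n) w' then (1 : ℝ) else 0) else 0 := by
    rw [goodCount, sum_range_shift (fun m => ∑ l ∈ 𝓛, if GoodSplit Z l m w' then (1 : ℝ) else 0)]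
  have hkw : killedCount Z 𝓛 w w'
      = ∑ m ∈ Finset.range (n + k + 1), ∑ l ∈ 𝓛, if KilledSplit Z l m w w' then (1 : ℝ) else 0 := by
    rw [killedCount, sum_range_extend (n := n) (k := n + k) (by omega)]
    intro m hm
    refine Finset.sum_eq_zero fun l _ => if_neg fun h => ?_
    have := h.goodSplit.add_length_le
    omega
  have hkw' : ∑ m ∈ Finset.range (n + k + 1),
      (if n ≤ m then ∑ l ∈ 𝓛, (if KilledByPast Z l (m - n) w' w then (1 : ℝ) else 0) else 0)
      ≤ killedCount Z (𝓛.image List.reverse) w'.reverse w.reverse := by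
    rw [sum_range_shift (fun m => ∑ l ∈ 𝓛, if KilledByPast Z l m w' w then (1 : ℝ) else 0)]
    exact sum_killedByPast_le Z 𝓛 w' w
  have hst := sum_straddle_le h𝓛 Z n (w ++ w')
  rw [hlen] at hst
  have hk0 := killedCount_nonneg Z 𝓛 w w'
  have hk0' := killedCount_nonneg Z (𝓛.image List.reverse) w'.reverse w.reverse
  have hite : ∀ (p : Prop) [Decidable p], (0 : ℝ) ≤ if p then 1 else 0 := fun p _ => by
    split_ifs <;> norm_num
  rw [abs_sub_le_iff]
  constructor
  · have h1 : goodCount Z 𝓛 (w ++ w') ≤ goodCount Z 𝓛 w + goodCount Z 𝓛 w'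
        + ∑ m ∈ Finset.range (n + k + 1), ∑ l ∈ 𝓛,
          (if (m < n ∧ n < m + l.length) ∧ GoodSplit Z l m (w ++ w') then (1 : ℝ) else 0) := by
      rw [hgw, hgw', goodCount, hlen, ← Finset.sum_add_distrib, ← Finset.sum_add_distrib]
      refine Finset.sum_le_sum fun m _ => ?_
      by_cases hnm : n ≤ m
      · rw [if_pos hnm, ← Finset.sum_add_distrib, ← Finset.sum_add_distrib]
        refine Finset.sum_le_sum fun l _ => ?_
        have a1 := hite (GoodSplit Z l m w)
        have a2 := hite (GoodSplit Z l (m - n) w')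
        have a3 := hite ((m < n ∧ n < m + l.length) ∧ GoodSplit Z l m (w ++ w'))
        by_cases hg : GoodSplit Z l m (w ++ w')
        · rw [if_pos hg]
          rcases goodSplit_append_cases hg with h | ⟨-, h⟩ | h
          · rw [if_pos h]; linarith
          · rw [if_pos h]; linarith
          · rw [if_pos (show (m < n ∧ n < m + l.length) ∧ GoodSplit Z l m (w ++ w') from ⟨h, hg⟩)]
            linarith
        · rw [if_neg hg]; linarith
      · rw [if_neg hnm, add_zero, ← Finset.sum_add_distrib]
        refine Finset.sum_le_sum fun l _ => ?_
        have a1 := hite (GoodSplit Z l m w)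
        have a3 := hite ((m < n ∧ n < m + l.length) ∧ GoodSplit Z l m (w ++ w'))
        by_cases hg : GoodSplit Z l m (w ++ w')
        · rw [if_pos hg]
          rcases goodSplit_append_cases hg with h | ⟨h, -⟩ | h
          · rw [if_pos h]; linarith
          · exact absurd h hnm
          · rw [if_pos (show (m < n ∧ n < m + l.length) ∧ GoodSplit Z l m (w ++ w') from ⟨h, hg⟩)]
            linarith
        · rw [if_neg hg]; linarith
    linarith
  · have h1 : goodCount Z 𝓛 w + goodCount Z 𝓛 w' ≤ goodCount Z 𝓛 (w ++ w')
        + (killedCount Z 𝓛 w w' + ∑ m ∈ Finset.range (n + k + 1),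
      (if n ≤ m then ∑ l ∈ 𝓛, (if KilledByPast Z l (m - n) w' w then (1 : ℝ) else 0) else 0)) := by
      rw [hgw, hgw', hkw, goodCount, hlen, ← Finset.sum_add_distrib, ← Finset.sum_add_distrib,
        ← Finset.sum_add_distrib]
      refine Finset.sum_le_sum fun m _ => ?_
      by_cases hnm : n ≤ m
      · rw [if_pos hnm, if_pos hnm, ← Finset.sum_add_distrib, ← Finset.sum_add_distrib,
          ← Finset.sum_add_distrib]
        refine Finset.sum_le_sum fun l hl => ?_
        have a1 := hite (GoodSplit Z l m (w ++ w'))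
        have a2 := hite (KilledSplit Z l m w w')
        have a3 := hite (KilledByPast Z l (m - n) w' w)
        have hno : ¬ GoodSplit Z l m w := fun h => by
          have := h.add_length_le
          have := List.length_pos_iff.2 (h𝓛.ne_nil l hl)
          omega
        rw [if_neg hno]
        by_cases hg : GoodSplit Z l (m - n) w'
        · rw [if_pos hg]
          rcases hg.append_left w with h | h
          · rw [Nat.add_sub_cancel' hnm] at h
            rw [if_pos h]; linarith
          · rw [if_pos h]; linarith
        · rw [if_neg hg]; linarith
      · rw [if_neg hnm, if_neg hnm, add_zero, add_zero, ← Finset.sum_add_distrib]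
        refine Finset.sum_le_sum fun l hl => ?_
        have a1 := hite (GoodSplit Z l m (w ++ w'))
        have a2 := hite (KilledSplit Z l m w w')
        by_cases hg : GoodSplit Z l m w
        · rw [if_pos hg]
          rcases hg.append_right w' with h | h
          · rw [if_pos h]; linarith
          · rw [if_pos h]; linarith
        · rw [if_neg hg]; linarith
    have : (0 : ℝ) ≤ L := by positivity
    linarith

/-- The variance of the number of good splittings of a random word of length `n`. -/
def goodVar (N : Finset V) (Z : Set V) (𝓛 : Finset (List V)) (n : ℕ) : ℝ :=
  wordMean N n (fun w => (goodCount Z 𝓛 w - wordMean N n (goodCount Z 𝓛)) ^ 2)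

/-- The mean minimizes the quadratic deviation. -/
theorem goodVar_le_sq_sub (hN : N.Nonempty) (Z : Set V) (n : ℕ) (a : ℝ) :
    goodVar N Z 𝓛 n ≤ wordMean N n (fun w => (goodCount Z 𝓛 w - a) ^ 2) := by
  have h : wordMean N n (fun w => (goodCount Z 𝓛 w - a) ^ 2)
      = goodVar N Z 𝓛 n + (wordMean N n (goodCount Z 𝓛) - a) ^ 2 := by
    set μ := wordMean N n (goodCount Z 𝓛) with hμ
    have e1 : ∀ w : List V, (goodCount Z 𝓛 w - a) ^ 2
        = (goodCount Z 𝓛 w - μ) ^ 2 + (2 * (μ - a) * (goodCount Z 𝓛 w - μ) + (μ - a) ^ 2) :=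
      fun w => by ring
    simp only [e1]
    rw [wordMean_add, wordMean_add, wordMean_const_mul, wordMean_sub, wordMean_const N hN,
      wordMean_const N hN, goodVar, ← hμ]
    ring
  rw [h]
  linarith [sq_nonneg (wordMean N n (goodCount Z 𝓛) - a)]

/-- The recursion for the variance when the length is doubled. The two halves being independent,
the standard deviation would be multiplied by `√2` if the count were additive, while its mean is
multiplied by `2`; the deviation from additivity is controlled by the killed splittings. -/
theorem goodVar_double_le (hN : N.Nonempty) (h𝓛 : IsLoopCode N 𝓛 L) (Z : Set V) (n : ℕ)
    {B : ℝ}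
    (hB : wordMean N n (fun w => wordMean N n (fun w' => killedCount Z 𝓛 w w' ^ 2)) ≤ B)
    (hB' : wordMean N n (fun w => wordMean N n (fun w' =>
      killedCount Z (𝓛.image List.reverse) w w' ^ 2)) ≤ B) :
    goodVar N Z 𝓛 (n + n) ≤ 3 * goodVar N Z 𝓛 n + (9 * L ^ 2 + 18 * B) := by
  set μ := wordMean N n (goodCount Z 𝓛) with hμ
  set I : List V → List V → ℝ := fun w w' => killedCount Z 𝓛 w w' with hI
  set J : List V → List V → ℝ := fun w w' =>
    killedCount Z (𝓛.image List.reverse) w'.reverse w.reverse with hJ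
  have hJB : wordMean N n (fun w => wordMean N n (fun w' => J w w' ^ 2)) ≤ B := by
    have e1 : wordMean N n (fun w => wordMean N n (fun w' => J w w' ^ 2))
        = wordMean N n (fun w => wordMean N n (fun w' =>
          killedCount Z (𝓛.image List.reverse) w w' ^ 2)) := by
      rw [wordMean_comm]
      simp only [hJ]
      rw [← wordMean_reverse]
      simp only [List.reverse_reverse]
      refine wordMean_congr N fun w _ _ => ?_
      exact wordMean_reverse N n (fun w' => killedCount Z (𝓛.image List.reverse) w w' ^ 2)
    rw [e1]
    exact hB'
  have hpt : ∀ w w' : List V, (goodCount Z 𝓛 (w ++ w') - 2 * μ) ^ 2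
      ≤ (3 / 2) * (goodCount Z 𝓛 w - μ) ^ 2 + ((3 / 2) * (goodCount Z 𝓛 w' - μ) ^ 2
        + (3 * ((goodCount Z 𝓛 w - μ) * (goodCount Z 𝓛 w' - μ))
        + (9 * (L : ℝ) ^ 2 + (9 * I w w' ^ 2 + 9 * J w w' ^ 2)))) := by
    intro w w'
    have h1 := abs_goodCount_append_sub_le h𝓛 Z w w'
    set R := goodCount Z 𝓛 (w ++ w') - (goodCount Z 𝓛 w + goodCount Z 𝓛 w') with hR
    have h2 : R ^ 2 ≤ (L + (I w w' + J w w')) ^ 2 := by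
      rw [← sq_abs R]
      gcongr
    have h3 : goodCount Z 𝓛 (w ++ w') - 2 * μ
        = (goodCount Z 𝓛 w - μ) + (goodCount Z 𝓛 w' - μ) + R := by rw [hR]; ring
    rw [h3]
    nlinarith [sq_nonneg ((goodCount Z 𝓛 w - μ) + (goodCount Z 𝓛 w' - μ) - 2 * R),
      sq_nonneg ((L : ℝ) - I w w'), sq_nonneg ((L : ℝ) - J w w'), sq_nonneg (I w w' - J w w')]
  refine (goodVar_le_sq_sub hN Z (n + n) (2 * μ)).trans ?_
  rw [wordMean_append]
  refine (wordMean_mono N fun w _ _ => wordMean_mono N fun w' _ _ => hpt w w').trans ?_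
  simp only [wordMean_add, wordMean_const_mul, wordMean_const N hN, wordMean_mul_const,
    wordMean_sub]
  simp only [goodVar, ← hμ]
  nlinarith [hB, hJB]

end Concentration

/-! ### The variance along dyadic scales -/

section Scales

variable {V : Type*} [AddCommGroup V] {N : Finset V} {𝓛 : Finset (List V)} {L : ℕ}

/-- The second moment bound for killed splittings at the dyadic scale `2 ^ i`, the two windows
having length `2 ^ (i - c)`. -/
theorem wordMean_killedCount_sq_dyadic_le (hN : N.Nonempty) (hneg : ∀ e, -e ∈ N ↔ e ∈ N)
    (Z : Finset V) (h𝓛 : IsLoopCode N 𝓛 L) {i c : ℕ} (hci : c ≤ i) (hLM : L ≤ 2 ^ (i - c))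
    {q η : ℝ} (hq : escapeProb N Z (2 ^ (i - c)) ≤ q)
    (hη : ∀ k ≤ 2 ^ i + 2 ^ i, ∀ x z, wordProb N k (Hits {z} x (2 ^ (i - c))) ≤ η) :
    wordMean N (2 ^ i) (fun w => wordMean N (2 ^ i) (fun w' =>
        killedCount (Z : Set V) 𝓛 w w' ^ 2))
      ≤ 4 ^ i * (4 * (L / 2 ^ i) * codeWeight N 𝓛 + 32 * (1 / 2 ^ c) * codeWeight N 𝓛 ^ 2
        + 8 * (Z.card : ℝ) ^ 2 * q ^ 4 * η ^ 2 * codeWeight N 𝓛 ^ 2) := by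
  refine (wordMean_killedCount_sq_le hN hneg Z h𝓛 hη).trans ?_
  set π := codeWeight N 𝓛
  have hpi : 0 ≤ π := codeWeight_nonneg N 𝓛
  have hq0 := escapeProb_nonneg N (Z : Set V) (2 ^ (i - c))
  have hq4 : escapeProb N Z (2 ^ (i - c)) ^ 4 ≤ q ^ 4 := by gcongr
  have hpow : (2 : ℝ) ^ (i - c) * 2 ^ c = 2 ^ i := by rw [← pow_add]; congr 1; omega
  have h4 : (4 : ℝ) ^ i = 2 ^ i * 2 ^ i := by rw [← mul_pow]; norm_num
  have hn1 : (1 : ℝ) ≤ 2 ^ i := one_le_pow₀ (by norm_num)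
  have hn2 : (0 : ℝ) < 2 ^ i := by positivity
  have hL' : (L : ℝ) ≤ 2 ^ (i - c) := by exact_mod_cast hLM
  push_cast
  have e1 : ((2 : ℝ) ^ i + 1) * (2 * L * π) ≤ 4 ^ i * (4 * (L / 2 ^ i) * π) := by
    have : (4 : ℝ) ^ i * (4 * (L / 2 ^ i) * π) = (2 ^ i + 2 ^ i) * (2 * L * π) := by
      rw [h4]; field_simp; ring
    rw [this]
    gcongr
  have e2 : ((2 : ℝ) ^ i + 1) * ((12 * 2 ^ (i - c) + 4 * L) * π ^ 2)
      ≤ 4 ^ i * (32 * (1 / 2 ^ c) * π ^ 2) := by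
    have : (4 : ℝ) ^ i * (32 * (1 / 2 ^ c) * π ^ 2)
        = (2 ^ i + 2 ^ i) * ((12 * 2 ^ (i - c) + 4 * 2 ^ (i - c)) * π ^ 2) := by
      rw [h4]
      nth_rewrite 2 [← hpow]
      field_simp
      ring
    rw [this]
    gcongr
  have e3 : ((2 : ℝ) ^ i + 1) ^ 2 * (π ^ 2 * (escapeProb N Z (2 ^ (i - c)) ^ 4
        * (2 * (Z.card : ℝ) ^ 2 * η ^ 2)))
      ≤ 4 ^ i * (8 * (Z.card : ℝ) ^ 2 * q ^ 4 * η ^ 2 * π ^ 2) := by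
    have : (4 : ℝ) ^ i * (8 * (Z.card : ℝ) ^ 2 * q ^ 4 * η ^ 2 * π ^ 2)
        = (2 ^ i + 2 ^ i) ^ 2 * (π ^ 2 * (q ^ 4 * (2 * (Z.card : ℝ) ^ 2 * η ^ 2))) := by
      rw [h4]; ring
    rw [this]
    gcongr
  linarith

/-- Iterating the variance recursion from the scale `2 ^ i₀` up to the scale `2 ^ (i₀ + k)`. -/
theorem goodVar_dyadic_le (hN : N.Nonempty) (h𝓛 : IsLoopCode N 𝓛 L) (Z : Set V) {i₀ k : ℕ}
    {W : ℝ} (hW : 0 ≤ W)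
    (hB : ∀ i, i₀ ≤ i → i < i₀ + k → wordMean N (2 ^ i) (fun w => wordMean N (2 ^ i) (fun w' =>
      killedCount Z 𝓛 w w' ^ 2)) ≤ 4 ^ i * W)
    (hB' : ∀ i, i₀ ≤ i → i < i₀ + k → wordMean N (2 ^ i) (fun w => wordMean N (2 ^ i) (fun w' =>
      killedCount Z (𝓛.image List.reverse) w w' ^ 2)) ≤ 4 ^ i * W) :
    goodVar N Z 𝓛 (2 ^ (i₀ + k)) ≤ 4 ^ (i₀ + k) * ((3 / 4) ^ k * (goodVar N Z 𝓛 (2 ^ i₀) / 4 ^ i₀)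
      + (9 * (L / 2 ^ i₀) ^ 2 + 18 * W)) := by
  induction k with
  | zero =>
    have h4 : (0 : ℝ) < 4 ^ i₀ := by positivity
    rw [add_zero, pow_zero, one_mul, mul_add, mul_div_cancel₀ _ h4.ne']
    have : 0 ≤ (4 : ℝ) ^ i₀ * (9 * (L / 2 ^ i₀) ^ 2 + 18 * W) := by positivity
    linarith
  | succ k ih =>
    have ih' := ih (fun i h1 h2 => hB i h1 (by omega)) (fun i h1 h2 => hB' i h1 (by omega))
    have h1 := goodVar_double_le hN h𝓛 Z (2 ^ (i₀ + k)) (hB (i₀ + k) (by omega) (by omega))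
      (hB' (i₀ + k) (by omega) (by omega))
    have h2 : 2 ^ (i₀ + (k + 1)) = 2 ^ (i₀ + k) + 2 ^ (i₀ + k) := by ring
    rw [h2]
    refine h1.trans ?_
    have hL : (L : ℝ) ^ 2 ≤ 4 ^ (i₀ + k) * (L / 2 ^ i₀) ^ 2 := by
      have e : (4 : ℝ) ^ (i₀ + k) * (L / 2 ^ i₀) ^ 2 = 4 ^ k * (L : ℝ) ^ 2 := by
        have : (4 : ℝ) ^ i₀ = (2 ^ i₀) ^ 2 := by rw [← pow_mul, mul_comm, pow_mul]; norm_num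
        rw [pow_add, this]
        field_simp
      rw [e]
      have : (1 : ℝ) ≤ 4 ^ k := one_le_pow₀ (by norm_num)
      nlinarith [sq_nonneg (L : ℝ)]
    have e4 : (4 : ℝ) ^ (i₀ + (k + 1)) = 4 * 4 ^ (i₀ + k) := by ring
    have e34 : ((3 : ℝ) / 4) ^ (k + 1) = 3 / 4 * (3 / 4) ^ k := by ring
    rw [e4, e34]
    set P := (4 : ℝ) ^ (i₀ + k)
    set y := ((3 : ℝ) / 4) ^ k * (goodVar N Z 𝓛 (2 ^ i₀) / 4 ^ i₀) with hy
    have e5 : 4 * P * (3 / 4 * (3 / 4) ^ k * (goodVar N Z 𝓛 (2 ^ i₀) / 4 ^ i₀)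
        + (9 * (L / 2 ^ i₀) ^ 2 + 18 * W))
        = 3 * (P * (y + (9 * (L / 2 ^ i₀) ^ 2 + 18 * W)))
          + (9 * (P * (L / 2 ^ i₀) ^ 2) + 18 * (P * W)) := by
      rw [hy]; ring
    rw [e5]
    linarith

/-- The trivial bound for the variance, which starts the recursion. -/
theorem goodVar_le_goodCount_sq (hN : N.Nonempty) (h𝓛 : IsLoopCode N 𝓛 L) (Z : Set V) (i : ℕ) :
    goodVar N Z 𝓛 (2 ^ i) / 4 ^ i ≤ 4 * (L / 2 ^ i) * codeWeight N 𝓛 + 4 * codeWeight N 𝓛 ^ 2 := by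
  have hpi := codeWeight_nonneg N 𝓛
  have h1 := goodVar_le_sq_sub (𝓛 := 𝓛) hN Z (2 ^ i) 0
  simp only [sub_zero] at h1
  have h2 := h1.trans (wordMean_goodCount_sq_le hN Z h𝓛 (2 ^ i))
  push_cast at h2
  have h4 : (4 : ℝ) ^ i = 2 ^ i * 2 ^ i := by rw [← mul_pow]; norm_num
  have hn1 : (1 : ℝ) ≤ 2 ^ i := one_le_pow₀ (by norm_num)
  rw [div_le_iff₀ (by positivity)]
  refine h2.trans ?_
  have : (4 * (L / 2 ^ i) * codeWeight N 𝓛 + 4 * codeWeight N 𝓛 ^ 2) * (4 : ℝ) ^ i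
      = (2 ^ i + 2 ^ i) * (2 * L * codeWeight N 𝓛) + (2 ^ i + 2 ^ i) ^ 2 * codeWeight N 𝓛 ^ 2 := by
    rw [h4]; field_simp; ring
  rw [this]
  gcongr

/-- Chebyshev's inequality for good splittings of the first half of a word that are not killed by
the second half. -/
theorem wordProb_goodCount_sub_killedCount_lt_le (hN : N.Nonempty) (Z : Set V)
    {n : ℕ} {T v B : ℝ} (hT : 0 < T) (hmean : 4 * T ≤ wordMean N n (goodCount Z 𝓛))
    (hv : goodVar N Z 𝓛 n ≤ v)
    (hB : wordMean N n (fun w => wordMean N n (fun w' => killedCount Z 𝓛 w w' ^ 2)) ≤ B) :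
    wordProb N (n + n) (fun w =>
        goodCount Z 𝓛 (w.take n) - killedCount Z 𝓛 (w.take n) (w.drop n) < T)
      ≤ (v + B) / T ^ 2 := by
  set μ := wordMean N n (goodCount Z 𝓛) with hμ
  have h1 := wordProb_le_of_mean N (n + n) (fun w =>
      goodCount Z 𝓛 (w.take n) - killedCount Z 𝓛 (w.take n) (w.drop n) < T)
    (fun w => (goodCount Z 𝓛 (w.take n) - μ) ^ 2 + killedCount Z 𝓛 (w.take n) (w.drop n) ^ 2)
    (t := T ^ 2) (by positivity) (fun w _ => by positivity) (by
      intro w _ hw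
      -- either the number of good splittings or the number of killed ones is far from its target
      by_cases hI : T ≤ killedCount Z 𝓛 (w.take n) (w.drop n)
      · nlinarith [sq_nonneg (goodCount Z 𝓛 (w.take n) - μ)]
      · push Not at hI
        nlinarith [sq_nonneg (killedCount Z 𝓛 (w.take n) (w.drop n))])
  refine h1.trans ?_
  gcongr
  rw [wordMean_append]
  have h2 : wordMean N n (fun u => wordMean N n (fun v =>
      (goodCount Z 𝓛 ((u ++ v).take n) - μ) ^ 2
        + killedCount Z 𝓛 ((u ++ v).take n) ((u ++ v).drop n) ^ 2))
      = wordMean N n (fun u => wordMean N n (fun v =>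
        (goodCount Z 𝓛 u - μ) ^ 2 + killedCount Z 𝓛 u v ^ 2)) := by
    refine wordMean_congr N fun u hu _ => wordMean_congr N fun v _ _ => ?_
    rw [← hu, List.take_left, List.drop_left]
  rw [h2]
  simp only [wordMean_add, wordMean_const N hN]
  exact add_le_add hv hB

end Scales

/-! ### Choice of the scales -/

section Asymptotics

/-- Exponential decay in `g` beats every power of `j`, if `g` is at least of order `j ^ (1/4)`. -/
theorem exists_pow_mul_pow_le (P Q : ℕ) {r ε : ℝ} (hr0 : 0 < r) (hr1 : r < 1) (hε : 0 < ε) :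
    ∃ j₀ : ℕ, ∀ j ≥ j₀, ∀ g : ℕ, j + 1 ≤ Q * (g + 1) ^ 4 → ((j : ℝ) + 1) ^ P * r ^ g ≤ ε := by
  have h1 := tendsto_pow_const_mul_const_pow_of_abs_lt_one (4 * P) (r := r)
    (by rwa [abs_of_pos hr0])
  have hQ : (0 : ℝ) < (Q : ℝ) ^ P + 1 := by positivity
  have h2 := (h1.comp (tendsto_add_atTop_nat 1)).eventually
    (gt_mem_nhds (show 0 < ε * r / ((Q : ℝ) ^ P + 1) by positivity))
  obtain ⟨g₀, hg₀⟩ := eventually_atTop.1 h2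
  refine ⟨Q * (g₀ + 1) ^ 4, fun j hj g hjg => ?_⟩
  have hg : g₀ ≤ g := by
    by_contra hcon
    push Not at hcon
    have : (g + 1) ^ 4 ≤ (g₀ + 1) ^ 4 := Nat.pow_le_pow_left (by omega) 4
    have := Nat.mul_le_mul_left Q this
    omega
  have h3 := hg₀ g hg
  simp only [Function.comp_apply] at h3
  have h4 : ((j : ℝ) + 1) ≤ Q * ((g : ℝ) + 1) ^ 4 := by exact_mod_cast hjg
  have h5 : ((j : ℝ) + 1) ^ P ≤ (Q : ℝ) ^ P * ((g : ℝ) + 1) ^ (4 * P) := by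
    rw [pow_mul, ← mul_pow]
    gcongr
  rw [lt_div_iff₀ hQ] at h3
  push_cast at h3
  rw [pow_succ] at h3
  have h6 : 0 < ((g : ℝ) + 1) ^ (4 * P) * r ^ g := by positivity
  have h7 : ((g : ℝ) + 1) ^ (4 * P) * r ^ g * ((Q : ℝ) ^ P + 1) < ε := by
    have : ((g : ℝ) + 1) ^ (4 * P) * (r ^ g * r) * ((Q : ℝ) ^ P + 1)
        = (((g : ℝ) + 1) ^ (4 * P) * r ^ g * ((Q : ℝ) ^ P + 1)) * r := by ring
    rw [this] at h3
    exact lt_of_mul_lt_mul_right h3 hr0.le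
  calc ((j : ℝ) + 1) ^ P * r ^ g ≤ (Q : ℝ) ^ P * ((g : ℝ) + 1) ^ (4 * P) * r ^ g := by gcongr
    _ ≤ ε := by nlinarith

/-- The logarithmic size of the windows at the scale `2 ^ j`: about `j ^ (1/4)`. -/
def windowExp (j : ℕ) : ℕ := Nat.sqrt (Nat.sqrt j)

theorem windowExp_pow_le (j : ℕ) : windowExp j ^ 4 ≤ j := by
  have h1 := Nat.sqrt_le' (Nat.sqrt j)
  have h2 := Nat.sqrt_le' j
  calc windowExp j ^ 4 = (windowExp j ^ 2) ^ 2 := by ring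
    _ ≤ (Nat.sqrt j) ^ 2 := Nat.pow_le_pow_left h1 2
    _ ≤ j := h2

theorem lt_windowExp_pow (j : ℕ) : j + 1 ≤ (windowExp j + 1) ^ 4 := by
  have h1 := Nat.lt_succ_sqrt' (Nat.sqrt j)
  have h2 := Nat.lt_succ_sqrt' j
  calc j + 1 ≤ (Nat.sqrt j + 1) ^ 2 := h2
    _ ≤ ((windowExp j + 1) ^ 2) ^ 2 := Nat.pow_le_pow_left h1 2
    _ = _ := by ring

/-- The bound for the relative variance at the scale `2 ^ j`, of order `j ^ (-3/2)`. -/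
def varScale (j : ℕ) : ℝ := ((windowExp j : ℝ) + 1) ^ 2 / (j : ℝ) ^ 2

theorem varScale_nonneg (j : ℕ) : 0 ≤ varScale j := by unfold varScale; positivity

theorem summable_varScale : Summable varScale := by
  have hs : Summable (fun j : ℕ => 4 * ((1 : ℝ) / (j : ℝ) ^ (3 / 2 : ℝ))) :=
    (Real.summable_one_div_nat_rpow.2 (by norm_num)).mul_left 4
  refine Summable.of_nonneg_of_le varScale_nonneg (fun j => ?_) hs
  rcases Nat.eq_zero_or_pos j with rfl | hj
  · simp [varScale]
  · have hj' : (0 : ℝ) < j := by exact_mod_cast hj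
    have h1 : ((windowExp j : ℝ)) ^ 2 ≤ √j := by
      apply Real.le_sqrt_of_sq_le
      rw [← pow_mul]
      exact_mod_cast windowExp_pow_le j
    have h2 : (1 : ℝ) ≤ √j := by
      rw [Real.one_le_sqrt]
      exact_mod_cast hj
    have h3 : ((windowExp j : ℝ) + 1) ^ 2 ≤ 4 * √j := by
      nlinarith [sq_nonneg ((windowExp j : ℝ) - 1)]
    have h4 : (j : ℝ) ^ 2 = √j * (j : ℝ) ^ (3 / 2 : ℝ) := by
      rw [Real.sqrt_eq_rpow, ← Real.rpow_add hj', ← Real.rpow_natCast]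
      norm_num
    unfold varScale
    rw [h4, mul_one_div, div_le_div_iff₀ (by positivity) (by positivity)]
    calc _ ≤ 4 * √j * (j : ℝ) ^ (3 / 2 : ℝ) := by gcongr
      _ = _ := by ring

theorem le_varScale (j : ℕ) (hj : 1 ≤ j) : 1 / ((j : ℝ) + 1) ^ 2 ≤ varScale j := by
  have hj' : (0 : ℝ) < j := by exact_mod_cast hj
  unfold varScale
  have h1 : (1 : ℝ) ≤ ((windowExp j : ℝ) + 1) ^ 2 := by
    have : (0 : ℝ) ≤ windowExp j := by positivity
    nlinarith
  gcongr
  linarith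

end Asymptotics

/-! ### Concentration at a dyadic scale -/

section ConcentrationAtScale

variable {V : Type*} [AddCommGroup V]

/-- The errors in the variance recursion, run over the scales between `j - j / Q` and `j`, are small
compared with `a ^ 4 * varScale j`, where `a` is bounded below by a negative power of `j`. -/
theorem exists_scale_bounds {c₀ c₁ ρ : ℝ} (hc₀ : 0 < c₀) (hc₁pos : 0 < c₁) (hρ : 1 / 2 < ρ)
    (K A : ℕ) : ∃ Q j₀ : ℕ, 4 ≤ Q ∧ 16 ≤ j₀ ∧ ∀ j ≥ j₀, ∀ (π a : ℝ) (L : ℕ), c₀ * ρ ^ j ≤ π →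
      0 < a → c₁ ≤ a * ((j : ℝ) + 1) ^ A → L ≤ K * (j + 1) →
      (L : ℝ) / 2 ^ (j - j / Q) ≤ π * (a ^ 4 * varScale j) ∧
      (1 : ℝ) / 2 ^ windowExp j ≤ a ^ 4 * varScale j ∧
      ((3 : ℝ) / 4) ^ (j / Q) ≤ a ^ 4 * varScale j ∧ L ≤ 2 ^ (j / Q) := by
  obtain ⟨Q₀, hQ₀⟩ := pow_unbounded_of_one_lt 4 (show (1 : ℝ) < 2 * ρ by linarith)
  obtain ⟨Q, hQ⟩ : ∃ Q, Q = Q₀ + 4 := ⟨_, rfl⟩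
  -- hence `2 ^ j * ρ ^ j ≥ 4 ^ (j / Q)`, which absorbs the loss `2 ^ (j / Q)` at the lowest scale
  have hQ4 : (4 : ℝ) ≤ (2 * ρ) ^ Q :=
    hQ₀.le.trans (pow_le_pow_right₀ (by linarith) (by omega))
  obtain ⟨j₁, hj₁⟩ := exists_pow_mul_pow_le (4 * A + 3) Q (r := 1 / 2)
    (ε := c₀ * c₁ ^ 4 / (K + 1)) (by norm_num) (by norm_num) (by positivity)
  obtain ⟨j₂, hj₂⟩ := exists_pow_mul_pow_le (4 * A + 2) 1 (r := 1 / 2)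
    (ε := c₁ ^ 4) (by norm_num) (by norm_num) (by positivity)
  obtain ⟨j₃, hj₃⟩ := exists_pow_mul_pow_le (4 * A + 2) Q (r := 3 / 4)
    (ε := c₁ ^ 4) (by norm_num) (by norm_num) (by positivity)
  obtain ⟨j₄, hj₄⟩ := exists_pow_mul_pow_le 1 Q (r := 1 / 2)
    (ε := 1 / (K + 1)) (by norm_num) (by norm_num) (by positivity)
  refine ⟨Q, 16 + j₁ + j₂ + j₃ + j₄, by omega, by omega, fun j hj π a L hπlow ha halow hL => ?_⟩
  obtain ⟨g, hg⟩ : ∃ g, g = j / Q := ⟨_, rfl⟩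
  obtain ⟨s, hs⟩ : ∃ s, s = varScale j := ⟨_, rfl⟩
  have hslow : 1 / ((j : ℝ) + 1) ^ 2 ≤ s := hs ▸ le_varScale j (by omega)
  have hgQ : g * Q ≤ j := hg ▸ Nat.div_mul_le_self j Q
  have hjg : j < (g + 1) * Q := by
    have := Nat.lt_div_mul_add (a := j) (b := Q) (by omega)
    rw [Nat.add_mul, one_mul, hg]
    exact this
  have hg4 : 4 * g ≤ j := by
    have : g * 4 ≤ g * Q := Nat.mul_le_mul_left g (by omega)
    omega
  have hjQ4 : j + 1 ≤ Q * (g + 1) ^ 4 := by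
    have h1 : (g + 1) ^ 1 ≤ (g + 1) ^ 4 := Nat.pow_le_pow_right (by omega) (by omega)
    have h2 := Nat.mul_le_mul_left Q h1
    rw [pow_one] at h2
    have h3 : (g + 1) * Q = Q * (g + 1) := mul_comm _ _
    omega
  rw [← hg, ← hs]
  have hρpos : 0 < ρ := by linarith
  have hπpos : 0 < π := lt_of_lt_of_le (by positivity) hπlow
  have has : c₁ ^ 4 / ((j : ℝ) + 1) ^ (4 * A + 2) ≤ a ^ 4 * s := by
    have e1 : c₁ ^ 4 ≤ a ^ 4 * ((j : ℝ) + 1) ^ (4 * A) := by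
      have : a ^ 4 * ((j : ℝ) + 1) ^ (4 * A) = (a * ((j : ℝ) + 1) ^ A) ^ 4 := by
        rw [mul_pow, ← pow_mul, mul_comm A 4]
      rw [this]
      gcongr
    rw [div_le_iff₀ (by positivity), pow_add]
    rw [div_le_iff₀ (by positivity)] at hslow
    calc c₁ ^ 4 ≤ a ^ 4 * ((j : ℝ) + 1) ^ (4 * A) * 1 := by rw [mul_one]; exact e1
      _ ≤ a ^ 4 * ((j : ℝ) + 1) ^ (4 * A) * (s * ((j : ℝ) + 1) ^ 2) := by gcongr
      _ = _ := by ring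
  have hLj : (L : ℝ) ≤ K * ((j : ℝ) + 1) := by exact_mod_cast hL
  have h2g : (2 : ℝ) ^ (j - g) * 2 ^ g = 2 ^ j := by rw [← pow_add]; congr 1; omega
  have hhalf : ∀ n : ℕ, ((1 : ℝ) / 2) ^ n = 1 / 2 ^ n := fun n => by rw [div_pow, one_pow]
  refine ⟨?_, ?_, ?_, ?_⟩
  · have h1 := hj₁ j (by omega) g hjQ4
    have h4g : (4 : ℝ) ^ g ≤ (2 * ρ) ^ j := by
      calc (4 : ℝ) ^ g ≤ ((2 * ρ) ^ Q) ^ g := by gcongr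
        _ = (2 * ρ) ^ (g * Q) := by rw [← pow_mul, mul_comm Q g]
        _ ≤ (2 * ρ) ^ j := pow_le_pow_right₀ (by linarith) hgQ
    have h44 : (4 : ℝ) ^ g = 2 ^ g * 2 ^ g := by rw [← mul_pow]; norm_num
    have h2j : (L : ℝ) / 2 ^ (j - g) = L * 2 ^ g / 2 ^ j := by rw [← h2g]; field_simp
    have h3 : c₀ * ρ ^ j * (c₁ ^ 4 / ((j : ℝ) + 1) ^ (4 * A + 2)) ≤ π * (a ^ 4 * s) := by
      gcongr
    refine le_trans ?_ h3
    rw [h2j, div_le_iff₀ (by positivity)]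
    rw [hhalf, mul_one_div, div_le_div_iff₀ (by positivity) (by positivity)] at h1
    have h5 : c₀ * ρ ^ j * (c₁ ^ 4 / ((j : ℝ) + 1) ^ (4 * A + 2)) * 2 ^ j
        = (c₀ * c₁ ^ 4) * (2 * ρ) ^ j / ((j : ℝ) + 1) ^ (4 * A + 2) := by
      rw [mul_pow 2 ρ j]; ring
    rw [h5, le_div_iff₀ (by positivity)]
    calc (L : ℝ) * 2 ^ g * ((j : ℝ) + 1) ^ (4 * A + 2)
        ≤ (K + 1) * ((j : ℝ) + 1) * 2 ^ g * ((j : ℝ) + 1) ^ (4 * A + 2) := by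
          gcongr
          nlinarith
      _ = ((j : ℝ) + 1) ^ (4 * A + 3) * (K + 1) * 2 ^ g := by ring
      _ ≤ c₀ * c₁ ^ 4 * 2 ^ g * 2 ^ g := by gcongr
      _ = c₀ * c₁ ^ 4 * 4 ^ g := by rw [h44]; ring
      _ ≤ _ := by gcongr
  · refine le_trans ?_ has
    have h1 := hj₂ j (by omega) (windowExp j) (by rw [one_mul]; exact lt_windowExp_pow j)
    rw [hhalf] at h1
    rw [le_div_iff₀ (by positivity)]
    linarith
  · refine le_trans ?_ has
    have h1 := hj₃ j (by omega) g hjQ4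
    rw [le_div_iff₀ (by positivity)]
    linarith
  · have h1 := hj₄ j (by omega) g hjQ4
    rw [hhalf, pow_one, mul_one_div, div_le_div_iff₀ (by positivity) (by positivity), one_mul] at h1
    have : (L : ℝ) ≤ 2 ^ g := by nlinarith
    exact_mod_cast this

/-- The number of good splittings in the first half of a word of length `2 ^ (j + 1)` that are not
killed by the second half is at least of the order of its mean, except with probability at most
a multiple of `varScale j`. The codes may depend on `j`, as long as their weight is larger than
`2 ^ (-j)` by an exponential factor. -/
theorem exists_wordProb_le_varScale {N : Finset V} (hN : N.Nonempty) (hneg : ∀ e, -e ∈ N ↔ e ∈ N)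
    (Z : Finset V) {C : ℝ} (hC : 0 < C)
    (hhit : ∀ (i r n : ℕ) (c z : V), 1 ≤ i → n ≤ 2 ^ (i + r) →
      wordProb N n (Hits {z} c (2 ^ i)) ≤ C * (r + 1) / i)
    {A i₁ : ℕ} (hmono : ∀ i ≥ i₁, escapeProb N Z (2 ^ i) * ((i : ℝ) + 1) ^ A
      ≤ escapeProb N Z (2 ^ (i + 1)) * ((i : ℝ) + 2) ^ A)
    (hpos : ∀ i, 0 < escapeProb N Z (2 ^ i))
    {𝓛 : ℕ → Finset (List V)} {L : ℕ → ℕ} (h𝓛 : ∀ j, IsLoopCode N (𝓛 j) (L j))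
    {K : ℕ} (hL : ∀ j, L j ≤ K * (j + 1)) {c₀ ρ : ℝ} (hc₀ : 0 < c₀) (hρ : 1 / 2 < ρ)
    (hweight : ∀ j, c₀ * ρ ^ j ≤ codeWeight N (𝓛 j)) :
    ∃ (K' : ℝ) (j₀ : ℕ), ∀ j ≥ j₀, wordProb N (2 ^ j + 2 ^ j) (fun w =>
        goodCount Z (𝓛 j) (w.take (2 ^ j))
          - killedCount Z (𝓛 j) (w.take (2 ^ j)) (w.drop (2 ^ j))
        < 2 ^ j * codeWeight N (𝓛 j) * escapeProb N Z (2 ^ j) ^ 2 / 8) ≤ K' * varScale j := by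
  obtain ⟨a, ha⟩ : ∃ a : ℕ → ℝ, ∀ i, a i = escapeProb N Z (2 ^ i) := ⟨_, fun _ => rfl⟩
  simp only [← ha] at hmono hpos ⊢
  have hmono' : ∀ i j, i₁ ≤ i → i ≤ j → a i * ((i : ℝ) + 1) ^ A ≤ a j * ((j : ℝ) + 1) ^ A := by
    intro i j hi hij
    induction j, hij using Nat.le_induction with
    | base => exact le_rfl
    | succ j hj ih =>
      refine ih.trans ((hmono j (by omega)).trans (le_of_eq ?_))
      push_cast
      ring
  obtain ⟨c₁, hc₁⟩ : ∃ c₁ : ℝ, c₁ = a i₁ * ((i₁ : ℝ) + 1) ^ A := ⟨_, rfl⟩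
  have hc₁pos : 0 < c₁ := hc₁ ▸ mul_pos (hpos i₁) (by positivity)
  obtain ⟨Q, j₁, hQ4, hj₁16, hsmall⟩ := exists_scale_bounds hc₀ hc₁pos hρ K A
  obtain ⟨K₁, hK₁⟩ : ∃ K₁ : ℝ, K₁ = 36 + 128 * (Z.card : ℝ) ^ 2 * 16 ^ A * C ^ 2 := ⟨_, rfl⟩
  refine ⟨64 * (17 + 19 * K₁), 2 * i₁ + j₁, fun j hj => ?_⟩
  obtain ⟨g, hg⟩ : ∃ g, g = j / Q := ⟨_, rfl⟩
  obtain ⟨c, hc⟩ : ∃ c, c = windowExp j := ⟨_, rfl⟩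
  have hgQ : g * Q ≤ j := hg ▸ Nat.div_mul_le_self j Q
  have hg4 : 4 * g ≤ j := by
    have : g * 4 ≤ g * Q := Nat.mul_le_mul_left g (by omega)
    omega
  have hc4 : 4 * c ≤ j := by
    have h1 := windowExp_pow_le j
    rw [← hc] at h1
    rcases Nat.lt_or_ge c 2 with h2 | h2
    · omega
    · have h3 : 2 ^ 3 ≤ c ^ 3 := Nat.pow_le_pow_left h2 3
      have h4 : c ^ 4 = c ^ 3 * c := by ring
      nlinarith
  have hc1 : 1 ≤ c := by
    by_contra hcon
    have h1 := lt_windowExp_pow j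
    have : windowExp j = 0 := by omega
    rw [this] at h1
    simp at h1
    omega
  have hj16 : 16 ≤ j := by omega
  have hjpos : (0 : ℝ) < j := by exact_mod_cast (by omega : 0 < j)
  obtain ⟨π, hπ⟩ : ∃ π, π = codeWeight N (𝓛 j) := ⟨_, rfl⟩
  obtain ⟨s, hs⟩ : ∃ s, s = varScale j := ⟨_, rfl⟩
  rw [← hπ, ← hs]
  have hs0 : 0 ≤ s := hs ▸ varScale_nonneg j
  have hπlow : c₀ * ρ ^ j ≤ π := hπ ▸ hweight j
  have hρpos : 0 < ρ := by linarith
  have hπpos : 0 < π := lt_of_lt_of_le (by positivity) hπlow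
  have haj : 0 < a j := hpos j
  have haj1 : a j ≤ 1 := ha j ▸ escapeProb_le_one hN _ _
  have halow : c₁ ≤ a j * ((j : ℝ) + 1) ^ A := hc₁ ▸ hmono' i₁ j le_rfl (by omega)
  have hs1 : s ≤ 1 := by
    rw [hs, varScale, div_le_one (by positivity)]
    have : ((windowExp j : ℝ) + 1) ≤ j := by
      have : windowExp j + 1 ≤ j := by omega
      exact_mod_cast this
    gcongr
  -- the small quantities
  obtain ⟨hS1, hS2, hS3, hS4⟩ := hsmall j (by omega) π (a j) (L j) hπlow haj halow (hL j)
  rw [← hg, ← hs] at hS1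
  rw [← hc, ← hs] at hS2
  rw [← hg, ← hs] at hS3
  rw [← hg] at hS4
  obtain ⟨x, hx⟩ : ∃ x : ℝ, x = (L j : ℝ) / 2 ^ (j - g) := ⟨_, rfl⟩
  rw [← hx] at hS1
  have hx0 : 0 ≤ x := by rw [hx]; positivity
  obtain ⟨E, hE⟩ : ∃ E : ℝ, E = π ^ 2 * (a j ^ 4 * s) := ⟨_, rfl⟩
  have has0 : 0 ≤ a j ^ 4 * s := by positivity
  have has1 : a j ^ 4 * s ≤ 1 := by
    have : a j ^ 4 ≤ 1 := pow_le_one₀ haj.le haj1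
    nlinarith [pow_pos haj 4]
  have hE0 : 0 ≤ E := by rw [hE]; positivity
  have hxπ : x * π ≤ E := by
    calc x * π ≤ π * (a j ^ 4 * s) * π := by gcongr
      _ = E := by rw [hE]; ring
  have hxx : x ^ 2 ≤ E := by
    calc x ^ 2 ≤ (π * (a j ^ 4 * s)) ^ 2 := by gcongr
      _ = π ^ 2 * (a j ^ 4 * s) * (a j ^ 4 * s) := by ring
      _ ≤ π ^ 2 * (a j ^ 4 * s) * 1 := by gcongr
      _ = E := by rw [hE, mul_one]
  -- the killed splittings at the scales between `j - g` and `j`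
  -- up to constants `q` and `η` bound the probability to escape until time `2 ^ (i - c)` and the
  -- probability to hit a point between the times `2 ^ (i - c)` and `2 ^ (i + 1)`
  obtain ⟨q, hq⟩ : ∃ q : ℝ, q = a j * 2 ^ A := ⟨_, rfl⟩
  obtain ⟨η, hη⟩ : ∃ η : ℝ, η = C * ((c : ℝ) + 2) * 2 / j := ⟨_, rfl⟩
  have hkill : ∀ 𝓒 : Finset (List V), IsLoopCode N 𝓒 (L j) → codeWeight N 𝓒 = π →
      ∀ i, j - g ≤ i → i ≤ j →
      wordMean N (2 ^ i) (fun w => wordMean N (2 ^ i) (fun w' =>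
        killedCount (Z : Set V) 𝓒 w w' ^ 2)) ≤ 4 ^ i * (K₁ * E) := by
    intro 𝓒 h𝓒 hw i hi1 hi2
    have hic : j ≤ 2 * (i - c) := by omega
    have hq' : escapeProb N Z (2 ^ (i - c)) ≤ q := by
      have h1 := hmono' (i - c) j (by omega) (by omega)
      have h2 : ((j : ℝ) + 1) ≤ 2 * (((i - c : ℕ) : ℝ) + 1) := by
        have : j + 1 ≤ 2 * ((i - c) + 1) := by omega
        exact_mod_cast this
      have h3 : a j * ((j : ℝ) + 1) ^ A ≤ a j * (2 * (((i - c : ℕ) : ℝ) + 1)) ^ A := by gcongr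
      rw [mul_pow, ← mul_assoc] at h3
      rw [← ha, hq]
      exact le_of_mul_le_mul_right (h1.trans h3) (by positivity)
    have hη' : ∀ k ≤ 2 ^ i + 2 ^ i, ∀ y z, wordProb N k (Hits {z} y (2 ^ (i - c))) ≤ η := by
      intro k hk y z
      have hk' : k ≤ 2 ^ ((i - c) + (c + 1)) := by
        have : (i - c) + (c + 1) = i + 1 := by omega
        rw [this, pow_succ]
        omega
      refine (hhit (i - c) (c + 1) k y z (by omega) hk').trans ?_
      have h1 : (j : ℝ) ≤ 2 * ((i - c : ℕ) : ℝ) := by exact_mod_cast hic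
      rw [hη, div_le_div_iff₀ (by linarith) hjpos]
      push_cast
      calc C * ((c : ℝ) + 1 + 1) * j ≤ C * ((c : ℝ) + 1 + 1) * (2 * ((i - c : ℕ) : ℝ)) := by gcongr
        _ = _ := by ring
    have hLM : L j ≤ 2 ^ (i - c) := hS4.trans (Nat.pow_le_pow_right (by norm_num) (by omega))
    refine (wordMean_killedCount_sq_dyadic_le hN hneg Z h𝓒 (by omega) hLM hq' hη').trans ?_
    rw [hw]
    have hxi : (L j : ℝ) / 2 ^ i ≤ x := by
      rw [hx]
      gcongr
      · norm_num
    have t1 : 4 * ((L j : ℝ) / 2 ^ i) * π ≤ 4 * E := by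
      have : (L j : ℝ) / 2 ^ i * π ≤ x * π := by gcongr
      linarith
    have t2 : 32 * (1 / 2 ^ c) * π ^ 2 ≤ 32 * E := by
      calc 32 * (1 / 2 ^ c) * π ^ 2 ≤ 32 * (a j ^ 4 * s) * π ^ 2 := by gcongr
        _ = 32 * E := by rw [hE]; ring
    have t3 : 8 * (Z.card : ℝ) ^ 2 * q ^ 4 * η ^ 2 * π ^ 2
        ≤ 128 * (Z.card : ℝ) ^ 2 * 16 ^ A * C ^ 2 * E := by
      have e1 : η ^ 2 ≤ 16 * C ^ 2 * s := by
        have : η ^ 2 = 4 * C ^ 2 * (((c : ℝ) + 2) ^ 2 / (j : ℝ) ^ 2) := by rw [hη]; ring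
        rw [this, hs, varScale]
        have h2 : ((c : ℝ) + 2) ^ 2 / (j : ℝ) ^ 2 ≤ (2 * ((c : ℝ) + 1)) ^ 2 / (j : ℝ) ^ 2 := by
          gcongr
          have : (0 : ℝ) ≤ c := by positivity
          linarith
        calc 4 * C ^ 2 * (((c : ℝ) + 2) ^ 2 / (j : ℝ) ^ 2)
            ≤ 4 * C ^ 2 * ((2 * ((c : ℝ) + 1)) ^ 2 / (j : ℝ) ^ 2) := by gcongr
          _ = _ := by rw [hc]; ring
      have e2 : q ^ 4 = a j ^ 4 * 16 ^ A := by
        rw [hq, mul_pow, ← pow_mul, mul_comm A 4, pow_mul]; norm_num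
      calc 8 * (Z.card : ℝ) ^ 2 * q ^ 4 * η ^ 2 * π ^ 2
          ≤ 8 * (Z.card : ℝ) ^ 2 * q ^ 4 * (16 * C ^ 2 * s) * π ^ 2 := by gcongr
        _ = _ := by rw [e2, hE]; ring
    gcongr
    calc _ ≤ 4 * E + 32 * E + 128 * (Z.card : ℝ) ^ 2 * 16 ^ A * C ^ 2 * E :=
          add_le_add (add_le_add t1 t2) t3
      _ = K₁ * E := by rw [hK₁]; ring
  have hK₁0 : 0 ≤ K₁ := by rw [hK₁]; positivity
  -- the variance at the scale `j`
  have hvar : goodVar N Z (𝓛 j) (2 ^ j) ≤ 4 ^ j * ((17 + 18 * K₁) * E) := by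
    have h1 := goodVar_dyadic_le hN (h𝓛 j) (Z : Set V) (i₀ := j - g) (k := g) (W := K₁ * E)
      (by positivity) (fun i h1 h2 => hkill (𝓛 j) (h𝓛 j) hπ.symm i h1 (by omega))
      (fun i h1 h2 => hkill _ (h𝓛 j).reverse ((codeWeight_reverse N _).trans hπ.symm) i h1
        (by omega))
    rw [show j - g + g = j by omega, ← hx] at h1
    refine h1.trans ?_
    have h2 := goodVar_le_goodCount_sq hN (h𝓛 j) (Z : Set V) (j - g)
    rw [← hx, ← hπ] at h2
    gcongr
    have h3 : ((3 : ℝ) / 4) ^ g * (goodVar N Z (𝓛 j) (2 ^ (j - g)) / 4 ^ (j - g)) ≤ 8 * E := by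
      calc _ ≤ ((3 : ℝ) / 4) ^ g * (4 * x * π + 4 * π ^ 2) := by gcongr
        _ = 4 * (((3 : ℝ) / 4) ^ g * (x * π)) + 4 * (((3 : ℝ) / 4) ^ g * π ^ 2) := by ring
        _ ≤ 4 * (1 * E) + 4 * ((a j ^ 4 * s) * π ^ 2) := by
            have : ((3 : ℝ) / 4) ^ g ≤ 1 := pow_le_one₀ (by norm_num) (by norm_num)
            gcongr
        _ = 8 * E := by rw [hE]; ring
    linarith
  have hB := hkill (𝓛 j) (h𝓛 j) hπ.symm j (by omega) le_rfl
  obtain ⟨T, hT⟩ : ∃ T : ℝ, T = 2 ^ j * π * a j ^ 2 / 8 := ⟨_, rfl⟩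
  rw [← hT]
  have hTpos : 0 < T := by rw [hT]; positivity
  have hLhalf : (L j : ℝ) ≤ 2 ^ j / 2 := by
    have h1 : L j * 2 ≤ 2 ^ j := by
      calc L j * 2 ≤ 2 ^ g * 2 := by omega
        _ = 2 ^ (g + 1) := by ring
        _ ≤ 2 ^ j := Nat.pow_le_pow_right (by norm_num) (by omega)
    have : (L j : ℝ) * 2 ≤ 2 ^ j := by exact_mod_cast h1
    linarith
  have hmean : 4 * T ≤ wordMean N (2 ^ j) (goodCount Z (𝓛 j)) := by
    have h1 := le_wordMean_goodCount hN (Z : Set V) (h𝓛 j) (2 ^ j)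
      (hS4.trans (Nat.pow_le_pow_right (by norm_num) (by omega)))
    refine le_trans ?_ h1
    push_cast
    rw [← hπ, ← ha]
    calc 4 * T = (2 ^ j - 2 ^ j / 2) * (π * a j ^ 2) := by rw [hT]; ring
      _ ≤ _ := by gcongr
  refine (wordProb_goodCount_sub_killedCount_lt_le hN (Z : Set V) hTpos hmean hvar hB).trans
    (le_of_eq ?_)
  have h4 : (4 : ℝ) ^ j = 2 ^ j * 2 ^ j := by rw [← mul_pow]; norm_num
  rw [hT, hE, h4]
  field_simp
  ring

end ConcentrationAtScale

/-! ### Products of codes -/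

section Product

variable {V : Type*}

/-- The words of length `n` with letters in `N`. -/
def wordsOfLength (N : Finset V) : ℕ → Finset (List V)
  | 0 => {[]}
  | n + 1 => Finset.image₂ List.cons N (wordsOfLength N n)

theorem mem_wordsOfLength {N : Finset V} {n : ℕ} : ∀ {w : List V},
    w ∈ wordsOfLength N n ↔ w.length = n ∧ ∀ e ∈ w, e ∈ N := by
  induction n with
  | zero =>
    intro w
    simp only [wordsOfLength, Finset.mem_singleton, List.length_eq_zero_iff]
    constructor
    · rintro rfl; simp
    · exact fun h => h.1
  | succ n ih =>
    intro w
    simp only [wordsOfLength, Finset.mem_image₂]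
    constructor
    · rintro ⟨e, he, v, hv, rfl⟩
      obtain ⟨h1, h2⟩ := ih.1 hv
      refine ⟨by simp [h1], fun x hx => ?_⟩
      rcases List.mem_cons.1 hx with rfl | hx
      · exact he
      · exact h2 x hx
    · rintro ⟨h1, h2⟩
      obtain ⟨e, v, rfl⟩ := List.exists_cons_of_length_eq_add_one h1
      exact ⟨e, h2 e (by simp), v, ih.2 ⟨by simpa using h1, fun x hx => h2 x (by simp [hx])⟩, rfl⟩

/-- The average written as a sum over the set of all words. -/
theorem wordMean_eq_sum (N : Finset V) (n : ℕ) : ∀ f : List V → ℝ,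
    wordMean N n f = ∑ w ∈ wordsOfLength N n, f w * ((N.card : ℝ)⁻¹) ^ n := by
  induction n with
  | zero => intro f; simp [wordsOfLength, wordMean_zero]
  | succ n ih =>
    intro f
    rw [wordMean_succ, wordsOfLength, Finset.image₂, Finset.sum_image, Finset.sum_product,
      Finset.sum_div]
    · refine Finset.sum_congr rfl fun e _ => ?_
      rw [ih, Finset.sum_div]
      refine Finset.sum_congr rfl fun w _ => ?_
      rw [pow_succ, Function.uncurry]
      ring
    · rintro ⟨e, w⟩ _ ⟨e', w'⟩ _ h
      simpa using h

/-- The set of concatenations of the words of two codes. -/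
def mulCode (𝓐 𝓑 : Finset (List V)) : Finset (List V) := Finset.image₂ (· ++ ·) 𝓐 𝓑

/-- The set of concatenations of `k` words of a code. -/
def powCode (𝓐 : Finset (List V)) : ℕ → Finset (List V)
  | 0 => {[]}
  | k + 1 => mulCode 𝓐 (powCode 𝓐 k)

/-- No word of the set is a proper prefix of another one. -/
def PrefixFree (𝓐 : Finset (List V)) : Prop := ∀ l ∈ 𝓐, ∀ l' ∈ 𝓐, l <+: l' → l = l'

/-- No word of the set is a proper suffix of another one. -/
def SuffixFree (𝓐 : Finset (List V)) : Prop := ∀ l ∈ 𝓐, ∀ l' ∈ 𝓐, l <:+ l' → l = l'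

theorem PrefixFree.append_prefix {𝓐 : Finset (List V)} (h : PrefixFree 𝓐) {a a' y y' : List V}
    (ha : a ∈ 𝓐) (ha' : a' ∈ 𝓐) (hp : a ++ y <+: a' ++ y') : a = a' ∧ y <+: y' := by
  have h1 : a <+: a' ++ y' := (List.prefix_append a y).trans hp
  have h2 : a = a' := by
    rcases List.prefix_or_prefix_of_prefix h1 (List.prefix_append a' y') with h3 | h3
    · exact h a ha a' ha' h3
    · exact (h a' ha' a ha h3).symm
  subst h2
  exact ⟨rfl, (List.prefix_append_right_inj a).1 hp⟩

theorem SuffixFree.append_suffix {𝓑 : Finset (List V)} (h : SuffixFree 𝓑) {a a' y y' : List V}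
    (hy : y ∈ 𝓑) (hy' : y' ∈ 𝓑) (hp : a ++ y <:+ a' ++ y') : y = y' ∧ a <:+ a' := by
  have h1 : y <:+ a' ++ y' := (List.suffix_append a y).trans hp
  have h2 : y = y' := by
    rcases List.suffix_or_suffix_of_suffix h1 (List.suffix_append a' y') with h3 | h3
    · exact h y hy y' hy' h3
    · exact (h y' hy' y hy h3).symm
  subst h2
  refine ⟨rfl, ?_⟩
  obtain ⟨t, ht⟩ := hp
  refine ⟨t, ?_⟩
  rw [← List.append_assoc] at ht
  exact List.append_cancel_right ht

theorem PrefixFree.mul {𝓐 𝓑 : Finset (List V)} (hA : PrefixFree 𝓐) (hB : PrefixFree 𝓑) :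
    PrefixFree (mulCode 𝓐 𝓑) := by
  intro l hl l' hl' hp
  obtain ⟨a, ha, y, hy, rfl⟩ := Finset.mem_image₂.1 hl
  obtain ⟨a', ha', y', hy', rfl⟩ := Finset.mem_image₂.1 hl'
  obtain ⟨rfl, h⟩ := hA.append_prefix ha ha' hp
  rw [hB y hy y' hy' h]

theorem SuffixFree.mul {𝓐 𝓑 : Finset (List V)} (hA : SuffixFree 𝓐) (hB : SuffixFree 𝓑) :
    SuffixFree (mulCode 𝓐 𝓑) := by
  intro l hl l' hl' hp
  obtain ⟨a, ha, y, hy, rfl⟩ := Finset.mem_image₂.1 hl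
  obtain ⟨a', ha', y', hy', rfl⟩ := Finset.mem_image₂.1 hl'
  obtain ⟨rfl, h⟩ := hB.append_suffix hy hy' hp
  rw [hA a ha a' ha' h]

theorem PrefixFree.pow {𝓐 : Finset (List V)} (hA : PrefixFree 𝓐) (k : ℕ) :
    PrefixFree (powCode 𝓐 k) := by
  induction k with
  | zero => intro l hl l' hl' _; rw [Finset.mem_singleton.1 hl, Finset.mem_singleton.1 hl']
  | succ k ih => exact hA.mul ih

theorem SuffixFree.pow {𝓐 : Finset (List V)} (hA : SuffixFree 𝓐) (k : ℕ) :
    SuffixFree (powCode 𝓐 k) := by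
  induction k with
  | zero => intro l hl l' hl' _; rw [Finset.mem_singleton.1 hl, Finset.mem_singleton.1 hl']
  | succ k ih => exact hA.mul ih

theorem PrefixFree.codeWeight_mul {𝓐 : Finset (List V)} (hA : PrefixFree 𝓐) (N : Finset V)
    (𝓑 : Finset (List V)) : codeWeight N (mulCode 𝓐 𝓑) = codeWeight N 𝓐 * codeWeight N 𝓑 := by
  rw [codeWeight, mulCode, Finset.image₂, Finset.sum_image, Finset.sum_product, codeWeight,
    codeWeight, Finset.sum_mul_sum]
  · simp only [Function.uncurry, List.length_append, pow_add]
  · rintro ⟨a, y⟩ h1 ⟨a', y'⟩ h2 h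
    rw [Finset.mem_coe, Finset.mem_product] at h1 h2
    simp only [Function.uncurry] at h
    have h3 : a ++ y <+: a' ++ y' := by rw [h]
    obtain ⟨rfl, -⟩ := hA.append_prefix h1.1 h2.1 h3
    rw [List.append_cancel_left h]

theorem PrefixFree.codeWeight_pow {𝓐 : Finset (List V)} (hA : PrefixFree 𝓐) (N : Finset V)
    (k : ℕ) : codeWeight N (powCode 𝓐 k) = codeWeight N 𝓐 ^ k := by
  induction k with
  | zero => simp [powCode, codeWeight]
  | succ k ih => rw [powCode, hA.codeWeight_mul, ih, pow_succ, mul_comm]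

theorem wordProb_prefix {N : Finset V} (hN : N.Nonempty) {l : List V} (hl : ∀ e ∈ l, e ∈ N)
    {n : ℕ} (hn : l.length ≤ n) :
    wordProb N n (fun w => l <+: w) = ((N.card : ℝ)⁻¹) ^ l.length := by
  rw [← wordProb_eq_word l hl, ← wordProb_take N hN hn]
  refine wordProb_congr N fun w _ _ => ?_
  rw [List.prefix_iff_eq_take]
  exact eq_comm

/-- The weight of a prefix-free code is the probability that a random word starts with one of its
words. -/
theorem PrefixFree.wordProb_exists_prefix {N : Finset V} (hN : N.Nonempty) {𝓐 : Finset (List V)}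
    (hA : PrefixFree 𝓐) (hmem : ∀ l ∈ 𝓐, ∀ e ∈ l, e ∈ N) {n : ℕ} (hn : ∀ l ∈ 𝓐, l.length ≤ n) :
    wordProb N n (fun w => ∃ l ∈ 𝓐, l <+: w) = codeWeight N 𝓐 := by
  rw [codeWeight, Finset.sum_congr rfl fun l hl => (wordProb_prefix hN (hmem l hl) (hn l hl)).symm]
  unfold wordProb
  rw [← wordMean_sum]
  refine wordMean_congr N fun w _ _ => ?_
  by_cases h : ∃ l ∈ 𝓐, l <+: w
  · obtain ⟨l, hl, hp⟩ := h
    rw [if_pos ⟨l, hl, hp⟩, Finset.sum_eq_single_of_mem l hl, if_pos hp]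
    intro l' hl' hne
    rw [if_neg]
    intro hp'
    rcases List.prefix_or_prefix_of_prefix hp hp' with h | h
    · exact hne (hA l hl l' hl' h).symm
    · exact hne (hA l' hl' l hl h)
  · rw [if_neg h, Finset.sum_eq_zero]
    exact fun l hl => if_neg fun hp => h ⟨l, hl, hp⟩

theorem wordProb_exists_prefix_le {N : Finset V} (hN : N.Nonempty) {𝓐 : Finset (List V)}
    (hmem : ∀ l ∈ 𝓐, ∀ e ∈ l, e ∈ N) (n : ℕ) :
    wordProb N n (fun w => ∃ l ∈ 𝓐, l <+: w) ≤ codeWeight N 𝓐 := by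
  refine (wordProb_le_sum N n 𝓐 _ (fun l w => l <+: w) fun w _ h => h).trans ?_
  refine Finset.sum_le_sum fun l hl => ?_
  rcases le_or_gt l.length n with h | h
  · exact (wordProb_prefix hN (hmem l hl) h).le
  · rw [wordProb_false N fun w hw _ hp => by have := hp.length_le; omega]
    positivity

end Product

/-! ### Excursions from the origin that avoid a point -/

section Excursions

variable {V : Type*} [AddCommGroup V]

/-- The path with the given steps starts at `0`, is back at `0` at its end but not before, and does
not visit `b`. -/
def IsExcursion (b : V) (l : List V) : Prop :=
  l ≠ [] ∧ l.sum = 0 ∧ (∀ i, 0 < i → i < l.length → (l.take i).sum ≠ 0) ∧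
    ∀ i ≤ l.length, (l.take i).sum ≠ b

/-- The words with letters in `N` and length at most `T` that describe an excursion from `0`
avoiding `b`. -/
def excursions (N : Finset V) (b : V) (T : ℕ) : Finset (List V) :=
  ((Finset.range (T + 1)).biUnion (wordsOfLength N)).filter (IsExcursion b)

theorem mem_excursions {N : Finset V} {b : V} {T : ℕ} {l : List V} :
    l ∈ excursions N b T ↔ l.length ≤ T ∧ (∀ e ∈ l, e ∈ N) ∧ IsExcursion b l := by
  simp only [excursions, Finset.mem_filter, Finset.mem_biUnion, Finset.mem_range, Nat.lt_succ_iff,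
    mem_wordsOfLength]
  constructor
  · rintro ⟨⟨n, hn, rfl, h2⟩, h3⟩; exact ⟨hn, h2, h3⟩
  · rintro ⟨h1, h2, h3⟩; exact ⟨⟨_, h1, rfl, h2⟩, h3⟩

theorem excursions_prefixFree (N : Finset V) (b : V) (T : ℕ) : PrefixFree (excursions N b T) := by
  intro l hl l' hl' hp
  obtain ⟨-, -, h1, h2, -, -⟩ := mem_excursions.1 hl
  obtain ⟨-, -, -, -, h3, -⟩ := mem_excursions.1 hl'
  refine hp.eq_of_length (le_antisymm hp.length_le (not_lt.1 fun hlt => ?_))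
  refine h3 l.length (List.length_pos_iff.2 h1) hlt ?_
  rw [← List.prefix_iff_eq_take.1 hp, h2]

theorem excursions_suffixFree (N : Finset V) (b : V) (T : ℕ) : SuffixFree (excursions N b T) := by
  intro l hl l' hl' hp
  obtain ⟨-, -, h1, h2, -, -⟩ := mem_excursions.1 hl
  obtain ⟨-, -, -, h4, h3, -⟩ := mem_excursions.1 hl'
  obtain ⟨u, rfl⟩ := hp
  rcases List.eq_nil_or_concat u with rfl | ⟨_, _, h⟩
  · rfl
  exfalso
  have hu : 0 < u.length := by rw [h]; simp
  refine h3 u.length hu (by simpa using List.length_pos_iff.2 h1) ?_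
  rw [List.take_left]
  simpa [h2] using h4

/-- A product of `k` excursions is a closed path with at least `k` returns, of bounded length, that
avoids `b`. -/
theorem of_mem_powCode_excursions {N : Finset V} {b : V} (hb : b ≠ 0) {T : ℕ} {k : ℕ} :
    ∀ {l : List V}, l ∈ powCode (excursions N b T) k →
      l.length ≤ T * k ∧ (∀ e ∈ l, e ∈ N) ∧ l.sum = 0 ∧ (k ≠ 0 → l ≠ []) ∧
      (∀ i ≤ l.length, (l.take i).sum ≠ b) ∧
      k + 1 ≤ ((Finset.range (l.length + 1)).filter (fun i => (l.take i).sum = 0)).card := by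
  induction k with
  | zero =>
    intro l hl
    rw [powCode, Finset.mem_singleton] at hl
    subst hl
    simp [hb.symm]
  | succ k ih =>
    intro l hl
    obtain ⟨x, hx, y, hy, rfl⟩ := Finset.mem_image₂.1 hl
    obtain ⟨hxT, hxN, hx0, hxs, hxi, hxb⟩ := mem_excursions.1 hx
    obtain ⟨h1, h2, h3, -, h5, h6⟩ := ih hy
    refine ⟨?_, ?_, by simp [hxs, h3], fun _ => by simp [hx0], ?_, ?_⟩
    · rw [List.length_append, mul_add, mul_one]; omega
    · intro e he
      rcases List.mem_append.1 he with he | he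
      · exact hxN e he
      · exact h2 e he
    · intro i hi
      rcases le_or_gt i x.length with h | h
      · rw [List.take_append_of_le_length h]; exact hxb i h
      · rw [List.take_append, List.take_of_length_le h.le, List.sum_append, hxs, zero_add]
        exact h5 _ (by simp at hi; omega)
    · have hxl := List.length_pos_iff.2 hx0
      set s := (Finset.range (y.length + 1)).filter (fun i => (y.take i).sum = 0) with hs
      have hsub : insert 0 (s.map (addLeftEmbedding x.length)) ⊆
          (Finset.range ((x ++ y).length + 1)).filter (fun i => ((x ++ y).take i).sum = 0) := by
        intro i hi
        rw [Finset.mem_insert, Finset.mem_map] at hi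
        rw [Finset.mem_filter, Finset.mem_range]
        rcases hi with rfl | ⟨i, hi, rfl⟩
        · simp
        · rw [hs, Finset.mem_filter, Finset.mem_range] at hi
          simp only [addLeftEmbedding_apply, List.length_append, List.take_length_add_append,
            List.sum_append, hxs, hi.2, add_zero, and_true]
          omega
      refine le_trans ?_ (Finset.card_le_card hsub)
      rw [Finset.card_insert_of_notMem, Finset.card_map]
      · omega
      · simp only [Finset.mem_map, addLeftEmbedding_apply, not_exists, not_and]
        intro i _
        omega

theorem isLoopCode_powCode_excursions (N : Finset V) {b : V} (hb : b ≠ 0) (T : ℕ) {k : ℕ}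
    (hk : k ≠ 0) : IsLoopCode N (powCode (excursions N b T) k) (T * k) where
  mem _ hl := (of_mem_powCode_excursions hb hl).2.1
  ne_nil _ hl := (of_mem_powCode_excursions hb hl).2.2.2.1 hk
  length_le _ hl := (of_mem_powCode_excursions hb hl).1
  sum_eq_zero _ hl := (of_mem_powCode_excursions hb hl).2.2.1
  prefixFree := (excursions_prefixFree N b T).pow k
  suffixFree := (excursions_suffixFree N b T).pow k

/-- A path with at least `k` returns to its starting point `0`, none of them after a visit of `b`,
starts with `k` excursions. -/
theorem exists_prefix_mem_powCode {N : Finset V} {b : V} {T : ℕ} {k : ℕ} :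
    ∀ {w : List V}, w.length ≤ T → (∀ e ∈ w, e ∈ N) → (∀ i ≤ w.length, (w.take i).sum ≠ b) →
      k ≤ ((Finset.Icc 1 w.length).filter (fun i => (w.take i).sum = 0)).card →
      ∃ l ∈ powCode (excursions N b T) k, l <+: w := by
  induction k with
  | zero => intro w _ _ _ _; exact ⟨[], by simp [powCode], List.nil_prefix⟩
  | succ k ih =>
    intro w hT hN hb hk
    have hex : ∃ i, 0 < i ∧ i ≤ w.length ∧ (w.take i).sum = 0 := by
      obtain ⟨i, hi⟩ := Finset.card_pos.1 (lt_of_lt_of_le (Nat.succ_pos k) hk)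
      rw [Finset.mem_filter, Finset.mem_Icc] at hi
      exact ⟨i, hi.1.1, hi.1.2, hi.2⟩
    obtain ⟨h1, h2, h3⟩ := Nat.find_spec hex
    have hmin : ∀ i, 0 < i → i < Nat.find hex → (w.take i).sum ≠ 0 := fun i hi hlt h =>
      Nat.find_min hex hlt ⟨hi, by omega, h⟩
    generalize Nat.find hex = m at h1 h2 h3 hmin
    have hx : w.take m ∈ excursions N b T := by
      refine mem_excursions.2 ⟨by rw [List.length_take]; omega,
        fun e he => hN e (List.mem_of_mem_take he), ?_, h3, ?_, ?_⟩
      · intro h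
        have := congrArg List.length h
        rw [List.length_take, List.length_nil] at this
        omega
      · intro i hi hlt
        rw [List.length_take] at hlt
        rw [List.take_take, min_eq_left (by omega)]
        exact hmin i hi (by omega)
      · intro i hi
        rw [List.length_take] at hi
        rw [List.take_take, min_eq_left (by omega)]
        exact hb i (by omega)
    have hsum : ∀ i, (w.take (m + i)).sum = ((w.drop m).take i).sum := by
      intro i
      rw [List.take_add, List.sum_append, h3, zero_add]
    obtain ⟨l, hl, hp⟩ := ih (w := w.drop m) (by rw [List.length_drop]; omega)
      (fun e he => hN e (List.mem_of_mem_drop he))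
      (fun i hi => by
        rw [List.length_drop] at hi
        rw [← hsum]
        exact hb _ (by omega))
      (by
        have hsub : (Finset.Icc 1 w.length).filter (fun i => (w.take i).sum = 0) ⊆
            insert m (((Finset.Icc 1 (w.drop m).length).filter
              (fun i => ((w.drop m).take i).sum = 0)).map (addLeftEmbedding m)) := by
          intro i hi
          rw [Finset.mem_filter, Finset.mem_Icc] at hi
          rw [Finset.mem_insert, Finset.mem_map]
          rcases lt_trichotomy i m with h | h | h
          · exact absurd hi.2 (hmin i (by omega) h)
          · exact Or.inl h
          · right
            refine ⟨i - m, ?_, by rw [addLeftEmbedding_apply]; omega⟩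
            rw [Finset.mem_filter, Finset.mem_Icc, List.length_drop, ← hsum,
              show m + (i - m) = i by omega]
            exact ⟨⟨by omega, by omega⟩, hi.2⟩
        have h := (Finset.card_le_card hsub).trans (Finset.card_insert_le _ _)
        rw [Finset.card_map] at h
        omega)
    refine ⟨w.take m ++ l, Finset.mem_image₂.2 ⟨_, hx, _, hl, rfl⟩, ?_⟩
    obtain ⟨t, ht⟩ := hp
    exact ⟨t, by rw [List.append_assoc, ht, List.take_append_drop]⟩

/-- The weight of the code of excursions is the probability of a return up to time `T` that is not
preceded by a visit of `b`. -/
theorem codeWeight_excursions_eq {N : Finset V} (hN : N.Nonempty) {b : V} (T : ℕ) :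
    codeWeight N (excursions N b T) = wordProb N T (fun w => ∃ m, 0 < m ∧ m ≤ T ∧
      (w.take m).sum = 0 ∧ ∀ i ≤ m, (w.take i).sum ≠ b) := by
  rw [← (excursions_prefixFree N b T).wordProb_exists_prefix hN
    (fun l hl => (mem_excursions.1 hl).2.1) (fun l hl => (mem_excursions.1 hl).1)]
  refine wordProb_congr N fun w hw hwN => ⟨?_, ?_⟩
  · rintro ⟨l, hl, hp⟩
    obtain ⟨h1, -, h2, h3, -, h4⟩ := mem_excursions.1 hl
    have hle : ∀ i ≤ l.length, w.take i = l.take i := by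
      obtain ⟨t, rfl⟩ := hp
      exact fun i hi => List.take_append_of_le_length hi
    refine ⟨l.length, List.length_pos_iff.2 h2, h1, ?_, fun i hi => ?_⟩
    · rw [hle _ le_rfl, List.take_length, h3]
    · rw [hle i hi]; exact h4 i hi
  · rintro ⟨m, h1, h2, h3, h4⟩
    obtain ⟨l, hl, hp⟩ := exists_prefix_mem_powCode (N := N) (b := b) (T := T) (k := 1)
      (w := w.take m) (by rw [List.length_take]; omega)
      (fun e he => hwN e (List.mem_of_mem_take he))
      (fun i hi => by
        rw [List.length_take] at hi
        rw [List.take_take, min_eq_left (by omega)]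
        exact h4 i (by omega))
      (Finset.card_pos.2 ⟨m, by
        rw [Finset.mem_filter, Finset.mem_Icc, List.length_take, List.take_take, min_self]
        exact ⟨⟨h1, by omega⟩, h3⟩⟩)
    obtain ⟨x, hx, y, hy, rfl⟩ := Finset.mem_image₂.1 hl
    rw [powCode, Finset.mem_singleton] at hy
    subst hy
    simp only [List.append_nil] at hp
    exact ⟨x, hx, hp.trans (List.take_prefix _ _)⟩

/-- The word with the letters `-b` and `b` is an excursion that avoids `b`. -/
theorem codeWeight_excursions_pos {N : Finset V} {b : V} (hb : b ∈ N) (hnb : -b ∈ N) (hb0 : b ≠ 0)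
    (hbb : -b ≠ b) {T : ℕ} (hT : 2 ≤ T) : 0 < codeWeight N (excursions N b T) := by
  have hc : (0 : ℝ) < N.card := by exact_mod_cast Finset.card_pos.2 ⟨b, hb⟩
  refine Finset.sum_pos (fun l _ => by positivity) ⟨[-b, b], mem_excursions.2 ⟨hT, ?_, ?_⟩⟩
  · simp [hb, hnb]
  · refine ⟨by simp, by simp, fun i h1 h2 => ?_, fun i hi => ?_⟩
    · obtain rfl : i = 1 := by simp at h2; omega
      simpa using hb0
    · simp at hi
      interval_cases i
      · simpa using hb0.symm
      · simpa using hbb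
      · simpa using hb0.symm

/-- An excursion that avoids `b` does not start with the step `b`. -/
theorem codeWeight_excursions_le {N : Finset V} {b : V} (hb : b ∈ N) (T : ℕ) :
    codeWeight N (excursions N b T) ≤ 1 - (N.card : ℝ)⁻¹ := by
  have hN : N.Nonempty := ⟨b, hb⟩
  have hc : (0 : ℝ) < N.card := by exact_mod_cast hN.card_pos
  rw [codeWeight_excursions_eq hN]
  cases T with
  | zero =>
    rw [wordProb_false N fun w _ _ ⟨m, h1, h2, _⟩ => by omega, sub_nonneg]
    exact inv_le_one_of_one_le₀ (by exact_mod_cast hN.card_pos)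
  | succ n =>
    rw [wordProb_succ, div_le_iff₀ hc, sub_mul, inv_mul_cancel₀ hc.ne', one_mul,
      ← Finset.add_sum_erase _ _ hb, wordProb_false N, zero_add]
    · refine (Finset.sum_le_card_nsmul _ _ 1 fun e _ => wordProb_le_one N hN _ _).trans ?_
      rw [Finset.card_erase_of_mem hb, nsmul_eq_mul, mul_one, Nat.cast_pred hN.card_pos]
    · rintro w - - ⟨m, h1, -, -, h⟩
      exact h 1 h1 (by simp)

/-- Invariance under automorphisms that preserve the steps. -/
theorem codeWeight_excursions_map {N : Finset V} (hN : N.Nonempty) (σ : V ≃+ V)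
    (hσ : ∀ e, σ e ∈ N ↔ e ∈ N) (b : V) (T : ℕ) :
    codeWeight N (excursions N (σ b) T) = codeWeight N (excursions N b T) := by
  rw [codeWeight_excursions_eq hN, codeWeight_excursions_eq hN,
    ← wordProb_map (N := N) σ.toEquiv hσ]
  refine wordProb_congr N fun w _ _ => ?_
  have : ∀ i, ((w.map σ.toEquiv).take i).sum = σ (w.take i).sum := by
    intro i
    rw [← List.map_take, map_list_sum]
    rfl
  simp only [this, EmbeddingLike.map_eq_zero_iff, ne_eq, EmbeddingLike.apply_eq_iff_eq]

end Excursions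

/-! ### Boundary points that are visited often, in terms of splittings -/

section FrequentPoints

variable {V : Type*} [AddCommGroup V]

theorem sum_reverse_take {u : List V} {i : ℕ} (hi : i ≤ u.length) :
    (u.reverse.take (u.length - i)).sum = u.sum - (u.take i).sum := by
  have h : u.reverse.take (u.length - i) = (u.drop i).reverse := by
    rw [List.take_reverse]
    congr 2
    omega
  rw [h, List.sum_reverse, eq_sub_iff_add_eq', ← List.sum_append, List.take_append_drop]

/-- Every good splitting of the first part of the path that is not killed by the rest of the path
gives a point with `k` returns and a neighbour that is never visited, and different splittings give
different points. -/
theorem goodCount_sub_killedCount_le {N : Finset V} {b : V} (hb : b ≠ 0) {Z : Set V}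
    (h0Z : 0 ∈ Z) (hbZ : b ∈ Z) (hnbZ : -b ∈ Z) (T k : ℕ) {w₁ w₂ : List V} {X : ℕ → V}
    (hX : ∀ i ≤ (w₁ ++ w₂).length, X i = ((w₁ ++ w₂).take i).sum) :
    goodCount Z (powCode (excursions N b T) k) w₁
        - killedCount Z (powCode (excursions N b T) k) w₁ w₂
      ≤ ({x | (∃ i ≤ w₁.length, X i = x) ∧ (∀ i ≤ (w₁ ++ w₂).length, X i ≠ x + b) ∧
        k + 1 ≤ ((Finset.range (w₁.length + 1)).filter (fun i => X i = x)).card}.ncard : ℝ) := by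
  set 𝓛 := powCode (excursions N b T) k with h𝓛
  set B : Set V := {x | (∃ i ≤ w₁.length, X i = x) ∧ (∀ i ≤ (w₁ ++ w₂).length, X i ≠ x + b) ∧
    k + 1 ≤ ((Finset.range (w₁.length + 1)).filter (fun i => X i = x)).card} with hB
  have hBfin : B.Finite := by
    refine ((Finset.range (w₁.length + 1)).image X).finite_toSet.subset ?_
    rintro x ⟨⟨i, hi, rfl⟩, -⟩
    exact Finset.mem_coe.2 (Finset.mem_image_of_mem _ (Finset.mem_range.2 (by omega)))
  set M : Finset ℕ := (Finset.range (w₁.length + 1)).filter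
    (fun m => ∃ l ∈ 𝓛, GoodSplit Z l m w₁ ∧ ¬ KilledSplit Z l m w₁ w₂) with hM
  have h1 : goodCount Z 𝓛 w₁ - killedCount Z 𝓛 w₁ w₂ ≤ (M.card : ℝ) := by
    rw [goodCount, killedCount, ← Finset.sum_sub_distrib, hM, Finset.card_filter, Nat.cast_sum]
    refine Finset.sum_le_sum fun m _ => ?_
    rw [← Finset.sum_sub_distrib]
    calc _ ≤ ∑ l ∈ 𝓛, (if GoodSplit Z l m w₁ ∧ ¬ KilledSplit Z l m w₁ w₂ then (1 : ℝ) else 0) := by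
          refine Finset.sum_le_sum fun l _ => ?_
          by_cases hG : GoodSplit Z l m w₁ <;> by_cases hK : KilledSplit Z l m w₁ w₂ <;>
            simp [hG, hK]
      _ ≤ _ := by
          split_ifs with h
          · rw [Nat.cast_one]
            exact sum_indicator_le_one ((excursions_prefixFree N b T).pow k)
              (fun l => GoodSplit Z l m w₁ ∧ ¬ KilledSplit Z l m w₁ w₂)
              fun l _ hl => hl.1.occursAt
          · rw [Finset.sum_eq_zero]
            · simp
            · exact fun l hl => if_neg fun hc => h ⟨l, hl, hc⟩
  refine h1.trans ?_
  -- the positions of the path during the first part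
  have hX₁ : ∀ i ≤ w₁.length, X i = (w₁.take i).sum := by
    intro i hi
    rw [hX i (by rw [List.length_append]; omega), List.take_append_of_le_length hi]
  -- the path before a good splitting avoids `X m` and its translates by `b` and `-b`
  have hpast : ∀ {u s : List V}, w₁ = u ++ s → ¬ Hits Z 0 1 u.reverse →
      ∀ i < u.length, X u.length - X i ∉ Z := by
    intro u s hus hu i hi hc
    refine hu ⟨u.length - i, by omega, by simp, ?_⟩
    rw [zero_add, sum_reverse_take hi.le]
    rw [hX₁ _ (by rw [hus]; simp), hX₁ _ (by rw [hus]; simp; omega), hus, List.take_left,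
      List.take_append_of_le_length hi.le] at hc
    exact hc
  have hmaps : ∀ m ∈ (M : Set ℕ), X m ∈ B := by
    intro m hm
    rw [Finset.mem_coe, hM, Finset.mem_filter, Finset.mem_range] at hm
    obtain ⟨hmw, l, hl, ⟨u, v, hw, hum, hu, hv⟩, hK⟩ := hm
    obtain ⟨-, -, hl0, -, hlb, hlk⟩ := of_mem_powCode_excursions hb hl
    have hlen : w₁.length = m + (l.length + v.length) := by rw [hw]; simp [hum]
    have hXm : X m = u.sum := by
      rw [hX₁ m (by omega), hw, ← hum, List.take_left]
    have hXl : ∀ i ≤ l.length, X (m + i) = X m + (l.take i).sum := by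
      intro i hi
      rw [hX₁ (m + i) (by omega), hXm, hw, ← hum, List.take_length_add_append, List.sum_append,
        List.take_append_of_le_length hi]
    have hXv : ∀ i ≤ v.length, X (m + (l.length + i)) = X m + (v.take i).sum := by
      intro i hi
      rw [hX₁ _ (by omega), hXm, hw, ← hum, List.take_length_add_append, List.sum_append,
        List.take_length_add_append, List.sum_append, hl0, zero_add]
    have hXw : ∀ i ≤ w₂.length, X (w₁.length + i) = X m + v.sum + (w₂.take i).sum := by
      intro i hi
      rw [hX _ (by rw [List.length_append]; omega), List.take_length_add_append, List.sum_append,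
        hXm]
      congr 1
      rw [hw, List.sum_append, List.sum_append, hl0, zero_add]
    refine ⟨⟨m, by omega, rfl⟩, ?_, ?_⟩
    · intro i hi hc
      rw [List.length_append] at hi
      rcases lt_or_ge i m with h | h
      · refine hpast hw hu i (by omega) ?_
        rw [hum, hc, sub_add_cancel_left]
        exact hnbZ
      obtain ⟨i, rfl⟩ := Nat.exists_eq_add_of_le h
      rcases le_or_gt i l.length with h2 | h2
      · rw [hXl i h2, add_left_cancel_iff] at hc
        exact hlb i h2 hc
      obtain ⟨i, rfl⟩ := Nat.exists_eq_add_of_lt h2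
      rw [add_assoc l.length] at hc hi
      rcases le_or_gt (i + 1) v.length with h3 | h3
      · rw [hXv _ h3, add_left_cancel_iff] at hc
        exact hv ⟨i + 1, by omega, h3, by rw [zero_add, hc]; exact hbZ⟩
      obtain ⟨i', hi'⟩ := Nat.exists_eq_add_of_lt h3
      rw [show m + (l.length + (i + 1)) = w₁.length + (i' + 1) by omega, hXw _ (by omega),
        add_assoc, add_left_cancel_iff] at hc
      exact hK ⟨u, v, hw, hum, hu, hv, i' + 1, by omega, by omega, by rw [hc]; exact hbZ⟩
    · refine hlk.trans ?_
      rw [← Finset.card_map (addLeftEmbedding m)]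
      refine Finset.card_le_card fun i hi => ?_
      obtain ⟨i, hil, rfl⟩ := Finset.mem_map.1 hi
      rw [Finset.mem_filter, Finset.mem_range] at hil
      rw [Finset.mem_filter, Finset.mem_range, addLeftEmbedding_apply, hXl i (by omega), hil.2,
        add_zero]
      exact ⟨by omega, rfl⟩
  have hinj : Set.InjOn X (M : Set ℕ) := by
    have key : ∀ m ∈ M, ∀ m' ∈ M, m < m' → X m ≠ X m' := by
      intro m _ m' hm' hlt heq
      rw [hM, Finset.mem_filter] at hm'
      obtain ⟨-, l, -, ⟨u, v, hw, hum, hu, -⟩, -⟩ := hm'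
      refine hpast hw hu m (by omega) ?_
      rw [hum, heq, sub_self]
      exact h0Z
    intro m hm m' hm' heq
    rcases lt_trichotomy m m' with h | h | h
    · exact absurd heq (key m hm m' hm' h)
    · exact h
    · exact absurd heq.symm (key m' hm' m hm h)
  have := Set.ncard_le_ncard_of_injOn X hmaps hinj hBfin
  rw [Set.ncard_coe_finset] at this
  exact_mod_cast this

/-- The number of pairs of a position `m` and a letter `e` such that a product of `k` excursions
that avoid `e` starts in `w` at position `m`. -/
def occurrenceCount (N : Finset V) (k : ℕ) (w : List V) : ℝ :=
  ∑ m ∈ Finset.range (w.length + 1), ∑ e ∈ N,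
    if ∃ l ∈ powCode (excursions N e w.length) k, l <+: w.drop m then 1 else 0

theorem occurrenceCount_nonneg (N : Finset V) (k : ℕ) (w : List V) : 0 ≤ occurrenceCount N k w :=
  Finset.sum_nonneg fun _ _ => Finset.sum_nonneg fun _ _ => by split_ifs <;> norm_num

/-- A point with `k` returns and an unvisited neighbour gives, at the time of its first visit,
an occurrence of a product of `k` excursions that avoid a neighbour of the origin. -/
theorem ncard_frequent_le {N : Finset V} {k n : ℕ} {w : List V} (hwN : ∀ e ∈ w, e ∈ N)
    (hn : n ≤ w.length) {X : ℕ → V} (hX : ∀ i ≤ w.length, X i = (w.take i).sum) :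
    ({x | (∃ e ∈ N, ∀ i ≤ n, X i ≠ x + e) ∧
        k + 1 ≤ ((Finset.range (n + 1)).filter (fun i => X i = x)).card}.ncard : ℝ)
      ≤ occurrenceCount N k w := by
  set B : Set V := {x | (∃ e ∈ N, ∀ i ≤ n, X i ≠ x + e) ∧
    k + 1 ≤ ((Finset.range (n + 1)).filter (fun i => X i = x)).card} with hB
  set M : Finset ℕ := (Finset.range (w.length + 1)).filter
    (fun m => ∃ e ∈ N, ∃ l ∈ powCode (excursions N e w.length) k, l <+: w.drop m) with hM
  have h2 : (M.card : ℝ) ≤ occurrenceCount N k w := by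
    rw [occurrenceCount, hM, Finset.card_filter, Nat.cast_sum]
    refine Finset.sum_le_sum fun m _ => ?_
    have hnn : ∀ e ∈ N, (0 : ℝ) ≤
        if ∃ l ∈ powCode (excursions N e w.length) k, l <+: w.drop m then 1 else 0 :=
      fun e _ => by split_ifs <;> norm_num
    split_ifs with h
    · obtain ⟨e, he, h⟩ := h
      refine le_trans (le_of_eq ?_) (Finset.single_le_sum hnn he)
      rw [if_pos h, Nat.cast_one]
    · rw [Nat.cast_zero]
      exact Finset.sum_nonneg hnn
  refine le_trans ?_ h2
  have hfirst : ∀ x ∈ B, ∃ m, m ∈ M ∧ X m = x := by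
    rintro x ⟨⟨e, he, hxe⟩, hk⟩
    have hex : ∃ m, m ≤ n ∧ X m = x := by
      obtain ⟨i, hi⟩ := Finset.card_pos.1 (lt_of_lt_of_le (Nat.succ_pos k) hk)
      rw [Finset.mem_filter, Finset.mem_range] at hi
      exact ⟨i, by omega, hi.2⟩
    obtain ⟨h3, h4⟩ := Nat.find_spec hex
    have hmin : ∀ i, X i = x → i ≤ n → Nat.find hex ≤ i := fun i hi hin =>
      Nat.find_min' hex ⟨hin, hi⟩
    generalize Nat.find hex = m at h3 h4 hmin
    have hsum : ∀ i, m + i ≤ n → X (m + i) = x + (((w.take n).drop m).take i).sum := by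
      intro i hi
      rw [hX _ (by omega), ← h4, hX m (by omega), List.take_add, List.sum_append, List.drop_take,
        List.take_take, min_eq_left (by omega)]
    have hlen : ((w.take n).drop m).length = n - m := by
      rw [List.length_drop, List.length_take, min_eq_left hn]
    obtain ⟨l, hl, hp⟩ := exists_prefix_mem_powCode (N := N) (b := e) (T := w.length) (k := k)
      (w := (w.take n).drop m) (by omega)
      (fun y hy => hwN y (List.mem_of_mem_take (List.mem_of_mem_drop hy)))
      (fun i hi hc => hxe (m + i) (by omega) (by rw [hsum i (by omega), hc]))
      (by
        have hsub : (Finset.range (n + 1)).filter (fun i => X i = x) ⊆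
            insert m (((Finset.Icc 1 ((w.take n).drop m).length).filter
              (fun i => (((w.take n).drop m).take i).sum = 0)).map (addLeftEmbedding m)) := by
          intro i hi
          rw [Finset.mem_filter, Finset.mem_range] at hi
          rw [Finset.mem_insert, Finset.mem_map]
          have h5 := hmin i hi.2 (by omega)
          rcases h5.eq_or_lt with h | h
          · exact Or.inl h.symm
          · right
            refine ⟨i - m, ?_, by rw [addLeftEmbedding_apply]; omega⟩
            have h6 := hsum (i - m) (by omega)
            rw [show m + (i - m) = i by omega, hi.2, left_eq_add] at h6
            rw [Finset.mem_filter, Finset.mem_Icc]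
            exact ⟨⟨by omega, by omega⟩, h6⟩
        have h := (Finset.card_le_card hsub).trans (Finset.card_insert_le _ _)
        rw [Finset.card_map] at h
        omega)
    refine ⟨m, ?_, h4⟩
    rw [hM, Finset.mem_filter, Finset.mem_range]
    refine ⟨by omega, e, he, l, hl, hp.trans ?_⟩
    rw [List.drop_take]
    exact List.take_prefix _ _
  have hsub : B ⊆ ((M.image X : Finset V) : Set V) := by
    intro x hx
    obtain ⟨m, hm, rfl⟩ := hfirst x hx
    exact Finset.mem_coe.2 (Finset.mem_image_of_mem _ hm)
  have h3 := Set.ncard_le_ncard hsub (Finset.finite_toSet _)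
  rw [Set.ncard_coe_finset] at h3
  exact_mod_cast h3.trans Finset.card_image_le

/-- The first moment bound for the number of points with many returns and an unvisited
neighbour. -/
theorem wordMean_occurrences_le {N : Finset V} (hN : N.Nonempty) {p : ℝ} {n : ℕ}
    (hp : ∀ e ∈ N, codeWeight N (excursions N e n) ≤ p) (k : ℕ) :
    wordMean N n (occurrenceCount N k) ≤ (n + 1) * N.card * p ^ k := by
  have h1 : wordMean N n (occurrenceCount N k)
      = ∑ m ∈ Finset.range (n + 1), ∑ e ∈ N, wordProb N n (fun w =>
        ∃ l ∈ powCode (excursions N e n) k, l <+: w.drop m) := by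
    unfold wordProb
    simp only [← wordMean_sum]
    exact wordMean_congr N fun w hw _ => by rw [occurrenceCount, hw]; congr!
  rw [h1]
  have h2 : ∀ m ∈ Finset.range (n + 1), ∀ e ∈ N, wordProb N n (fun w =>
        ∃ l ∈ powCode (excursions N e n) k, l <+: w.drop m) ≤ p ^ k := by
    intro m hm e he
    rw [Finset.mem_range] at hm
    obtain ⟨t, rfl⟩ : ∃ t, n = m + t := ⟨n - m, by omega⟩
    have hmem : ∀ l ∈ powCode (excursions N e (m + t)) k, ∀ x ∈ l, x ∈ N := by
      clear h1 hp hm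
      induction k with
      | zero => intro l hl; rw [powCode, Finset.mem_singleton] at hl; simp [hl]
      | succ k ih =>
        intro l hl x hx
        obtain ⟨a, ha, y, hy, rfl⟩ := Finset.mem_image₂.1 hl
        rcases List.mem_append.1 hx with hx | hx
        · exact (mem_excursions.1 ha).2.1 x hx
        · exact ih y hy x hx
    rw [wordProb_append, ← wordMean_const N hN m (p ^ k)]
    refine wordMean_mono N fun u hu _ => ?_
    subst hu
    simp only [List.drop_left]
    refine (wordProb_exists_prefix_le hN hmem t).trans ?_
    rw [(excursions_prefixFree N e _).codeWeight_pow]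
    exact pow_le_pow_left₀ (codeWeight_nonneg _ _) (hp e he) k
  calc _ ≤ ∑ m ∈ Finset.range (n + 1), ∑ e ∈ N, p ^ k :=
        Finset.sum_le_sum fun m hm => Finset.sum_le_sum fun e he => h2 m hm e he
    _ = _ := by simp; ring

end FrequentPoints

/-! ### Escape probabilities and excursions on the lattice -/

section Lattice

variable {d : ℕ}

theorem ne_zero_of_mem_unitSteps {b : Fin d → ℤ} (hb : b ∈ unitSteps d) : b ≠ 0 := by
  obtain ⟨i, rfl | rfl⟩ := mem_unitSteps.1 hb <;> simp

theorem neg_ne_self_of_mem_unitSteps {b : Fin d → ℤ} (hb : b ∈ unitSteps d) : -b ≠ b := by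
  intro h
  refine ne_zero_of_mem_unitSteps hb (funext fun i => ?_)
  have := congrFun h i
  simp only [Pi.neg_apply, Pi.zero_apply] at this ⊢
  omega

/-- The walk escapes from `{0, b, -b}` in a coordinate direction orthogonal to `b`, which exists as
`d ≥ 2`. -/
theorem le_escapeProb_unitSteps (hd : 2 ≤ d) {b : Fin d → ℤ} (hb : b ∈ unitSteps d) (n : ℕ) :
    1 / ((n : ℝ) + 1) / (unitSteps d).card
      ≤ escapeProb (unitSteps d) (({0, b, -b} : Finset (Fin d → ℤ)) : Set (Fin d → ℤ)) (n + 1) := by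
  obtain ⟨i, hi⟩ := mem_unitSteps.1 hb
  have : Nontrivial (Fin d) := Fin.nontrivial_iff_two_le.2 hd
  obtain ⟨j, hj⟩ := exists_ne i
  have hbj : b j = 0 := by rcases hi with rfl | rfl <;> simp [hj]
  refine le_escapeProb (unitSteps_nonempty hd) _ (Pi.evalAddMonoidHom (fun _ : Fin d => ℤ) j)
    ?_ ?_ ?_ ?_ (e₀ := Pi.single j 1) (mem_unitSteps.2 ⟨j, Or.inl rfl⟩) (by simp) n
  · intro z hz
    simp only [Finset.coe_insert, Finset.coe_singleton, Set.mem_insert_iff,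
      Set.mem_singleton_iff] at hz
    rcases hz with rfl | rfl | rfl <;> simp [hbj]
  · intro e he
    obtain ⟨k, rfl | rfl⟩ := mem_unitSteps.1 he <;>
      by_cases hk : j = k <;> simp [hk]
  · intro e he
    obtain ⟨k, rfl | rfl⟩ := mem_unitSteps.1 he <;>
      by_cases hk : j = k <;> simp [hk]
  · have h := sum_unitSteps (d := d) (fun e => ((e j : ℤ) : ℝ))
    have h2 : ((∑ e ∈ unitSteps d, Pi.evalAddMonoidHom (fun _ : Fin d => ℤ) j e : ℤ) : ℝ) = 0 := by
      push_cast
      simp only [Pi.evalAddMonoidHom_apply]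
      rw [h]
      refine Finset.sum_eq_zero fun k _ => ?_
      by_cases hk : j = k <;> simp [hk]
    exact_mod_cast h2

theorem escapeProb_unitSteps_pos (hd : 2 ≤ d) {b : Fin d → ℤ} (hb : b ∈ unitSteps d) (i : ℕ) :
    1 / ((unitSteps d).card : ℝ) / 2 ^ i
      ≤ escapeProb (unitSteps d) (({0, b, -b} : Finset (Fin d → ℤ)) : Set (Fin d → ℤ)) (2 ^ i) := by
  obtain ⟨n, hn⟩ : ∃ n, 2 ^ i = n + 1 := ⟨2 ^ i - 1, by have := Nat.one_le_two_pow (n := i); omega⟩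
  have h := le_escapeProb_unitSteps hd hb n
  have h2 : (2 : ℝ) ^ i = (n : ℝ) + 1 := by exact_mod_cast hn
  rw [hn, h2, div_right_comm]
  exact h

/-- The escape probabilities at the scales `2 ^ i` decay at most like a power of `i`. -/
theorem exists_escapeProb_mul_pow_monotone (hd : 2 ≤ d) {b : Fin d → ℤ} (hb : b ∈ unitSteps d) :
    ∃ A i₁ : ℕ, ∀ i ≥ i₁,
      escapeProb (unitSteps d) (({0, b, -b} : Finset (Fin d → ℤ)) : Set (Fin d → ℤ)) (2 ^ i)
        * ((i : ℝ) + 1) ^ A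
      ≤ escapeProb (unitSteps d) (({0, b, -b} : Finset (Fin d → ℤ)) : Set (Fin d → ℤ))
        (2 ^ (i + 1)) * ((i : ℝ) + 2) ^ A := by
  have hN := unitSteps_nonempty hd
  have hcard : (0 : ℝ) < (unitSteps d).card := by exact_mod_cast hN.card_pos
  set Z : Finset (Fin d → ℤ) := {0, b, -b} with hZ
  obtain ⟨C, hC, hhit⟩ := exists_wordProb_hits_le hd
  refine exists_monotone_mul_pow (a := fun i => escapeProb (unitSteps d) (Z : Set _) (2 ^ i))
    (fun i => escapeProb_nonneg _ _ _) (K := Z.card * (C * 3))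
    (c := 1 / ((unitSteps d).card : ℝ)) (by positivity) ?_ (by positivity)
    (fun i => escapeProb_unitSteps_pos hd hb i)
  intro i hi
  have h := escapeProb_sub_le hN (Z : Set (Fin d → ℤ)) (m₀ := 2 ^ i) (M := 2 ^ i)
    (m := 2 ^ (i + 1)) (n := 2 ^ (i + 2)) (η := Z.card * (C * 3 / i)) (by rw [pow_succ]; omega)
    (Nat.pow_le_pow_right (by norm_num) (by omega)) (fun c => wordProb_hits_finset_le Z fun z => by
      refine (hhit i 2 _ c z hi (Nat.sub_le _ _)).trans (le_of_eq ?_)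
      norm_num)
  refine h.trans (le_of_eq ?_)
  ring

/-- A signed permutation of the coordinates that maps one unit vector to another one. -/
theorem exists_addEquiv_unitSteps {b e : Fin d → ℤ} (hb : b ∈ unitSteps d)
    (he : e ∈ unitSteps d) :
    ∃ σ : (Fin d → ℤ) ≃+ (Fin d → ℤ), (∀ x, σ x ∈ unitSteps d ↔ x ∈ unitSteps d) ∧ σ b = e := by
  have hswap : ∀ i j : Fin d, ∃ σ : (Fin d → ℤ) ≃+ (Fin d → ℤ),
      (∀ x, σ x ∈ unitSteps d ↔ x ∈ unitSteps d) ∧ ∀ a, σ (Pi.single i a) = Pi.single j a := by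
    intro i j
    refine ⟨(LinearEquiv.funCongrLeft ℤ ℤ (Equiv.swap i j)).toAddEquiv, fun x => ?_, fun a => ?_⟩
    · simp only [mem_unitSteps_iff, latticeNeighbors, Set.mem_ofPred_eq, Pi.zero_apply, sub_zero]
      rw [← Equiv.sum_comp (Equiv.swap i j) (fun k => x k ^ 2)]
      rfl
    · funext k
      change (Pi.single i a : Fin d → ℤ) (Equiv.swap i j k) = _
      by_cases hk : k = j
      · subst hk; simp
      · rw [Pi.single_eq_of_ne hk, Pi.single_eq_of_ne]
        intro h
        rw [Equiv.swap_apply_eq_iff, Equiv.swap_apply_left] at h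
        exact hk h
  have hneg : ∀ σ : (Fin d → ℤ) ≃+ (Fin d → ℤ), (∀ x, σ x ∈ unitSteps d ↔ x ∈ unitSteps d) →
      ∀ x, (σ.trans (AddEquiv.neg _)) x ∈ unitSteps d ↔ x ∈ unitSteps d := by
    intro σ hσ x
    rw [← hσ x]
    exact neg_mem_unitSteps
  obtain ⟨i, hi⟩ := mem_unitSteps.1 hb
  obtain ⟨j, hj⟩ := mem_unitSteps.1 he
  obtain ⟨σ, hσ, hij⟩ := hswap i j
  rcases hi with rfl | rfl <;> rcases hj with rfl | rfl
  · exact ⟨σ, hσ, hij 1⟩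
  · refine ⟨σ.trans (AddEquiv.neg _), hneg σ hσ, ?_⟩
    change -σ _ = _
    rw [hij, ← Pi.single_neg]
  · refine ⟨σ.trans (AddEquiv.neg _), hneg σ hσ, ?_⟩
    change -σ _ = _
    rw [hij, ← Pi.single_neg, neg_neg]
  · exact ⟨σ, hσ, hij (-1)⟩

/-- By symmetry all neighbours of the origin give the same weight. -/
theorem codeWeight_excursions_unitSteps (hd : 2 ≤ d) {b e : Fin d → ℤ} (hb : b ∈ unitSteps d)
    (he : e ∈ unitSteps d) (T : ℕ) :
    codeWeight (unitSteps d) (excursions (unitSteps d) e T)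
      = codeWeight (unitSteps d) (excursions (unitSteps d) b T) := by
  obtain ⟨σ, hσ, rfl⟩ := exists_addEquiv_unitSteps hb he
  exact codeWeight_excursions_map (unitSteps_nonempty hd) σ hσ b T

end Lattice

/-! ### From words to the random walk -/

section Walk

variable {Ω : Type*} {d : ℕ} {S : ℕ → Ω → Fin d → ℤ}

/-- The word formed by the first `n` steps of the walk. -/
def stepWord (S : ℕ → Ω → Fin d → ℤ) (n : ℕ) (ω : Ω) : List (Fin d → ℤ) :=
  (List.range n).map fun k => S (k + 1) ω - S k ω

theorem length_stepWord (n : ℕ) (ω : Ω) : (stepWord S n ω).length = n := by simp [stepWord]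

theorem take_stepWord {m n : ℕ} (h : m ≤ n) (ω : Ω) :
    (stepWord S n ω).take m = stepWord S m ω := by
  rw [stepWord, ← List.map_take, List.take_range, min_eq_left h, stepWord]

theorem sum_stepWord {ω : Ω} (h0 : S 0 ω = 0) (n : ℕ) : (stepWord S n ω).sum = S n ω := by
  induction n with
  | zero => simp [stepWord, h0]
  | succ n ih =>
    rw [stepWord, List.range_succ, List.map_append, List.sum_append, ← stepWord, ih]
    simp

theorem eq_sum_take_stepWord {ω : Ω} (h0 : S 0 ω = 0) {i n : ℕ} (h : i ≤ n) :
    S i ω = ((stepWord S n ω).take i).sum := by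
  rw [take_stepWord h, sum_stepWord h0]

theorem stepWord_eq_iff {n : ℕ} {ω : Ω} {l : List (Fin d → ℤ)} (hl : l.length = n) :
    stepWord S n ω = l ↔ ∀ k ∈ Finset.range n, S (k + 1) ω - S k ω = l.getD k 0 := by
  constructor
  · rintro rfl k hk
    rw [Finset.mem_range] at hk
    simp [stepWord, List.getD_eq_getElem?_getD, hk]
  · intro h
    refine List.ext_getElem (by rw [length_stepWord, hl]) fun k h1 h2 => ?_
    rw [length_stepWord] at h1
    have := h k (Finset.mem_range.2 h1)
    rw [List.getD_eq_getElem _ _ h2] at this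
    simpa [stepWord] using this

/-- The event `T_x < T_y` in terms of the path. -/
theorem firstPassage_lt_iff {x y : Fin d → ℤ} {ω : Ω} :
    firstPassage S x ω < firstPassage S y ω ↔
      ∃ m, 0 < m ∧ S m ω = x ∧ ∀ i, 0 < i → i ≤ m → S i ω ≠ y := by
  constructor
  · intro h
    have hne : hittingAfter S {x} 1 ω ≠ ⊤ := ne_top_of_lt h
    have hmem := hittingAfter_mem_set_of_ne_top hne
    rw [WithTop.untopA_eq_untop hne] at hmem
    have hle := le_hittingAfter (u := S) (s := {x}) (n := 1) ω
    have hcoe := WithTop.coe_untop _ hne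
    refine ⟨(hittingAfter S {x} 1 ω).untop hne, ?_, hmem, fun i h1 h2 h3 => ?_⟩
    · rw [← hcoe] at hle
      exact Nat.lt_of_lt_of_le Nat.one_pos (WithTop.coe_le_coe.1 hle)
    · refine notMem_of_lt_hittingAfter (u := S) (s := {y}) (n := 1) (ω := ω) (k := i) ?_ h1 h3
      refine lt_of_le_of_lt ?_ h
      change (i : WithTop ℕ) ≤ hittingAfter S {x} 1 ω
      rw [← hcoe]
      exact WithTop.coe_le_coe.2 h2
  · rintro ⟨m, h1, h2, h3⟩
    have hle : firstPassage S x ω ≤ m := hittingAfter_le_of_mem h1 h2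
    refine lt_of_le_of_lt hle (not_le.1 fun h => ?_)
    obtain ⟨i, hi, hy⟩ := hittingAfter_le_iff.1 h
    exact h3 i hi.1 hi.2 hy

theorem visitCount_eq_card {n : ℕ} {x : Fin d → ℤ} {ω : Ω} :
    visitCount S n x ω = ((Finset.range (n + 1)).filter (fun i => S i ω = x)).card := by
  rw [visitCount, Finset.card_filter]

variable [MeasurableSpace Ω] {μ : Measure Ω}

theorem measurable_step (hS : IsSimpleRandomWalk S μ) (k : ℕ) :
    Measurable fun ω => S (k + 1) ω - S k ω :=
  (hS.measurable (k + 1)).sub (hS.measurable k)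

theorem measurableSet_stepWord (hS : IsSimpleRandomWalk S μ) {n : ℕ} {l : List (Fin d → ℤ)}
    (hl : l.length = n) : MeasurableSet {ω | stepWord S n ω = l} := by
  have : {ω | stepWord S n ω = l}
      = ⋂ k ∈ Finset.range n, {ω | S (k + 1) ω - S k ω = l.getD k 0} := by
    ext ω
    simp only [Set.mem_ofPred_eq, stepWord_eq_iff hl, Set.mem_iInter]
  rw [this]
  exact Finset.measurableSet_biInter _ fun k _ =>
    measurable_step hS k (measurableSet_singleton _)

theorem measure_stepWord_eq (hS : IsSimpleRandomWalk S μ) {n : ℕ} {l : List (Fin d → ℤ)}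
    (hl : l.length = n) (hlN : ∀ e ∈ l, e ∈ unitSteps d) :
    μ {ω | stepWord S n ω = l} = ENNReal.ofReal ((((unitSteps d).card : ℝ)⁻¹) ^ n) := by
  have h1 : {ω | stepWord S n ω = l}
      = ⋂ k ∈ Finset.range n, (fun ω => S (k + 1) ω - S k ω) ⁻¹' {l.getD k 0} := by
    ext ω
    simp only [Set.mem_ofPred_eq, stepWord_eq_iff hl, Set.mem_iInter, Set.mem_preimage,
      Set.mem_singleton_iff]
  have h2 := hS.indep.measure_inter_preimage_eq_mul (Finset.range n)
    (sets := fun k => {l.getD k 0}) (fun k _ => measurableSet_singleton _)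
  rw [h1, h2, Finset.prod_congr rfl (g := fun _ => ENNReal.ofReal (((unitSteps d).card : ℝ)⁻¹)),
    Finset.prod_const, Finset.card_range, ← ENNReal.ofReal_pow (by positivity)]
  intro k hk
  rw [Finset.mem_range, ← hl] at hk
  have hmem : l.getD k 0 ∈ unitSteps d := by
    rw [List.getD_eq_getElem _ _ hk]
    exact hlN _ (List.getElem_mem hk)
  have hd : 0 < d := by
    obtain ⟨i, -⟩ := mem_unitSteps.1 hmem
    exact i.pos
  rw [card_unitSteps, ENNReal.ofReal_inv_of_pos (by positivity)]
  refine (hS.uniform k _ (mem_unitSteps_iff.1 hmem)).trans ?_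
  rw [ENNReal.ofReal_mul (by norm_num)]
  simp

theorem ae_forall_step_mem [IsProbabilityMeasure μ] (hd : 2 ≤ d) (hS : IsSimpleRandomWalk S μ) :
    ∀ᵐ ω ∂μ, ∀ k, S (k + 1) ω - S k ω ∈ unitSteps d := by
  rw [ae_all_iff]
  intro k
  have hm : MeasurableSet {ω | S (k + 1) ω - S k ω ∈ unitSteps d} :=
    measurable_step hS k (unitSteps d).measurableSet
  have hU : {ω | S (k + 1) ω - S k ω ∈ unitSteps d}
      = ⋃ e ∈ unitSteps d, {ω | S (k + 1) ω - S k ω = e} := by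
    ext ω; simp
  refine (mem_ae_iff_prob_eq_one hm).2 ?_
  rw [hU, measure_biUnion_finset]
  · rw [Finset.sum_congr rfl fun e he => hS.uniform k e (mem_unitSteps_iff.1 he), Finset.sum_const,
      nsmul_eq_mul]
    have h1 : ((unitSteps d).card : ℝ≥0∞) = 2 * d := by
      have := card_unitSteps d
      exact_mod_cast this
    rw [h1]
    refine ENNReal.mul_inv_cancel ?_ (ENNReal.mul_ne_top (by simp) (by simp))
    simp only [ne_eq, mul_eq_zero, not_or]
    exact ⟨by norm_num, by norm_cast; omega⟩
  · intro e _ e' _ hne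
    exact Set.disjoint_left.2 fun ω h1 h2 => hne (h1.symm.trans h2)
  · exact fun e _ => measurable_step hS k (measurableSet_singleton _)

/-- The law of the word formed by the first `n` steps is the uniform one. -/
theorem measure_stepWord [IsProbabilityMeasure μ] (hd : 2 ≤ d) (hS : IsSimpleRandomWalk S μ)
    (n : ℕ) (P : List (Fin d → ℤ) → Prop) :
    μ {ω | P (stepWord S n ω)} = ENNReal.ofReal (wordProb (unitSteps d) n P) := by
  have h1 : {ω | P (stepWord S n ω)} =ᵐ[μ]
      ⋃ l ∈ (wordsOfLength (unitSteps d) n).filter P, {ω | stepWord S n ω = l} := by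
    filter_upwards [ae_forall_step_mem hd hS] with ω hω
    refine propext ⟨fun h => ?_, fun h => ?_⟩
    · refine Set.mem_biUnion (x := stepWord S n ω) ?_ rfl
      rw [Finset.mem_coe, Finset.mem_filter, mem_wordsOfLength]
      refine ⟨⟨length_stepWord _ _, fun e he => ?_⟩, h⟩
      obtain ⟨k, -, rfl⟩ := List.mem_map.1 he
      exact hω k
    · obtain ⟨l, hl, h2⟩ := Set.mem_iUnion₂.1 h
      have h3 : stepWord S n ω = l := h2
      rw [Finset.mem_filter] at hl
      change P (stepWord S n ω)
      rw [h3]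
      exact hl.2
  have hmem : ∀ l ∈ (wordsOfLength (unitSteps d) n).filter P, l.length = n ∧
      ∀ e ∈ l, e ∈ unitSteps d := fun l hl => mem_wordsOfLength.1 (Finset.mem_filter.1 hl).1
  rw [measure_congr h1, measure_biUnion_finset, wordProb, wordMean_eq_sum,
    Finset.sum_congr rfl fun l hl => measure_stepWord_eq hS (hmem l hl).1 (hmem l hl).2,
    ← ENNReal.ofReal_sum_of_nonneg fun l _ => by positivity, Finset.sum_filter]
  · congr 1
    refine Finset.sum_congr rfl fun l _ => ?_
    split_ifs <;> simp
  · intro l _ l' _ hne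
    exact Set.disjoint_left.2 fun ω h1 h2 => hne (Eq.trans (Eq.symm h1) h2)
  · exact fun l hl => measurableSet_stepWord hS (hmem l hl).1

/-- The Borel–Cantelli lemma for events that depend on finitely many steps. -/
theorem ae_eventually_not_stepWord [IsProbabilityMeasure μ] (hd : 2 ≤ d)
    (hS : IsSimpleRandomWalk S μ) (L : ℕ → ℕ) (P : ℕ → List (Fin d → ℤ) → Prop) {g : ℕ → ℝ}
    (hg : Summable g) {j₀ : ℕ} (hP : ∀ j ≥ j₀, wordProb (unitSteps d) (L j) (P j) ≤ g j) :
    ∀ᵐ ω ∂μ, ∀ᶠ j in atTop, ¬ P j (stepWord S (L j) ω) := by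
  have hsum : ∑' j, μ {ω | P (j + j₀) (stepWord S (L (j + j₀)) ω)} ≠ ∞ := by
    refine ne_top_of_le_ne_top ((summable_nat_add_iff j₀).2 hg).tsum_ofReal_ne_top
      (ENNReal.tsum_le_tsum fun j => ?_)
    rw [measure_stepWord hd hS]
    exact ENNReal.ofReal_le_ofReal (hP _ (by omega))
  filter_upwards [ae_eventually_notMem hsum] with ω hω
  obtain ⟨j₁, hj₁⟩ := eventually_atTop.1 hω
  filter_upwards [eventually_ge_atTop (j₁ + j₀)] with j hj
  have := hj₁ (j - j₀) (by omega)
  simpa [Nat.sub_add_cancel (by omega : j₀ ≤ j)] using this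

/-- The weights of the codes of excursions converge to `P(T_0 < T_b)`. -/
theorem tendsto_codeWeight_excursions [IsProbabilityMeasure μ] (hd : 2 ≤ d)
    (hS : IsSimpleRandomWalk S μ) {b : Fin d → ℤ} (hb : b ≠ 0) :
    Monotone (fun T => codeWeight (unitSteps d) (excursions (unitSteps d) b T)) ∧
    Tendsto (fun T => codeWeight (unitSteps d) (excursions (unitSteps d) b T)) atTop
      (𝓝 (μ.real {ω | firstPassage S 0 ω < firstPassage S b ω})) := by
  set E : ℕ → Set Ω := fun T => {ω | ∃ m, 0 < m ∧ m ≤ T ∧ S m ω = 0 ∧ ∀ i ≤ m, S i ω ≠ b} with hE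
  have hmono : Monotone E := by
    rintro T T' h ω ⟨m, h1, h2, h3⟩
    exact ⟨m, h1, h2.trans h, h3⟩
  have hw : ∀ T, codeWeight (unitSteps d) (excursions (unitSteps d) b T) = μ.real (E T) := by
    intro T
    rw [codeWeight_excursions_eq (unitSteps_nonempty hd),
      ← ENNReal.toReal_ofReal (wordProb_nonneg _ _ _), ← measure_stepWord hd hS, Measure.real]
    congr 1
    refine measure_congr ?_
    filter_upwards [hS.start] with ω hω
    refine propext (exists_congr fun m => and_congr_right fun _ => and_congr_right fun hm => ?_)
    rw [← eq_sum_take_stepWord hω hm]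
    refine and_congr_right fun _ => forall₂_congr fun i hi => ?_
    rw [← eq_sum_take_stepWord hω (hi.trans hm)]
  have hU : μ.real (⋃ T, E T) = μ.real {ω | firstPassage S 0 ω < firstPassage S b ω} := by
    refine measureReal_congr ?_
    filter_upwards [hS.start] with ω hω
    refine propext ?_
    change ω ∈ ⋃ T, E T ↔ firstPassage S 0 ω < firstPassage S b ω
    rw [Set.mem_iUnion, firstPassage_lt_iff]
    constructor
    · rintro ⟨T, m, h1, -, h3, h4⟩
      exact ⟨m, h1, h3, fun i _ hi => h4 i hi⟩
    · rintro ⟨m, h1, h3, h4⟩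
      refine ⟨m, m, h1, le_rfl, h3, fun i hi => ?_⟩
      rcases Nat.eq_zero_or_pos i with rfl | h
      · rw [hω]; exact hb.symm
      · exact h4 i h hi
  simp only [hw]
  refine ⟨fun T T' h => measureReal_mono (hmono h), ?_⟩
  rw [← hU]
  exact (ENNReal.tendsto_toReal (measure_ne_top _ _)).comp (tendsto_measure_iUnion_atTop hmono)

end Walk

/-! ### The two bounds for the number of frequent boundary points -/

section Bounds

variable {Ω : Type*} {d : ℕ} {S : ℕ → Ω → Fin d → ℤ}

theorem frequentCount_finite (β δ : ℝ) (n : ℕ) (ω : Ω) :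
    {x | x ∈ innerBoundary (walkRange S n ω) ∧
      (visitCount S n x ω : ℝ) / Real.log n ≥ β * δ}.Finite := by
  refine ((Finset.range (n + 1)).image (fun i => S i ω)).finite_toSet.subset ?_
  rintro x ⟨⟨⟨i, hi, rfl⟩, -⟩, -⟩
  exact Finset.mem_coe.2 (Finset.mem_image.2 ⟨i, Finset.mem_range.2 (by omega), rfl⟩)

theorem rpow_le_pow_ceil {p κ : ℝ} (hp0 : 0 < p) (hp1 : p ≤ 1) (hκ : 0 ≤ κ) (n : ℕ) :
    p * (p ^ κ) ^ n ≤ p ^ ⌈κ * n⌉₊ := by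
  calc p * (p ^ κ) ^ n = p ^ (κ * n + 1) := by
        rw [Real.rpow_add hp0, Real.rpow_one, Real.rpow_mul hp0.le, Real.rpow_natCast, mul_comm]
    _ ≤ p ^ ((⌈κ * n⌉₊ : ℕ) : ℝ) :=
        Real.rpow_le_rpow_of_exponent_ge hp0 hp1 (Nat.ceil_lt_add_one (by positivity)).le
    _ = _ := Real.rpow_natCast _ _

theorem pow_ceil_sub_one_le {p κ : ℝ} (hp0 : 0 < p) (hp1 : p ≤ 1) (n : ℕ) :
    p ^ (⌈κ * n⌉₊ - 1) ≤ p⁻¹ * (p ^ κ) ^ n := by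
  calc p ^ (⌈κ * n⌉₊ - 1) = p ^ ((⌈κ * n⌉₊ - 1 : ℕ) : ℝ) := (Real.rpow_natCast _ _).symm
    _ ≤ p ^ (κ * n - 1) := by
        refine Real.rpow_le_rpow_of_exponent_ge hp0 hp1 ?_
        have h1 := Nat.le_ceil (κ * n)
        have h2 : ((⌈κ * n⌉₊ : ℕ) : ℝ) ≤ ((⌈κ * n⌉₊ - 1 : ℕ) : ℝ) + 1 := by
          exact_mod_cast (by omega : ⌈κ * n⌉₊ ≤ ⌈κ * n⌉₊ - 1 + 1)
        linarith
    _ = _ := by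
        rw [Real.rpow_sub hp0, Real.rpow_one, Real.rpow_mul hp0.le, Real.rpow_natCast]
        field_simp

/-- A geometric sequence eventually beats a slower one, up to a power. -/
theorem eventually_pow_le_div {r R c : ℝ} (hr : 0 < r) (hrR : r < R) (hc : 0 < c) (A : ℕ) :
    ∀ᶠ j : ℕ in atTop, r ^ (j + 1) ≤ c * R ^ j / ((j : ℝ) + 1) ^ A := by
  have hR : 0 < R := hr.trans hrR
  have h := (tendsto_pow_const_mul_const_pow_of_abs_lt_one A (r := r / R) (by
    rw [abs_of_pos (by positivity), div_lt_one hR]; exact hrR)).comp (tendsto_add_atTop_nat 1)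
  filter_upwards [h.eventually (gt_mem_nhds (show 0 < c / R by positivity))] with j hj
  simp only [Function.comp_apply] at hj
  push_cast at hj
  rw [le_div_iff₀ (by positivity)]
  have h1 : ((j : ℝ) + 1) ^ A * (r / R) ^ (j + 1) * R ^ (j + 1) ≤ c / R * R ^ (j + 1) := by gcongr
  have h2 : ((j : ℝ) + 1) ^ A * (r / R) ^ (j + 1) * R ^ (j + 1)
      = r ^ (j + 1) * ((j : ℝ) + 1) ^ A := by
    rw [div_pow]; field_simp
  have h3 : c / R * R ^ (j + 1) = c * R ^ j := by rw [pow_succ]; field_simp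
  linarith

theorem log_natCast_le_of_le_two_pow {n j : ℕ} (hn : 0 < n) (h : n ≤ 2 ^ j) :
    Real.log n ≤ j * Real.log 2 := by
  rw [← Real.log_pow]
  exact Real.log_le_log (by exact_mod_cast hn) (by exact_mod_cast h)

theorem le_log_natCast_of_two_pow_le {n j : ℕ} (h : 2 ^ j ≤ n) :
    j * Real.log 2 ≤ Real.log n := by
  rw [← Real.log_pow]
  exact Real.log_le_log (by positivity) (by exact_mod_cast h)

variable [MeasurableSpace Ω] {μ : Measure Ω} [IsProbabilityMeasure μ]

/-- The probability `P(T_0 < T_b)` lies strictly between `0` and `1`, and it bounds the weights of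
the codes of excursions for every neighbour of the origin. -/
theorem firstPassage_prob (hd : 2 ≤ d) (hS : IsSimpleRandomWalk S μ) {b : Fin d → ℤ}
    (hb : b ∈ unitSteps d) :
    0 < μ.real {ω | firstPassage S 0 ω < firstPassage S b ω} ∧
    μ.real {ω | firstPassage S 0 ω < firstPassage S b ω} < 1 ∧
    ∀ e ∈ unitSteps d, ∀ T, codeWeight (unitSteps d) (excursions (unitSteps d) e T)
      ≤ μ.real {ω | firstPassage S 0 ω < firstPassage S b ω} := by
  have hb0 := ne_zero_of_mem_unitSteps hb
  obtain ⟨hmono, hlim⟩ := tendsto_codeWeight_excursions hd hS hb0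
  have hle := fun T => hmono.ge_of_tendsto hlim T
  have hcard : (0 : ℝ) < (unitSteps d).card := by
    exact_mod_cast (unitSteps_nonempty hd).card_pos
  refine ⟨?_, ?_, fun e he T => ?_⟩
  · exact lt_of_lt_of_le (codeWeight_excursions_pos hb (neg_mem_unitSteps.2 hb) hb0
      (neg_ne_self_of_mem_unitSteps hb) le_rfl) (hle 2)
  · refine lt_of_le_of_lt (le_of_tendsto' hlim fun T => codeWeight_excursions_le hb T) ?_
    have := inv_pos.2 hcard
    linarith
  · rw [codeWeight_excursions_unitSteps hd hb he]
    exact hle T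

/-- Almost surely `Θ_n ≥ n ^ (1 - δ - ε)` for all large `n`. For `2 ^ j ≤ n ≤ 2 ^ (j + 1)` the count
is at least the number of good splittings of the first `2 ^ j` steps that are not killed by the next
`2 ^ j` steps, with products of about `β δ log n` excursions as middle words. -/
theorem ae_eventually_le_log_frequentCount (hd : 2 ≤ d) (hS : IsSimpleRandomWalk S μ)
    {b : Fin d → ℤ} (hb : b ∈ unitSteps d) {δ ε : ℝ} (hδ : 0 < δ) (hε : 0 < ε) (hδε : δ + ε < 1) :
    ∀ᵐ ω ∂μ, ∀ᶠ n : ℕ in atTop, 1 - δ - ε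
      ≤ Real.log (frequentCount S (betaConst S μ b) δ n ω : ℝ) / Real.log n := by
  have hN := unitSteps_nonempty hd
  have hb0 := ne_zero_of_mem_unitSteps hb
  obtain ⟨hp0, hp1, -⟩ := firstPassage_prob hd hS hb
  obtain ⟨-, hlim⟩ := tendsto_codeWeight_excursions hd hS hb0
  rw [betaConst]
  generalize μ.real {ω | firstPassage S 0 ω < firstPassage S b ω} = p at hp0 hp1 hlim
  have hlogp : Real.log p < 0 := Real.log_neg hp0 hp1
  have hlog2 : 0 < Real.log 2 := Real.log_pos (by norm_num)
  obtain ⟨β, hβ⟩ : ∃ β, β = 1 / (-Real.log p) := ⟨_, rfl⟩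
  rw [← hβ]
  have hβ0 : 0 < β := by rw [hβ]; exact one_div_pos.2 (neg_pos.2 hlogp)
  obtain ⟨κ, hκ⟩ : ∃ κ, κ = β * δ * Real.log 2 := ⟨_, rfl⟩
  have hκ0 : 0 < κ := by rw [hκ]; positivity
  have hpκ : p ^ κ = 2 ^ (-δ) := by
    rw [Real.rpow_def_of_pos hp0, Real.rpow_def_of_pos (by norm_num : (0 : ℝ) < 2), hκ, hβ]
    congr 1
    have := hlogp.ne
    field_simp
  -- excursions of bounded length are enough, up to a small loss in the exponent
  obtain ⟨T, hTρ, hT2⟩ : ∃ T, (2 : ℝ) ^ (-(δ + ε / 2))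
      < codeWeight (unitSteps d) (excursions (unitSteps d) b T) ^ κ ∧ 2 ≤ T := by
    have h1 := (Real.continuousAt_rpow_const p κ (Or.inl hp0.ne')).tendsto.comp hlim
    rw [hpκ] at h1
    have h2 : (2 : ℝ) ^ (-(δ + ε / 2)) < 2 ^ (-δ) :=
      Real.rpow_lt_rpow_of_exponent_lt (by norm_num) (by linarith)
    exact ((h1.eventually (lt_mem_nhds h2)).and (eventually_ge_atTop 2)).exists
  obtain ⟨pT, hpT⟩ : ∃ pT, pT = codeWeight (unitSteps d) (excursions (unitSteps d) b T) := ⟨_, rfl⟩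
  rw [← hpT] at hTρ
  have hpT0 : 0 < pT := hpT ▸ codeWeight_excursions_pos hb (neg_mem_unitSteps.2 hb) hb0
    (neg_ne_self_of_mem_unitSteps hb) hT2
  have hpT1 : pT ≤ 1 := by
    refine hpT ▸ (codeWeight_excursions_le hb T).trans ?_
    have : (0 : ℝ) ≤ ((unitSteps d).card : ℝ)⁻¹ := by positivity
    linarith
  obtain ⟨ρ, hρ⟩ : ∃ ρ, ρ = pT ^ κ := ⟨_, rfl⟩
  rw [← hρ] at hTρ
  have hρ0 : 0 < ρ := hρ ▸ Real.rpow_pos_of_pos hpT0 κ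
  have hρhalf : 1 / 2 < ρ := by
    refine lt_of_le_of_lt ?_ hTρ
    rw [show (1 : ℝ) / 2 = 2 ^ (-1 : ℝ) by rw [Real.rpow_neg_one]; norm_num]
    exact Real.rpow_le_rpow_of_exponent_le (by norm_num) (by linarith)
  have hr2ρ : (2 : ℝ) ^ (1 - δ - ε) < 2 * ρ := by
    calc (2 : ℝ) ^ (1 - δ - ε) < 2 ^ (1 + -(δ + ε / 2)) :=
          Real.rpow_lt_rpow_of_exponent_lt (by norm_num) (by linarith)
      _ = 2 * 2 ^ (-(δ + ε / 2)) := by rw [Real.rpow_add (by norm_num), Real.rpow_one]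
      _ < 2 * ρ := by linarith
  -- `k j + 1` visits are enough for all `n ≤ 2 ^ (j + 1)`
  obtain ⟨k, hk⟩ : ∃ k : ℕ → ℕ, ∀ j, k j = ⌈κ * ((j + 1 : ℕ) : ℝ)⌉₊ := ⟨_, fun _ => rfl⟩
  have hk0 : ∀ j, k j ≠ 0 := fun j => by
    rw [hk]
    exact (Nat.ceil_pos.2 (by positivity)).ne'
  obtain ⟨C, hC, hhit⟩ := exists_wordProb_hits_le hd
  obtain ⟨A, i₁, hmono⟩ := exists_escapeProb_mul_pow_monotone hd hb
  have hpos := fun i => lt_of_lt_of_le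
    (div_pos (one_div_pos.2 (by exact_mod_cast hN.card_pos)) (by positivity))
    (escapeProb_unitSteps_pos hd hb i)
  obtain ⟨K', j₀, hvar⟩ := exists_wordProb_le_varScale hN (fun e => neg_mem_unitSteps) {0, b, -b} hC
    hhit hmono hpos (𝓛 := fun j => powCode (excursions (unitSteps d) b T) (k j))
    (L := fun j => T * k j) (fun j => isLoopCode_powCode_excursions _ hb0 T (hk0 j))
    (K := T * ⌈κ⌉₊) (fun j => by
      rw [mul_assoc]
      refine Nat.mul_le_mul_left T ?_
      rw [hk, Nat.ceil_le]
      push_cast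
      gcongr
      exact Nat.le_ceil κ)
    (c₀ := pT * ρ) (ρ := ρ) (by positivity) hρhalf (fun j => by
      rw [(excursions_prefixFree _ _ _).codeWeight_pow, ← hpT, hk]
      refine le_trans (le_of_eq ?_) (rpow_le_pow_ceil hpT0 hpT1 hκ0.le (j + 1))
      rw [← hρ, pow_succ]
      ring)
  -- the mean number of good splittings is large
  obtain ⟨c₁, hc₁⟩ : ∃ c₁, c₁ = escapeProb (unitSteps d)
    (({0, b, -b} : Finset (Fin d → ℤ)) : Set (Fin d → ℤ)) (2 ^ i₁) * ((i₁ : ℝ) + 1) ^ A := ⟨_, rfl⟩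
  have hc₁0 : 0 < c₁ := hc₁ ▸ mul_pos (hpos i₁) (by positivity)
  have hlow : ∀ j ≥ i₁, c₁ ≤ escapeProb (unitSteps d)
      (({0, b, -b} : Finset (Fin d → ℤ)) : Set (Fin d → ℤ)) (2 ^ j) * ((j : ℝ) + 1) ^ A := by
    intro j hj
    induction j, hj using Nat.le_induction with
    | base => exact hc₁.le
    | succ j hj ih =>
      refine ih.trans ((hmono j hj).trans (le_of_eq ?_))
      push_cast
      ring
  have hbig := eventually_pow_le_div (r := 2 ^ (1 - δ - ε)) (R := 2 * ρ)
    (c := pT * ρ * c₁ ^ 2 / 8) (by positivity) hr2ρ (by positivity) (2 * A)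
  filter_upwards [hS.start, ae_eventually_not_stepWord hd hS (fun j => 2 ^ j + 2 ^ j) _
    (summable_varScale.mul_left K') hvar] with ω hω0 hω
  obtain ⟨j₁, hj₁⟩ := eventually_atTop.1 ((hω.and hbig).and (eventually_ge_atTop (i₁ + 1)))
  filter_upwards [eventually_ge_atTop (2 ^ j₁)] with n hn
  have hn0 : n ≠ 0 := by have := Nat.one_le_two_pow (n := j₁); omega
  obtain ⟨j, hj⟩ : ∃ j, j = Nat.log 2 n := ⟨_, rfl⟩
  have hjn : 2 ^ j ≤ n := hj ▸ Nat.pow_log_le_self 2 hn0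
  have hnj : n < 2 ^ (j + 1) := hj ▸ Nat.lt_pow_succ_log_self (by norm_num) n
  have hjj : j₁ ≤ j := hj ▸ Nat.le_log_of_pow_le (by norm_num) hn
  obtain ⟨⟨hnot, hbigj⟩, hji⟩ := hj₁ j hjj
  rw [not_lt] at hnot
  have hlogn : 0 < Real.log n := by
    refine lt_of_lt_of_le ?_ (le_log_natCast_of_two_pow_le hjn)
    have : (0 : ℝ) < j := by exact_mod_cast (by omega : 0 < j)
    positivity
  set w := stepWord S (2 ^ j + 2 ^ j) ω with hw
  have hlen₁ : (w.take (2 ^ j)).length = 2 ^ j := by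
    rw [hw, take_stepWord (by omega), length_stepWord]
  have hcount := goodCount_sub_killedCount_le (N := unitSteps d) hb0
    (Z := (({0, b, -b} : Finset (Fin d → ℤ)) : Set (Fin d → ℤ)))
    (by simp) (by simp) (by simp) T (k j)
    (w₁ := w.take (2 ^ j)) (w₂ := w.drop (2 ^ j)) (X := fun i => S i ω) (by
      intro i hi
      rw [List.take_append_drop, hw, length_stepWord] at hi
      rw [List.take_append_drop]
      exact eq_sum_take_stepWord hω0 hi)
  rw [List.take_append_drop, hlen₁, hw, length_stepWord, ← hw] at hcount
  have hsub : ({x | (∃ i ≤ 2 ^ j, S i ω = x) ∧ (∀ i ≤ 2 ^ j + 2 ^ j, S i ω ≠ x + b) ∧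
      k j + 1 ≤ ((Finset.range (2 ^ j + 1)).filter (fun i => S i ω = x)).card} :
        Set (Fin d → ℤ)).ncard
      ≤ frequentCount S β δ n ω := by
    refine Set.ncard_le_ncard ?_ (frequentCount_finite β δ n ω)
    rintro x ⟨⟨i, hi, rfl⟩, h2, h3⟩
    refine ⟨⟨⟨i, by omega, rfl⟩, fun hc => ?_⟩, ?_⟩
    · have hmem : S i ω + b ∈ latticeNeighbors (S i ω) := by
        have := mem_unitSteps_iff.1 hb
        simpa [latticeNeighbors] using this
      obtain ⟨i', hi', h4⟩ := hc hmem
      refine h2 i' ?_ h4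
      rw [pow_succ] at hnj
      omega
    · rw [ge_iff_le, le_div_iff₀ hlogn, visitCount_eq_card]
      have h4 : ((Finset.range (2 ^ j + 1)).filter (fun i' => S i' ω = S i ω)).card
          ≤ ((Finset.range (n + 1)).filter (fun i' => S i' ω = S i ω)).card :=
        Finset.card_le_card (Finset.filter_subset_filter _ (Finset.range_subset_range.2 (by omega)))
      have h5 : ((k j : ℕ) : ℝ) ≤
          (((Finset.range (n + 1)).filter (fun i' => S i' ω = S i ω)).card : ℝ) := by
        exact_mod_cast (by omega : k j ≤ _)
      refine le_trans ?_ h5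
      calc β * δ * Real.log n ≤ β * δ * (((j + 1 : ℕ) : ℝ) * Real.log 2) := by
            gcongr
            exact log_natCast_le_of_le_two_pow (Nat.pos_of_ne_zero hn0) hnj.le
        _ = κ * ((j + 1 : ℕ) : ℝ) := by rw [hκ]; ring
        _ ≤ k j := by rw [hk]; exact Nat.le_ceil _
  -- put the bounds together
  have hmain : ((2 : ℝ) ^ (1 - δ - ε)) ^ (j + 1) ≤ (frequentCount S β δ n ω : ℝ) := by
    have hcount' : _ ≤ (frequentCount S β δ n ω : ℝ) := hcount.trans (by
      refine le_trans (le_of_eq ?_) (Nat.cast_le.2 hsub)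
      congr!)
    refine (hbigj.trans ?_).trans (hnot.trans hcount')
    have ha := hlow j (by omega)
    have hπ : pT * ρ * ρ ^ j ≤ codeWeight (unitSteps d)
        (powCode (excursions (unitSteps d) b T) (k j)) := by
      rw [(excursions_prefixFree _ _ _).codeWeight_pow, ← hpT, hk]
      refine le_trans (le_of_eq ?_) (rpow_le_pow_ceil hpT0 hpT1 hκ0.le (j + 1))
      rw [← hρ, pow_succ]
      ring
    generalize escapeProb (unitSteps d)
      (({0, b, -b} : Finset (Fin d → ℤ)) : Set (Fin d → ℤ)) (2 ^ j) = a at ha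
    generalize codeWeight (unitSteps d) (powCode (excursions (unitSteps d) b T) (k j)) = π at hπ
    have hπ0 : 0 ≤ π := le_trans (by positivity) hπ
    have ha2 : c₁ ^ 2 / ((j : ℝ) + 1) ^ (2 * A) ≤ a ^ 2 := by
      rw [div_le_iff₀ (by positivity), mul_comm 2 A, pow_mul, ← mul_pow]
      gcongr
    calc pT * ρ * c₁ ^ 2 / 8 * (2 * ρ) ^ j / ((j : ℝ) + 1) ^ (2 * A)
        = 2 ^ j * (pT * ρ * ρ ^ j) * (c₁ ^ 2 / ((j : ℝ) + 1) ^ (2 * A)) / 8 := by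
          rw [mul_pow]; ring
      _ ≤ 2 ^ j * π * a ^ 2 / 8 := by gcongr
  rw [le_div_iff₀ hlogn]
  have h1 : 0 ≤ 1 - δ - ε := by linarith
  calc (1 - δ - ε) * Real.log n ≤ (1 - δ - ε) * (((j + 1 : ℕ) : ℝ) * Real.log 2) := by
        gcongr
        exact log_natCast_le_of_le_two_pow (Nat.pos_of_ne_zero hn0) hnj.le
    _ = Real.log (((2 : ℝ) ^ (1 - δ - ε)) ^ (j + 1)) := by
        rw [Real.log_pow, Real.log_rpow (by norm_num)]; ring
    _ ≤ _ := Real.log_le_log (by positivity) hmain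

/-- Almost surely `Θ_n ≤ n ^ (1 - δ + ε)` for all large `n`, by the first moment bound along the
powers of `2`. -/
theorem ae_eventually_log_frequentCount_le (hd : 2 ≤ d) (hS : IsSimpleRandomWalk S μ)
    {b : Fin d → ℤ} (hb : b ∈ unitSteps d) {δ ε : ℝ} (hδ : 0 < δ) (hε : 0 < ε) (hδ1 : δ < 1) :
    ∀ᵐ ω ∂μ, ∀ᶠ n : ℕ in atTop,
      Real.log (frequentCount S (betaConst S μ b) δ n ω : ℝ) / Real.log n ≤ 1 - δ + ε := by
  have hN := unitSteps_nonempty hd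
  obtain ⟨hp0, hp1, hpe⟩ := firstPassage_prob hd hS hb
  rw [betaConst]
  generalize μ.real {ω | firstPassage S 0 ω < firstPassage S b ω} = p at hp0 hp1 hpe
  have hlogp : Real.log p < 0 := Real.log_neg hp0 hp1
  have hlog2 : 0 < Real.log 2 := Real.log_pos (by norm_num)
  obtain ⟨β, hβ⟩ : ∃ β, β = 1 / (-Real.log p) := ⟨_, rfl⟩
  rw [← hβ]
  have hβ0 : 0 < β := by rw [hβ]; exact one_div_pos.2 (neg_pos.2 hlogp)
  obtain ⟨κ, hκ⟩ : ∃ κ, κ = β * δ * Real.log 2 := ⟨_, rfl⟩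
  have hκ0 : 0 < κ := by rw [hκ]; positivity
  have hpκ : p ^ κ = 2 ^ (-δ) := by
    rw [Real.rpow_def_of_pos hp0, Real.rpow_def_of_pos (by norm_num : (0 : ℝ) < 2), hκ, hβ]
    congr 1
    have := hlogp.ne
    field_simp
  -- for `n ≥ 2 ^ j` at least `κ j` visits are required, and the first one is not a return
  obtain ⟨k, hk⟩ : ∃ k : ℕ → ℕ, ∀ j, k j = ⌈κ * (j : ℝ)⌉₊ - 1 := ⟨_, fun _ => rfl⟩
  obtain ⟨t, ht⟩ : ∃ t : ℝ, t = 2 ^ (1 - δ + ε) := ⟨_, rfl⟩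
  have ht0 : 0 < t := by rw [ht]; positivity
  have hprob : ∀ j ≥ 0, wordProb (unitSteps d) (2 ^ (j + 1))
      (fun w => t ^ j ≤ occurrenceCount (unitSteps d) (k j) w)
      ≤ 4 * (unitSteps d).card * p⁻¹ * ((2 : ℝ) ^ (-ε)) ^ j := by
    intro j _
    refine (wordProb_le_of_mean _ _ _ (occurrenceCount (unitSteps d) (k j)) (pow_pos ht0 j)
      (fun w _ => occurrenceCount_nonneg _ _ w) (fun w _ h => h)).trans ?_
    have h1 := wordMean_occurrences_le hN (n := 2 ^ (j + 1)) (fun e he => hpe e he _) (k j)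
    have h2 : p ^ k j ≤ p⁻¹ * ((2 : ℝ) ^ (-δ)) ^ j := by
      rw [hk, ← hpκ]
      exact pow_ceil_sub_one_le hp0 hp1.le j
    have h3 : wordMean (unitSteps d) (2 ^ (j + 1)) (occurrenceCount (unitSteps d) (k j))
        ≤ 4 * 2 ^ j * (unitSteps d).card * (p⁻¹ * ((2 : ℝ) ^ (-δ)) ^ j) := by
      refine h1.trans ?_
      have h4 : ((2 ^ (j + 1) : ℕ) : ℝ) + 1 ≤ 4 * 2 ^ j := by
        have : (1 : ℝ) ≤ 2 ^ j := one_le_pow₀ (by norm_num)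
        push_cast
        rw [pow_succ]
        linarith
      gcongr
    rw [div_le_iff₀ (pow_pos ht0 j)]
    refine h3.trans (le_of_eq ?_)
    have h5 : (2 : ℝ) * 2 ^ (-δ) = 2 ^ (-ε) * t := by
      rw [ht, ← Real.rpow_add (by norm_num)]
      nth_rewrite 1 [← Real.rpow_one 2]
      rw [← Real.rpow_add (by norm_num)]
      congr 1
      ring
    calc _ = 4 * (unitSteps d).card * p⁻¹ * ((2 : ℝ) * 2 ^ (-δ)) ^ j := by rw [mul_pow]; ring
      _ = _ := by rw [h5, mul_pow]; ring
  have hsummable : Summable fun j : ℕ =>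
      4 * ((unitSteps d).card : ℝ) * p⁻¹ * ((2 : ℝ) ^ (-ε)) ^ j := by
    refine Summable.mul_left _ (summable_geometric_of_lt_one (by positivity) ?_)
    exact Real.rpow_lt_one_of_one_lt_of_neg (by norm_num) (by linarith)
  filter_upwards [hS.start, ae_forall_step_mem hd hS,
    ae_eventually_not_stepWord hd hS (fun j => 2 ^ (j + 1)) _ hsummable hprob] with ω hω0 hstep hω
  obtain ⟨j₁, hj₁⟩ := eventually_atTop.1 (hω.and (eventually_ge_atTop 1))
  filter_upwards [eventually_ge_atTop (2 ^ j₁)] with n hn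
  have hn0 : n ≠ 0 := by have := Nat.one_le_two_pow (n := j₁); omega
  obtain ⟨j, hj⟩ : ∃ j, j = Nat.log 2 n := ⟨_, rfl⟩
  have hjn : 2 ^ j ≤ n := hj ▸ Nat.pow_log_le_self 2 hn0
  have hnj : n < 2 ^ (j + 1) := hj ▸ Nat.lt_pow_succ_log_self (by norm_num) n
  have hjj : j₁ ≤ j := hj ▸ Nat.le_log_of_pow_le (by norm_num) hn
  obtain ⟨hnot, hji⟩ := hj₁ j hjj
  rw [not_le] at hnot
  have hj0 : (0 : ℝ) < j := by exact_mod_cast (by omega : 0 < j)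
  have hlogn : 0 < Real.log n :=
    lt_of_lt_of_le (by positivity) (le_log_natCast_of_two_pow_le hjn)
  set w := stepWord S (2 ^ (j + 1)) ω with hw
  have hlen : w.length = 2 ^ (j + 1) := length_stepWord _ _
  have hcount := ncard_frequent_le (N := unitSteps d) (k := k j) (n := n) (w := w)
    (fun e he => by
      obtain ⟨i, -, rfl⟩ := List.mem_map.1 he
      exact hstep i) (by omega) (X := fun i => S i ω)
    (fun i hi => eq_sum_take_stepWord hω0 (by omega))
  have hsub : frequentCount S β δ n ω ≤ ({x | (∃ e ∈ unitSteps d, ∀ i ≤ n, S i ω ≠ x + e) ∧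
      k j + 1 ≤ ((Finset.range (n + 1)).filter (fun i => S i ω = x)).card} :
        Set (Fin d → ℤ)).ncard := by
    refine Set.ncard_le_ncard ?_ ?_
    · rintro x ⟨⟨-, h2⟩, h3⟩
      obtain ⟨z, hz, hzn⟩ := Set.not_subset.1 h2
      refine ⟨⟨z - x, ?_, fun i hi h => hzn ⟨i, hi, by rw [h]; abel⟩⟩, ?_⟩
      · rw [mem_unitSteps_iff]
        simpa [latticeNeighbors] using hz
      · rw [ge_iff_le, le_div_iff₀ hlogn, visitCount_eq_card] at h3
        have h1 : 0 < ⌈κ * (j : ℝ)⌉₊ := Nat.ceil_pos.2 (by positivity)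
        rw [hk, Nat.sub_add_cancel h1, Nat.ceil_le]
        refine le_trans ?_ h3
        calc κ * j = β * δ * (j * Real.log 2) := by rw [hκ]; ring
          _ ≤ β * δ * Real.log n := by
              gcongr
              exact le_log_natCast_of_two_pow_le hjn
    · refine ((Finset.range (n + 1)).image (fun i => S i ω)).finite_toSet.subset ?_
      rintro x ⟨-, h⟩
      obtain ⟨i, hi⟩ := Finset.card_pos.1 (lt_of_lt_of_le (Nat.succ_pos _) h)
      rw [Finset.mem_filter] at hi
      exact Finset.mem_coe.2 (Finset.mem_image.2 ⟨i, hi.1, hi.2⟩)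
  have hmain : (frequentCount S β δ n ω : ℝ) ≤ t ^ j :=
    ((Nat.cast_le.2 hsub).trans (le_trans (le_of_eq (by congr!)) hcount)).trans hnot.le
  rw [div_le_iff₀ hlogn]
  have h1 : 0 ≤ 1 - δ + ε := by linarith
  -- if the count vanishes, so does its logarithm in Lean, and the bound holds as `1 - δ + ε ≥ 0`
  rcases Nat.eq_zero_or_pos (frequentCount S β δ n ω) with h | h
  · rw [h, Nat.cast_zero, Real.log_zero]
    positivity
  calc Real.log (frequentCount S β δ n ω : ℝ) ≤ Real.log (t ^ j) :=
        Real.log_le_log (by exact_mod_cast h) hmain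
    _ = (1 - δ + ε) * (j * Real.log 2) := by
        rw [Real.log_pow, ht, Real.log_rpow (by norm_num)]; ring
    _ ≤ _ := by
        gcongr
        exact le_log_natCast_of_two_pow_le hjn

end Bounds

end LatticeWalk

end

theorem theorem2p2 {Ω : Type*} [MeasurableSpace Ω] (μ : Measure Ω) [IsProbabilityMeasure μ]
    (d : ℕ) (hd : 2 ≤ d) (S : ℕ → Ω → Fin d → ℤ) (hS : IsSimpleRandomWalk S μ)
    (b : Fin d → ℤ) (hb : b ∈ latticeNeighbors (0 : Fin d → ℤ))
    (δ : ℝ) (hδ0 : 0 < δ) (hδ1 : δ < 1) :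
    ∀ᵐ ω ∂μ, Tendsto
      (fun n : ℕ => Real.log (frequentCount S (betaConst S μ b) δ n ω : ℝ) / Real.log (n : ℝ))
      atTop (𝓝 (1 - δ)) := by
  rw [← LatticeWalk.mem_unitSteps_iff] at hb
  have hε : ∀ m : ℕ, 0 < (1 - δ) / ((m : ℝ) + 2) := fun m => div_pos (by linarith) (by positivity)
  have hε1 : ∀ m : ℕ, δ + (1 - δ) / ((m : ℝ) + 2) < 1 := fun m => by
    have h1 : (1 - δ) / ((m : ℝ) + 2) < 1 - δ := by
      have : (0 : ℝ) ≤ m := by positivity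
      exact div_lt_self (by linarith) (by linarith)
    linarith
  have hlow := ae_all_iff.2 fun m : ℕ =>
    LatticeWalk.ae_eventually_le_log_frequentCount hd hS hb hδ0 (hε m) (hε1 m)
  have hup := ae_all_iff.2 fun m : ℕ =>
    LatticeWalk.ae_eventually_log_frequentCount_le hd hS hb hδ0 (hε m) hδ1
  have hlim : Tendsto (fun m : ℕ => (1 - δ) / ((m : ℝ) + 2)) atTop (𝓝 0) :=
    tendsto_const_nhds.div_atTop (tendsto_atTop_add_const_right _ _ tendsto_natCast_atTop_atTop)
  filter_upwards [hlow, hup] with ω h1 h2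
  rw [Metric.tendsto_nhds]
  intro η hη
  obtain ⟨m, hm⟩ := (hlim.eventually (gt_mem_nhds hη)).exists
  filter_upwards [h1 m, h2 m] with n h3 h4
  rw [Real.dist_eq, abs_lt]
  constructor <;> linarith
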